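/- Let $k$ be a field, $M$ a free abelian group of finite rank, $N=\mathrm{Hom}(M,\mathbb{Z})$ and $N_{\mathbb{R}}=\mathrm{Hom}(M,\mathbb{R})$. A fan is a finite set of strongly convex rational polyhedral cones that is closed under taking faces and in which any two cones meet in a common face. For a fan $\Sigma$ in $N_{\mathbb{R}}$ and a field $F$, let $Y_{\Sigma}$ be the toric variety over $F$ glued from the affine charts $U_\sigma=\mathrm{Spec}\,F[S_\sigma]$, $S_\sigma=\{u\in M:\langle u,v\rangle\ge 0\text{ for all }v\in\sigma\}$, $\sigma\in\Sigma$. Let $\Delta$ be a fan in $N_{\mathbb{R}}\times\mathbb{R}$ (with lattice $N\times\mathbb{Z}$ and character lattice $M\times\mathbb{Z}$) whose support is $N_{\mathbb{R}}\times\mathbb{R}_{\ge 0}$, and let $\Sigma=\Delta\cap(N_{\mathbb{R}}\times\{0\})$, which is a complete fan in $N_{\mathbb{R}}$. Let $f:Y_\Delta\to\mathbb{A}^1=\mathrm{Spec}\,k[t]$ be the toric morphism of $k$-varieties induced by the second projection, so that $t$ pulls back to the character $\chi^{(0,1)}$. Let $C_\Delta$ be the polyhedral complex in $N_{\mathbb{R}}$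 whose cells are the nonempty slices $\{v:(v,1)\in\delta\}$, $\delta\in\Delta$. For a cell $P$, with cone $\delta_P\in\Delta$ over it, let $\mathrm{star}(P)$ be the fan of images of the cones $\delta\supseteq\delta_P$ of $\Delta$ in $(N_{\mathbb{R}}\times\mathbb{R})/\mathrm{span}(\delta_P)$, with character lattice $\delta_P^{\perp}\cap(M\times\mathbb{Z})$, and let $Y_{\mathrm{star}(P)}$ be its toric variety over $k$. Then $f$ is surjective, and: (i) The generic fiber $Y_\Delta\times_{\mathbb{A}^1}\mathrm{Spec}\,k(t)$ is the toric $k(t)$-variety $Y_\Sigma$. More precisely, there is a morphism $g:Y_\Sigma\to Y_\Delta$, given on charts by $\chi^{(u,n)}\mapsto t^n\chi^u$, which identifies $Y_\Sigma\to\mathrm{Spec}\,k(t)$ with the base change of $f$ along $\mathrm{Spec}\,k(t)\to\mathbb{A}^1$. (ii) Let $X_0$ be the scheme-theoretic fiber $f^{-1}(0)$ with its reduced structure. There are closed immersions $\iota_P:Y_{\mathrm{star}(P)}\to X_0$, one for each cell $P$ of $C_\Delta$, whose composite with $X_0\to Y_\Delta$ is given on the chart of each $\delta\supseteq\delta_P$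 by $\chi^m\mapsto\chi^m$ if $m\in\delta_P^\perp$ and $\chi^m\mapsto 0$ otherwise; and for cells $P\subseteq Q$ the immersion $\iota_Q$ factors through $\iota_P$ by a morphism $j_{P,Q}:Y_{\mathrm{star}(Q)}\to Y_{\mathrm{star}(P)}$. These have the following properties. * $X_0$ is the union of the images of the $\iota_v$, where $v$ runs over the vertices of $C_\Delta$. * For cells $P,Q$, if some cell contains both and $R$ is the smallest such cell, then $Y_{\mathrm{star}(R)}=Y_{\mathrm{star}(P)}\times_{X_0}Y_{\mathrm{star}(Q)}$; if no cell contains both, then $Y_{\mathrm{star}(P)}$ and $Y_{\mathrm{star}(Q)}$ are disjoint in $X_0$. * If $v$ is a vertex of an edge (one-dimensional cell) $e$, then the image of $j_{v,e}$ is a torus-invariant prime divisor of $Y_{\mathrm{star}(v)}$. * $X_0$ is obtained by gluing the $Y_{\mathrm{star}(v)}$ along these divisors: for every scheme $T$ and every family of morphisms $g_v:Y_{\mathrm{star}(v)}\to T$, indexed by the vertices of $C_\Delta$, such that $g_v\circ j_{v,e}=g_w\circ j_{w,e}$ for every edge $e$ with vertices $v,w$, there is a unique morphism $\varphi:X_0\to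 T$ with $\varphi\circ\iota_v=g_v$ for all $v$. If all vertices of $C_\Delta$ lie in $N$, then the scheme-theoretic fiber $f^{-1}(0)$ is itself reduced, so that it is equal to $X_0$. -/

import Mathlib

open CategoryTheory CategoryTheory.Limits AlgebraicGeometry

universe u

namespace Toric

section Cones

/-- The real vector space `N_ℝ = N ⊗ ℝ = Hom(M, ℝ)` attached to the character lattice `M`, where
`N = Hom(M, ℤ)`.  The canonical pairing `⟨m, v⟩` is evaluation `v m`. -/
abbrev NR (M : Type u) [AddCommGroup M] : Type u := M →+ ℝ

variable {M : Type u} [AddCommGroup M]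

/-- The inclusion of the cocharacter lattice `N = Hom(M, ℤ)` into `N_ℝ`. -/
def toNR (n : M →+ ℤ) : NR M := (Int.castAddHom ℝ).comp n

@[simp] lemma toNR_apply (n : M →+ ℤ) (m : M) : toNR n m = (n m : ℝ) := rfl

/-- Rational polyhedral cones: those generated by finitely many lattice vectors. -/
def IsRational (σ : PointedCone ℝ (NR M)) : Prop :=
  ∃ G : Finset (M →+ ℤ), σ = PointedCone.hull ℝ (toNR '' (G : Set (M →+ ℤ)))

/-- The semigroup `S_σ = {m ∈ M : ⟨m, v⟩ ≥ 0 for all v ∈ σ}`. -/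
def dualMonoid (σ : PointedCone ℝ (NR M)) : AddSubmonoid M where
  carrier := {m | ∀ v ∈ σ, 0 ≤ v m}
  zero_mem' := by simp
  add_mem' := by
    intro a b ha hb v hv
    rw [map_add]
    exact add_nonneg (ha v hv) (hb v hv)

lemma mem_dualMonoid {σ : PointedCone ℝ (NR M)} {m : M} :
    m ∈ dualMonoid σ ↔ ∀ v ∈ σ, 0 ≤ v m := Iff.rfl

lemma dualMonoid_anti {σ τ : PointedCone ℝ (NR M)} (h : τ ≤ σ) : dualMonoid σ ≤ dualMonoid τ :=
  fun _ hm v hv => hm v (h hv)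

/-- The sublattice `σ^⊥ ∩ M` of characters vanishing on `σ`. -/
def perp (σ : PointedCone ℝ (NR M)) : AddSubgroup M where
  carrier := {m | ∀ v ∈ σ, v m = 0}
  zero_mem' := by simp
  add_mem' := by
    intro a b ha hb v hv
    rw [map_add, ha v hv, hb v hv, add_zero]
  neg_mem' := by
    intro a ha v hv
    rw [map_neg, ha v hv, neg_zero]

lemma mem_perp {σ : PointedCone ℝ (NR M)} {m : M} : m ∈ perp σ ↔ ∀ v ∈ σ, v m = 0 := Iff.rfl

/-- Farkas' lemma over the integers. -/
lemma farkas (n : ℕ) : ∀ (l : List (M →+ ℤ)), l.length = n → ∀ b : M →+ ℤ,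
    toNR b ∈ PointedCone.hull ℝ (toNR '' {a | a ∈ l}) ∨ ∃ x : M, (∀ a ∈ l, 0 ≤ a x) ∧ b x < 0 := by
  induction n with
  | zero =>
    intro l hl b
    obtain rfl := List.length_eq_zero_iff.mp hl
    by_cases hb : b = 0
    · left
      have : toNR b = 0 := by ext m; simp [hb]
      rw [this]; exact zero_mem _
    · right
      obtain ⟨x, hx⟩ := DFunLike.ne_iff.mp hb
      rcases lt_or_gt_of_ne hx with h | h
      · exact ⟨x, by simp, by simpa using h⟩
      · exact ⟨-x, by simp, by simpa using h⟩
  | succ n ih =>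
    intro l hl b
    obtain ⟨a₀, l, rfl⟩ := List.exists_cons_of_length_eq_add_one hl
    have hl' : l.length = n := by simpa using hl
    rcases ih l hl' b with h | ⟨x, hx, hbx⟩
    · left
      refine Submodule.span_mono (Set.image_mono ?_) h
      exact fun a ha => List.mem_cons_of_mem _ ha
    by_cases hax : 0 ≤ a₀ x
    · right
      refine ⟨x, ?_, hbx⟩
      intro a ha
      rcases List.mem_cons.mp ha with rfl | h
      exacts [hax, hx a h]
    push Not at hax
    set c : ℤ := -a₀ x with hc
    have hc0 : 0 < c := by omega
    set T : (M →+ ℤ) → (M →+ ℤ) := fun a => c • a + a x • a₀ with hT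
    have hTa : ∀ a y, T a y = a (c • y + a₀ y • x) := by
      intro a y
      simp [hT, mul_comm]
    rcases ih (l.map T) (by simpa using hl') (T b) with h | ⟨y, hy, hby⟩
    · left
      set C := PointedCone.hull ℝ (toNR '' {a | a ∈ a₀ :: l}) with hC
      have hgen : ∀ a ∈ a₀ :: l, toNR a ∈ C := fun a ha => Submodule.subset_span ⟨a, ha, rfl⟩
      have hle : PointedCone.hull ℝ (toNR '' {a | a ∈ l.map T}) ≤ C := by
        refine Submodule.span_le.mpr ?_
        rintro _ ⟨a', ha', rfl⟩
        obtain ⟨a, ha, rfl⟩ := List.mem_map.mp ha'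
        have e : toNR (T a) = (c : ℝ) • toNR a + (a x : ℝ) • toNR a₀ := by
          ext m; simp [hT]
        rw [e]
        refine add_mem (C.smul_mem (by exact_mod_cast hc0.le) (hgen a (by simp [ha])))
          (C.smul_mem (by exact_mod_cast hx a ha) (hgen a₀ (by simp)))
      have h1 := hle h
      have h2 : toNR b = (c : ℝ)⁻¹ • (toNR (T b) + (-(b x : ℝ)) • toNR a₀) := by
        have : (c : ℝ) ≠ 0 := by exact_mod_cast hc0.ne'
        ext m
        simp [hT]
        field_simp
        ring
      rw [h2]
      refine C.smul_mem (by positivity) (add_mem h1 (C.smul_mem ?_ (hgen a₀ (by simp))))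
      have : (b x : ℝ) < 0 := by exact_mod_cast hbx
      linarith
    · right
      refine ⟨c • y + a₀ y • x, ?_, by rw [← hTa]; exact hby⟩
      intro a ha
      rcases List.mem_cons.mp ha with rfl | h
      · simp [hc, mul_comm]
      · rw [← hTa]; exact hy _ (List.mem_map_of_mem h)

/-- Every face of a rational polyhedral cone is cut out by a supporting lattice hyperplane. -/
lemma exists_exposing {σ τ : PointedCone ℝ (NR M)} (hσ : IsRational σ) (hτ : τ.IsFaceOf σ) :
    ∃ u ∈ dualMonoid σ, ∀ x ∈ σ, (x ∈ τ ↔ x u = 0) := by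
  classical
  obtain ⟨G, rfl⟩ := hσ
  set σ := PointedCone.hull ℝ (toNR '' (G : Set (M →+ ℤ))) with hσ
  have hgen : ∀ a ∈ G, toNR a ∈ σ := fun a ha => Submodule.subset_span ⟨a, ha, rfl⟩
  have key : ∀ g ∈ G, toNR g ∉ τ →
      ∃ u ∈ dualMonoid σ, (∀ a ∈ G, toNR a ∈ τ → a u = 0) ∧ 0 < g u := by
    intro g hg hgτ
    set l : List (M →+ ℤ) := G.toList ++ ((G.filter fun a => toNR a ∈ τ).toList.map fun a => -a)
      with hl
    rcases farkas l.length l rfl (-g) with h | ⟨u, hu, hgu⟩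
    · exfalso
      have : ∀ y ∈ PointedCone.hull ℝ (toNR '' {a | a ∈ l}), ∃ t ∈ τ, y + t ∈ σ := by
        intro y hy
        induction hy using Submodule.span_induction with
        | mem y hy =>
          obtain ⟨a, ha, rfl⟩ := hy
          rcases List.mem_append.mp ha with h | h
          · exact ⟨0, zero_mem _, by simpa using hgen a (by simpa using h)⟩
          · obtain ⟨a', ha', rfl⟩ := List.mem_map.mp h
            simp only [Finset.mem_toList, Finset.mem_filter] at ha'
            refine ⟨toNR a', ha'.2, ?_⟩
            have : toNR (-a') + toNR a' = 0 := by ext m; simp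
            rw [this]; exact zero_mem _
        | zero => exact ⟨0, zero_mem _, by simp⟩
        | add y z _ _ hy hz =>
          obtain ⟨t, ht, h1⟩ := hy
          obtain ⟨s, hs, h2⟩ := hz
          refine ⟨t + s, add_mem ht hs, ?_⟩
          have : y + z + (t + s) = (y + t) + (z + s) := by abel
          rw [this]; exact add_mem h1 h2
        | smul c y _ hy =>
          obtain ⟨t, ht, h1⟩ := hy
          refine ⟨c • t, Submodule.smul_mem _ c ht, ?_⟩
          rw [← smul_add]; exact Submodule.smul_mem _ c h1
      obtain ⟨t, ht, hs⟩ := this _ h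
      refine hgτ (hτ.mem_of_add_mem_left (hgen g hg) hs ?_)
      have : toNR g + (toNR (-g) + t) = t := by ext m; simp
      rwa [this]
    · refine ⟨u, ?_, ?_, by simpa using hgu⟩
      · intro v hv
        induction hv using Submodule.span_induction with
        | mem y hy =>
          obtain ⟨a, ha, rfl⟩ := hy
          have := hu a (by simp [hl]; left; exact ha)
          simpa using this
        | zero => simp
        | add y z _ _ hy hz => simpa using add_nonneg hy hz
        | smul c y _ hy => exact mul_nonneg c.2 hy
      · intro a ha haτ
        have h1 := hu a (by simp [hl, ha])
        have h2 := hu (-a) (by simp [hl, ha, haτ])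
        simp at h2
        omega
  choose! w hw1 hw2 hw3 using key
  set B := G.filter fun a => toNR a ∉ τ with hB
  have hwB : ∀ g ∈ B, g ∈ G ∧ toNR g ∉ τ := fun g hg => by simpa [hB] using hg
  have hwS : ∀ g ∈ B, w g ∈ dualMonoid σ := fun g hg => hw1 g (hwB g hg).1 (hwB g hg).2
  have huS : ∑ g ∈ B, w g ∈ dualMonoid σ := sum_mem hwS
  refine ⟨∑ g ∈ B, w g, huS, ?_⟩
  intro x hx
  induction hx using Submodule.span_induction with
  | mem y hy =>
    obtain ⟨a, ha, rfl⟩ := hy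
    have ha : a ∈ G := ha
    constructor
    · intro haτ
      rw [map_sum]
      refine Finset.sum_eq_zero fun g hg => ?_
      simp [hw2 g (hwB g hg).1 (hwB g hg).2 a ha haτ]
    · intro h0
      by_contra haτ
      have haB : a ∈ B := by simp [hB, ha, haτ]
      rw [map_sum] at h0
      have h1 := (Finset.sum_eq_zero_iff_of_nonneg
        (fun g hg => hwS g hg _ (hgen a ha))).mp h0 a haB
      have h2 := hw3 a ha haτ
      simp at h1
      omega
  | zero => simp
  | add y z hy hz ihy ihz =>
    rw [hτ.add_mem_iff_mem hy hz, ihy, ihz, AddMonoidHom.add_apply,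
      add_eq_zero_iff_of_nonneg (huS y hy) (huS z hz)]
  | smul c y hy ih =>
    by_cases hc : c = 0
    · simp [hc]
    have hc' : 0 < (c : ℝ) := lt_of_le_of_ne c.2 fun h => hc (Subtype.ext h.symm)
    have e1 : c • y ∈ τ ↔ y ∈ τ := by
      constructor
      · intro h
        have := Submodule.smul_mem τ c⁻¹ h
        rwa [smul_smul, inv_mul_cancel₀ hc, one_smul] at this
      · exact fun h => Submodule.smul_mem τ c h
    rw [e1, ih]
    change _ ↔ (c : ℝ) * y _ = 0
    simp [hc'.ne']

/-- A functional vanishing on the common kernel of lattice vectors is a linear combination. -/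
lemma mem_span_of_perp (l : List (M →+ ℤ)) : ∀ b : NR M,
    (∀ m, (∀ a ∈ l, a m = 0) → b m = 0) → b ∈ Submodule.span ℝ (toNR '' {a | a ∈ l}) := by
  induction l with
  | nil =>
    intro b hb
    have : b = 0 := by ext m; exact hb m (by simp)
    rw [this]; exact zero_mem _
  | cons a₀ l ih =>
    intro b hb
    have hmono : Submodule.span ℝ (toNR '' {a | a ∈ l}) ≤
        Submodule.span ℝ (toNR '' {a | a ∈ a₀ :: l}) :=
      Submodule.span_mono (Set.image_mono fun a ha => List.mem_cons_of_mem _ ha)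
    by_cases h : ∀ m, (∀ a ∈ l, a m = 0) → b m = 0
    · exact hmono (ih b h)
    push Not at h
    obtain ⟨x, hx, hbx⟩ := h
    have hax : a₀ x ≠ 0 := by
      intro h0
      refine hbx (hb x ?_)
      intro a ha
      rcases List.mem_cons.mp ha with rfl | h
      exacts [h0, hx a h]
    have haxR : (a₀ x : ℝ) ≠ 0 := by exact_mod_cast hax
    have h1 : b - (b x / a₀ x) • toNR a₀ ∈ Submodule.span ℝ (toNR '' {a | a ∈ l}) := by
      refine ih _ fun m hm => ?_
      have := hb (a₀ x • m - a₀ m • x) (by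
        intro a ha
        rcases List.mem_cons.mp ha with rfl | h
        · simp [mul_comm]
        · simp [hm a h, hx a h])
      simp at this
      simp
      field_simp
      linarith
    have h2 : b = (b - (b x / a₀ x) • toNR a₀) + (b x / a₀ x) • toNR a₀ := by simp
    rw [h2]
    exact add_mem (hmono h1) (Submodule.smul_mem _ _ (Submodule.subset_span ⟨a₀, by simp, rfl⟩))

/-- The quotient map `N_ℝ → N(τ)_ℝ = N_ℝ / span τ`, where `N(τ)` is the lattice dual to the
character lattice `τ^⊥ ∩ M`: restriction of functionals to `τ^⊥ ∩ M`. -/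
def res (τ : PointedCone ℝ (NR M)) : NR M →ₗ[ℝ] NR (perp τ) where
  toFun v := v.comp (perp τ).subtype
  map_add' _ _ := rfl
  map_smul' _ _ := rfl

@[simp] lemma res_apply (τ : PointedCone ℝ (NR M)) (v : NR M) (m : perp τ) :
    res τ v m = v m := rfl

lemma res_eq_res {τ : PointedCone ℝ (NR M)} (hτ : IsRational τ) {x y : NR M}
    (h : res τ x = res τ y) : ∃ s ∈ τ, ∃ t ∈ τ, x + s = y + t := by
  classical
  obtain ⟨G, hG⟩ := hτ
  have hgen : ∀ a ∈ G, toNR a ∈ τ := fun a ha => hG ▸ Submodule.subset_span ⟨a, ha, rfl⟩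
  have hmem : x - y ∈ Submodule.span ℝ (toNR '' {a | a ∈ G.toList}) := by
    refine mem_span_of_perp _ _ fun m hm => ?_
    have hm' : m ∈ perp τ := by
      rw [hG]
      intro v hv
      induction hv using Submodule.span_induction with
      | mem y hy =>
        obtain ⟨a, ha, rfl⟩ := hy
        simpa using hm a (by simpa using ha)
      | zero => simp
      | add y z _ _ hy hz => simp [hy, hz]
      | smul c y _ hy =>
        change (c : ℝ) * y m = 0
        simp [hy]
    have := DFunLike.congr_fun h ⟨m, hm'⟩
    simpa [sub_eq_zero] using this
  have : ∀ z ∈ Submodule.span ℝ (toNR '' {a | a ∈ G.toList}), ∃ s ∈ τ, ∃ t ∈ τ, z + s = t := by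
    intro z hz
    induction hz using Submodule.span_induction with
    | mem y hy =>
      obtain ⟨a, ha, rfl⟩ := hy
      exact ⟨0, zero_mem _, _, hgen a (by simpa using ha), by simp⟩
    | zero => exact ⟨0, zero_mem _, 0, zero_mem _, by simp⟩
    | add y z _ _ hy hz =>
      obtain ⟨s, hs, t, ht, h1⟩ := hy
      obtain ⟨s', hs', t', ht', h2⟩ := hz
      refine ⟨s + s', add_mem hs hs', t + t', add_mem ht ht', ?_⟩
      rw [← h1, ← h2]; abel
    | smul c y _ hy =>
      obtain ⟨s, hs, t, ht, h1⟩ := hy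
      rcases le_total 0 c with hc | hc
      · exact ⟨c • s, τ.smul_mem hc hs, c • t, τ.smul_mem hc ht, by rw [← h1, smul_add]⟩
      · refine ⟨(-c) • t, τ.smul_mem (by linarith) ht, (-c) • s, τ.smul_mem (by linarith) hs, ?_⟩
        rw [← h1, smul_add, neg_smul, neg_smul]; abel
  obtain ⟨s, hs, t, ht, h1⟩ := this _ hmem
  refine ⟨s, hs, t, ht, ?_⟩
  rw [← h1]; abel

end Cones

/-- A fan in `N_ℝ`: a finite set of strongly convex rational polyhedral cones that contains every
face of each of its cones, and in which any two cones meet in a common face. -/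
structure Fan (M : Type u) [AddCommGroup M] where
  cones : Set (PointedCone ℝ (NR M))
  finite : cones.Finite
  rational : ∀ σ ∈ cones, IsRational σ
  pointed : ∀ σ ∈ cones, σ.lineal = ⊥
  face_mem : ∀ σ ∈ cones, ∀ τ : PointedCone ℝ (NR M), τ.IsFaceOf σ → τ ∈ cones
  inter_face : ∀ σ ∈ cones, ∀ τ ∈ cones, (σ ⊓ τ).IsFaceOf σ

namespace Fan

variable {M : Type u} [AddCommGroup M]

/-- The cones of a fan, partially ordered by inclusion. -/
abbrev Cone (Δ : Fan M) : Type u := {σ : PointedCone ℝ (NR M) // σ ∈ Δ.cones}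

/-- The support of a fan: the union of its cones. -/
def support (Δ : Fan M) : Set (NR M) := ⋃ σ ∈ Δ.cones, (σ : Set (NR M))

lemma isFaceOf (Δ : Fan M) {τ σ : Δ.Cone} (h : τ ≤ σ) : τ.1.IsFaceOf σ.1 := by
  have := Δ.inter_face σ.1 σ.2 τ.1 τ.2
  rwa [inf_eq_right.mpr (show τ.1 ≤ σ.1 from h)] at this

/-- The star of a cone `τ` of a fan `Δ`: the fan in `N(τ)_ℝ = N_ℝ / span τ` consisting of the
images of the cones of `Δ` that contain `τ`. -/
def star (Δ : Fan M) (τ : Δ.Cone) : Fan (perp τ.1) where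
  cones := {ρ | ∃ σ : Δ.Cone, τ ≤ σ ∧ ρ = σ.1.map (res τ.1)}
  finite := by
    have := Δ.finite.to_subtype
    refine (Set.finite_range fun σ : Δ.Cone => σ.1.map (res τ.1)).subset ?_
    rintro _ ⟨σ, -, rfl⟩
    exact ⟨σ, rfl⟩
  rational := by
    classical
    rintro _ ⟨σ, -, rfl⟩
    obtain ⟨G, hG⟩ := Δ.rational σ.1 σ.2
    refine ⟨G.image fun n => n.comp (perp τ.1).subtype, ?_⟩
    rw [hG]
    unfold PointedCone.map PointedCone.hull
    rw [Submodule.map_span, ← Set.image_comp, Finset.coe_image, ← Set.image_comp]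
    rfl
  pointed := by
    rintro _ ⟨σ, hτσ, rfl⟩
    rw [eq_bot_iff]
    rintro _ ⟨⟨x, hx, rfl⟩, ⟨y, hy, hxy⟩⟩
    have hx : x ∈ σ.1 := hx
    have hy : y ∈ σ.1 := hy
    have hxy : res τ.1 y = - res τ.1 x := hxy
    have hz : res τ.1 (x + y) = res τ.1 0 := by rw [map_add, hxy, map_zero, add_neg_cancel]
    obtain ⟨s, hs, t, ht, hst⟩ := res_eq_res (Δ.rational _ τ.2) hz
    have hf := Δ.isFaceOf hτσ
    have h1 : x + (y + s) ∈ τ.1 := by rw [← add_assoc, hst, zero_add]; exact ht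
    have h2 : x ∈ τ.1 := hf.mem_of_add_mem_left hx (add_mem hy (hτσ hs)) h1
    rw [Submodule.mem_bot]
    ext m
    exact m.2 x h2
  face_mem := by
    rintro _ ⟨σ, hτσ, rfl⟩ φ hφ
    have hF : (φ.comap (res τ.1) ⊓ σ.1).IsFaceOf σ.1 := by
      refine ⟨inf_le_right, ?_⟩
      intro x y a hx hy ha h
      refine ⟨?_, hx⟩
      refine hφ.mem_of_smul_add_mem (x := res τ.1 x) (y := res τ.1 y) ⟨x, hx, rfl⟩ ⟨y, hy, rfl⟩ ha ?_
      rw [← map_smul, ← map_add]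
      exact h.1
    refine ⟨⟨_, Δ.face_mem σ.1 σ.2 _ hF⟩, ?_, ?_⟩
    · intro v hv
      refine ⟨?_, hτσ hv⟩
      have : res τ.1 v = 0 := by ext m; exact m.2 v hv
      change res τ.1 v ∈ φ
      rw [this]; exact zero_mem _
    · ext y
      constructor
      · intro hy
        obtain ⟨x, hx, rfl⟩ := hφ.le hy
        exact ⟨x, ⟨hy, hx⟩, rfl⟩
      · rintro ⟨x, ⟨hx, -⟩, rfl⟩
        exact hx
  inter_face := by
    rintro _ ⟨σ, hσ, rfl⟩ _ ⟨σ', hσ', rfl⟩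
    have hf := Δ.inter_face σ.1 σ.2 σ'.1 σ'.2
    refine ⟨inf_le_left, ?_⟩
    rintro _ _ a ⟨x, hx, rfl⟩ ⟨y, hy, rfl⟩ ha ⟨-, ⟨z, hz, hxy⟩⟩
    have hx : x ∈ σ.1 := hx
    have hy : y ∈ σ.1 := hy
    have hz : z ∈ σ'.1 := hz
    have hxy : res τ.1 z = res τ.1 (a • x + y) := by rw [map_add, map_smul]; exact hxy
    obtain ⟨s, hs, t, ht, hst⟩ := res_eq_res (Δ.rational _ τ.2) hxy
    have h1 : a • x + (y + t) ∈ σ.1 ⊓ σ'.1 := by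
      refine ⟨add_mem (σ.1.smul_mem ha.le hx) (add_mem hy (hσ ht)), ?_⟩
      rw [← add_assoc, ← hst]
      exact add_mem hz (hσ' hs)
    have h2 := hf.mem_of_smul_add_mem hx (add_mem hy (hσ ht)) ha h1
    exact ⟨⟨x, hx, rfl⟩, ⟨x, h2.2, rfl⟩⟩

/-- The cone of the star of `τ` given by a cone `σ` of the fan that contains `τ`. -/
def starCone (Δ : Fan M) {τ σ : Δ.Cone} (h : τ ≤ σ) : (Δ.star τ).Cone :=
  ⟨σ.1.map (res τ.1), σ, h, rfl⟩

end Fan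

noncomputable section

section Charts

variable (k : Type u) [Field k] {M : Type u} [AddCommGroup M]

/-- The semigroup ring `k[S_σ]`. -/
abbrev semigroupRing (σ : PointedCone ℝ (NR M)) : Type u := AddMonoidAlgebra k (dualMonoid σ)

/-- The inclusion `k[S_σ] ⊆ k[S_τ]` for `τ ⊆ σ`. -/
def restr {τ σ : PointedCone ℝ (NR M)} (h : τ ≤ σ) : semigroupRing k σ →+* semigroupRing k τ :=
  AddMonoidAlgebra.mapDomainRingHom k (AddSubmonoid.inclusion (dualMonoid_anti h))

@[simp] lemma restr_single {τ σ : PointedCone ℝ (NR M)} (h : τ ≤ σ) (m : dualMonoid σ) (a : k) :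
    restr k h (AddMonoidAlgebra.single m a) =
      AddMonoidAlgebra.single (AddSubmonoid.inclusion (dualMonoid_anti h) m) a := by
  simp [restr]

lemma restr_injective {τ σ : PointedCone ℝ (NR M)} (h : τ ≤ σ) :
    Function.Injective (restr k h) :=
  AddMonoidAlgebra.mapDomain_injective (AddSubmonoid.inclusion_injective _)

lemma restr_refl (σ : PointedCone ℝ (NR M)) : restr k (le_refl σ) = RingHom.id _ := by
  refine RingHom.ext fun x => ?_
  induction x using AddMonoidAlgebra.induction_linear with
  | zero => simp
  | add x y hx hy => rw [map_add, map_add, hx, hy]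
  | single m a => rw [restr_single]; rfl

lemma restr_comp {ρ τ σ : PointedCone ℝ (NR M)} (h : ρ ≤ τ) (h' : τ ≤ σ) :
    (restr k h).comp (restr k h') = restr k (h.trans h') := by
  ext <;> simp [AddSubmonoid.inclusion]

/-- If the character `u ∈ S_σ` cuts out the face `τ` of `σ`, then `k[S_τ] = k[S_σ][χ^{-u}]`. -/
lemma isLocalization_restr {τ σ : PointedCone ℝ (NR M)} (h : τ ≤ σ) (hσ : IsRational σ)
    (u : dualMonoid σ) (hu : ∀ x ∈ σ, (x ∈ τ ↔ x (u : M) = 0)) :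
    letI := (restr k h).toAlgebra
    IsLocalization.Away (AddMonoidAlgebra.single u (1 : k)) (semigroupRing k τ) := by
  let := (restr k h).toAlgebra
  have hmap : ∀ x, algebraMap (semigroupRing k σ) (semigroupRing k τ) x = restr k h x :=
    fun _ => rfl
  refine IsLocalization.Away.mk _ ?_ ?_ ?_
  · have hneg : -(u : M) ∈ dualMonoid τ := by
      intro v hv
      rw [map_neg, (hu v (h hv)).mp hv, neg_zero]
    refine IsUnit.of_mul_eq_one (AddMonoidAlgebra.single ⟨-(u : M), hneg⟩ 1) ?_
    rw [hmap, restr_single, AddMonoidAlgebra.single_mul_single, AddMonoidAlgebra.one_def]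
    congr 1
    · ext; simp
    · simp
  · intro s
    induction s using AddMonoidAlgebra.induction_linear with
    | zero => exact ⟨0, 0, by simp⟩
    | add x y hx hy =>
      obtain ⟨n, a, hn⟩ := hx
      obtain ⟨m, b, hm⟩ := hy
      refine ⟨n + m, a * AddMonoidAlgebra.single u 1 ^ m + b * AddMonoidAlgebra.single u 1 ^ n, ?_⟩
      rw [map_add, map_mul, map_mul, map_pow, map_pow, ← hn, ← hm, pow_add]
      ring
    | single w r =>
      obtain ⟨G, hG⟩ := hσ
      have hgen : ∀ a ∈ G, toNR a ∈ σ := fun a ha => hG ▸ Submodule.subset_span ⟨a, ha, rfl⟩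
      obtain ⟨n, hn⟩ : ∃ n : ℕ, ∀ g ∈ G, 0 ≤ g (w : M) + n * g (u : M) := by
        refine ⟨∑ g ∈ G, (g (w : M)).natAbs, fun g hg => ?_⟩
        have h0 : 0 ≤ g (u : M) := by
          have := u.2 _ (hgen g hg)
          simpa using this
        rcases h0.eq_or_lt with h1 | h1
        · have : toNR g ∈ τ := (hu _ (hgen g hg)).mpr (by simp [← h1])
          have := w.2 _ this
          simp at this
          simpa [← h1] using this
        · have h2 : (g (w : M)).natAbs ≤ ∑ g ∈ G, (g (w : M)).natAbs :=
            Finset.single_le_sum (f := fun g : M →+ ℤ => (g (w : M)).natAbs)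
              (fun _ _ => Nat.zero_le _) hg
          have h3 : ((g (w : M)).natAbs : ℤ) ≤ ((∑ g ∈ G, (g (w : M)).natAbs : ℕ) : ℤ) := by
            exact_mod_cast h2
          have h4 : -g (w : M) ≤ ((g (w : M)).natAbs : ℤ) := by omega
          nlinarith
      have hmem : (w : M) + n • (u : M) ∈ dualMonoid σ := by
        intro v hv
        rw [hG] at hv
        induction hv using Submodule.span_induction with
        | mem y hy =>
          obtain ⟨a, ha, rfl⟩ := hy
          have := hn a ha
          simp
          exact_mod_cast this
        | zero => simp
        | add y z _ _ hy hz => exact add_nonneg hy hz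
        | smul c y _ hy => exact mul_nonneg c.2 hy
      refine ⟨n, AddMonoidAlgebra.single ⟨_, hmem⟩ r, ?_⟩
      rw [hmap, hmap, restr_single, restr_single, AddMonoidAlgebra.single_pow,
        AddMonoidAlgebra.single_mul_single]
      congr 1
      simp
  · intro a b hab
    exact ⟨0, by rw [restr_injective k h hab]⟩

/-- The affine toric variety `U_σ = Spec k[S_σ]`. -/
abbrev chart (σ : PointedCone ℝ (NR M)) : Scheme.{u} := Spec (CommRingCat.of (semigroupRing k σ))

/-- The morphism `U_τ ⟶ U_σ` for `τ ⊆ σ`. -/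
def chartMap {τ σ : PointedCone ℝ (NR M)} (h : τ ≤ σ) : chart k τ ⟶ chart k σ :=
  Spec.map (CommRingCat.ofHom (restr k h))

lemma chartMap_comp {ρ τ σ : PointedCone ℝ (NR M)} (h : ρ ≤ τ) (h' : τ ≤ σ) :
    chartMap k h ≫ chartMap k h' = chartMap k (h.trans h') := by
  rw [chartMap, chartMap, ← Spec.map_comp, ← CommRingCat.ofHom_comp, restr_comp]
  rfl

lemma isOpenImmersion_chartMap {τ σ : PointedCone ℝ (NR M)} (h : τ ≤ σ) (hσ : IsRational σ)
    (hτ : τ.IsFaceOf σ) : IsOpenImmersion (chartMap k h) := by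
  obtain ⟨u, hu, hx⟩ := exists_exposing hσ hτ
  let := (restr k h).toAlgebra
  have := isLocalization_restr k h hσ ⟨u, hu⟩ hx
  exact IsOpenImmersion.of_isLocalization (AddMonoidAlgebra.single ⟨u, hu⟩ (1 : k))

lemma range_chartMap {τ σ : PointedCone ℝ (NR M)} (h : τ ≤ σ) (hσ : IsRational σ)
    (u : dualMonoid σ) (hu : ∀ x ∈ σ, (x ∈ τ ↔ x (u : M) = 0)) :
    Set.range (chartMap k h) =
      (PrimeSpectrum.basicOpen (AddMonoidAlgebra.single u (1 : k)) :
        Set (PrimeSpectrum (semigroupRing k σ))) := by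
  let := (restr k h).toAlgebra
  have := isLocalization_restr k h hσ u hu
  exact PrimeSpectrum.localization_away_comap_range (semigroupRing k τ)
    (AddMonoidAlgebra.single u (1 : k))

end Charts

namespace Fan

variable (k : Type u) [Field k] {M : Type u} [AddCommGroup M] (Δ : Fan M)

/-- The diagram of affine toric varieties `U_σ`, for `σ` in the fan `Δ`. -/
def functor : Δ.Cone ⥤ Scheme.{u} where
  obj σ := chart k σ.1
  map f := chartMap k (leOfHom f)
  map_id σ := by
    change chartMap k (le_refl σ.1) = _
    rw [chartMap, restr_refl]
    exact Spec.map_id _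
  map_comp f g := by
    exact (chartMap_comp k _ _).symm

instance {σ τ : Δ.Cone} (f : σ ⟶ τ) : IsOpenImmersion ((Δ.functor k).map f) :=
  isOpenImmersion_chartMap k _ (Δ.rational _ τ.2) (Δ.isFaceOf (leOfHom f))

instance : (Δ.functor k ⋙ Scheme.forget).IsLocallyDirected where
  cond := by
    intro σ₁ σ₂ σ f₁ f₂ x₁ x₂ hx
    have hσ := Δ.rational _ σ.2
    have hx : chartMap k (leOfHom f₁) x₁ = chartMap k (leOfHom f₂) x₂ := hx
    obtain ⟨u₁, hu₁, h₁⟩ := exists_exposing hσ (Δ.isFaceOf (leOfHom f₁))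
    obtain ⟨u₂, hu₂, h₂⟩ := exists_exposing hσ (Δ.isFaceOf (leOfHom f₂))
    let ρ : Δ.Cone := ⟨σ₁.1 ⊓ σ₂.1, Δ.face_mem _ σ₁.2 _ (Δ.inter_face _ σ₁.2 _ σ₂.2)⟩
    have hρ₁ : ρ ≤ σ₁ := show ρ.1 ≤ σ₁.1 from inf_le_left
    have hρ₂ : ρ ≤ σ₂ := show ρ.1 ≤ σ₂.1 from inf_le_right
    have hρ : ρ.1 ≤ σ.1 := hρ₁.trans (leOfHom f₁)
    have hexp : ∀ x ∈ σ.1, (x ∈ ρ.1 ↔ x (u₁ + u₂) = 0) := by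
      intro x hx
      rw [map_add, add_eq_zero_iff_of_nonneg (hu₁ x hx) (hu₂ x hx), ← h₁ x hx, ← h₂ x hx]
      rfl
    have hr := range_chartMap k hρ hσ ⟨u₁ + u₂, add_mem hu₁ hu₂⟩ hexp
    have hr₁ := range_chartMap k (leOfHom f₁) hσ ⟨u₁, hu₁⟩ h₁
    have hr₂ := range_chartMap k (leOfHom f₂) hσ ⟨u₂, hu₂⟩ h₂
    have hm : (AddMonoidAlgebra.single (⟨u₁ + u₂, add_mem hu₁ hu₂⟩ : dualMonoid σ.1) (1 : k)) =
        AddMonoidAlgebra.single ⟨u₁, hu₁⟩ 1 * AddMonoidAlgebra.single ⟨u₂, hu₂⟩ 1 := by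
      rw [AddMonoidAlgebra.single_mul_single, mul_one]; rfl
    rw [hm, PrimeSpectrum.basicOpen_mul, TopologicalSpace.Opens.coe_inf, ← hr₁, ← hr₂] at hr
    have hmem : chartMap k (leOfHom f₁) x₁ ∈ Set.range (chartMap k hρ) := by
      rw [hr]
      exact ⟨⟨x₁, rfl⟩, ⟨x₂, hx.symm⟩⟩
    obtain ⟨y, hy⟩ := hmem
    refine ⟨ρ, homOfLE hρ₁, homOfLE hρ₂, y, ?_, ?_⟩
    · have := isOpenImmersion_chartMap k (leOfHom f₁) hσ (Δ.isFaceOf (leOfHom f₁))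
      apply (chartMap k (leOfHom f₁)).isOpenEmbedding.injective
      rw [← hy]
      change ((Δ.functor k).map (homOfLE hρ₁) ≫ (Δ.functor k).map f₁) y = _
      rw [← Functor.map_comp]
      rfl
    · have := isOpenImmersion_chartMap k (leOfHom f₂) hσ (Δ.isFaceOf (leOfHom f₂))
      apply (chartMap k (leOfHom f₂)).isOpenEmbedding.injective
      rw [← hx, ← hy]
      change ((Δ.functor k).map (homOfLE hρ₂) ≫ (Δ.functor k).map f₂) y = _
      rw [← Functor.map_comp]
      rfl

/-- The toric variety `Y_Δ` over `k`: the gluing of the affine toric varieties `U_σ`, `σ ∈ Δ`,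
along the open immersions `U_τ ⟶ U_σ` attached to the faces `τ` of `σ`. -/
def toricVariety : Scheme.{u} := colimit (Δ.functor k)

/-- The open immersion `U_σ ⟶ Y_Δ`. -/
def ι (σ : Δ.Cone) : chart k σ.1 ⟶ Δ.toricVariety k := colimit.ι (Δ.functor k) σ

/-- The structure morphism `Y_Δ ⟶ Spec k`. -/
def structureMap : Δ.toricVariety k ⟶ Spec (CommRingCat.of k) :=
  colimit.desc (Δ.functor k)
    { pt := Spec (CommRingCat.of k)
      ι :=
        { app := fun σ => Spec.map (CommRingCat.ofHom (algebraMap k (semigroupRing k σ.1)))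
          naturality := by
            intro σ τ f
            have e : (restr k (leOfHom f)).comp (algebraMap k (semigroupRing k τ.1)) =
                algebraMap k (semigroupRing k σ.1) := by
              refine RingHom.ext fun a => ?_
              simp only [AddMonoidAlgebra.coe_algebraMap, RingHom.comp_apply, Function.comp_apply,
                restr_single, map_zero]
            change chartMap k (leOfHom f) ≫ Spec.map _ = _ ≫ 𝟙 _
            rw [Category.comp_id, chartMap, ← Spec.map_comp, ← CommRingCat.ofHom_comp, e] } }

/-- A subset `Z` of `Y_Δ` is torus-invariant if, on every chart `U_σ`, the ideal of functions
vanishing on `Z` is homogeneous for the grading of `k[S_σ]` by characters, that is, stable under the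
coaction of the torus `Spec k[M]`. -/
def IsTorusInvariant (Z : Set (Δ.toricVariety k)) : Prop :=
  ∀ (σ : Δ.Cone) (f : semigroupRing k σ.1) (m : dualMonoid σ.1),
    f ∈ PrimeSpectrum.vanishingIdeal (R := semigroupRing k σ.1) (Δ.ι k σ ⁻¹' Z) →
    AddMonoidAlgebra.single m (f.coeff m) ∈
      PrimeSpectrum.vanishingIdeal (R := semigroupRing k σ.1) (Δ.ι k σ ⁻¹' Z)

/-- The truncation `k[S_σ] → k[S_σ ∩ τ^⊥]`, for a cone `τ ⊆ σ`, which sends the character `χ^m` to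
`χ^m` if `m ∈ τ^⊥` and to `0` otherwise.  Its target is the semigroup ring of the image of `σ` in
the star of `τ`. -/
def truncate {τ σ : Δ.Cone} (h : τ ≤ σ) :
    semigroupRing k σ.1 →+* semigroupRing k (Δ.starCone h).1 :=
  open scoped Classical in
  (AddMonoidAlgebra.lift k (semigroupRing k (Δ.starCone h).1) (dualMonoid σ.1)
    { toFun := fun m =>
        if hm : (m.toAdd : M) ∈ perp τ.1 then
          AddMonoidAlgebra.single ⟨⟨m.toAdd, hm⟩, by
            rintro _ ⟨x, hx, rfl⟩
            exact m.toAdd.2 x hx⟩ 1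
        else 0
      map_one' := by
        rw [dif_pos (by simp)]
        rfl
      map_mul' := by
        intro a b
        have key : ((a * b).toAdd : M) ∈ perp τ.1 ↔
            (a.toAdd : M) ∈ perp τ.1 ∧ (b.toAdd : M) ∈ perp τ.1 := by
          simp only [mem_perp, toAdd_mul, AddSubmonoid.coe_add, map_add]
          rw [← forall₂_and]
          refine forall₂_congr fun v hv => ?_
          exact add_eq_zero_iff_of_nonneg (a.toAdd.2 v (h hv)) (b.toAdd.2 v (h hv))
        by_cases ha : (a.toAdd : M) ∈ perp τ.1
        · by_cases hb : (b.toAdd : M) ∈ perp τ.1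
          · rw [dif_pos ha, dif_pos hb, dif_pos (key.mpr ⟨ha, hb⟩),
              AddMonoidAlgebra.single_mul_single, mul_one]
            rfl
          · rw [dif_neg hb, mul_zero, dif_neg fun h => hb (key.mp h).2]
        · rw [dif_neg ha, zero_mul, dif_neg fun h => ha (key.mp h).1] }).toRingHom

end Fan

/-- A prime divisor, as a subset: irreducible, closed and of codimension one. -/
def IsPrimeDivisor {X : Scheme.{u}} (Z : Set X) : Prop :=
  ∃ W : TopologicalSpace.IrreducibleCloseds X, (W : Set X) = Z ∧ Order.coheight W = 1

/-! ### Fans in the half-space `N_ℝ × ℝ_{≥ 0}`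

The character lattice is `M × ℤ`, and `N_ℝ × ℝ` is identified with `Hom(M × ℤ, ℝ)`. -/

section Degeneration

variable {M : Type u} [AddCommGroup M]

/-- The point `(v, r)` of `N_ℝ × ℝ`, as the functional `(u, n) ↦ ⟨u, v⟩ + r n` on `M × ℤ`. -/
def pt (v : NR M) (r : ℝ) : NR (M × ℤ) := v.coprod (r • Int.castAddHom ℝ)

@[simp] lemma pt_apply (v : NR M) (r : ℝ) (m : M × ℤ) : pt v r m = v m.1 + r * m.2 := by
  simp [pt]

/-- The inclusion `N_ℝ = N_ℝ × {0} ⊆ N_ℝ × ℝ`. -/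
def heightZero (M : Type u) [AddCommGroup M] : NR M →ₗ[ℝ] NR (M × ℤ) where
  toFun v := pt v 0
  map_add' v w := by ext <;> simp
  map_smul' r v := by ext <;> simp

@[simp] lemma heightZero_apply (v : NR M) : heightZero M v = pt v 0 := rfl

/-- The half-space `N_ℝ × ℝ_{≥ 0}`; the second projection of `N_ℝ × ℝ` is evaluation at the
character `(0, 1)`. -/
def halfSpace (M : Type u) [AddCommGroup M] : Set (NR (M × ℤ)) := {x | 0 ≤ x (0, 1)}

/-- The slice `{v ∈ N_ℝ : (v, 1) ∈ δ}` of a cone `δ` at height one. -/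
def slice (δ : PointedCone ℝ (NR (M × ℤ))) : Set (NR M) := {v | pt v 1 ∈ δ}

/-- The cells of the height-one polyhedral complex `C_Δ`, each given by the cone of `Δ` over it: the
cones of `Δ` with nonempty slice at height one.  They are ordered by inclusion. -/
abbrev Cell (Δ : Fan (M × ℤ)) : Type u := {δ : Δ.Cone // (slice δ.1).Nonempty}

namespace Cell

variable {Δ : Fan (M × ℤ)}

/-- The polyhedron in `N_ℝ` which is the cell of `C_Δ`. -/
def polyhedron (P : Cell Δ) : Set (NR M) := slice P.1.1

/-- The vertices of `C_Δ`: the cells that consist of one point. -/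
def IsVertex (P : Cell Δ) : Prop := ∃ v, P.polyhedron = {v}

/-- The edges of `C_Δ`: the cells of dimension one. -/
def IsEdge (P : Cell Δ) : Prop := Module.finrank ℝ (vectorSpan ℝ P.polyhedron) = 1

/-- The toric variety `Y_star(P)` of the star of the cone over the cell `P`. -/
abbrev starVariety (k : Type u) [Field k] (P : Cell Δ) : Scheme.{u} := (Δ.star P.1).toricVariety k

end Cell

variable (k : Type u) [Field k]

/-- The inclusion `k[t] → k[S_δ]`, `t ↦ χ^{(0,1)}`, for a cone `δ` in the half-space. -/
def tHom (δ : PointedCone ℝ (NR (M × ℤ))) (h : ((0, 1) : M × ℤ) ∈ dualMonoid δ) :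
    Polynomial k →+* semigroupRing k δ :=
  (Polynomial.aeval (R := k) (AddMonoidAlgebra.single (⟨(0, 1), h⟩ : dualMonoid δ) (1 : k))).toRingHom

lemma t_mem {Δ : Fan (M × ℤ)} (h : Δ.support ⊆ halfSpace M) (δ : Δ.Cone) :
    ((0, 1) : M × ℤ) ∈ dualMonoid δ.1 := fun _ hv => h (Set.mem_biUnion δ.2 hv)

/-- The toric morphism `f_{pr₂} : Y_Δ ⟶ 𝔸¹ = Spec k[t]` induced by the projection
`pr₂ : N_ℝ × ℝ_{≥ 0} → ℝ_{≥ 0}`; it pulls `t` back to the character `χ^{(0,1)}`. -/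
def toA1 {Δ : Fan (M × ℤ)} (h : Δ.support ⊆ halfSpace M) :
    Δ.toricVariety k ⟶ Spec (CommRingCat.of (Polynomial k)) :=
  colimit.desc (Δ.functor k)
    { pt := Spec (CommRingCat.of (Polynomial k))
      ι :=
        { app := fun δ => Spec.map (CommRingCat.ofHom (tHom k δ.1 (t_mem h δ)))
          naturality := by
            intro σ τ f
            have e : (restr k (leOfHom f)).comp (tHom k τ.1 (t_mem h τ)) =
                tHom k σ.1 (t_mem h σ) := by
              refine Polynomial.ringHom_ext (fun a => ?_) ?_
              · simp [tHom, restr_single]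
              · simp only [tHom, AlgHom.toRingHom_eq_coe, RingHom.comp_apply, RingHom.coe_coe,
                  Polynomial.aeval_X, restr_single]
                rfl
            change chartMap k (leOfHom f) ≫ Spec.map _ = _ ≫ 𝟙 _
            rw [Category.comp_id, chartMap, ← Spec.map_comp, ← CommRingCat.ofHom_comp, e] } }

/-- The scheme-theoretic fiber of `f_{pr₂}` over the point `t = 0`. -/
def specialFiber {Δ : Fan (M × ℤ)} (h : Δ.support ⊆ halfSpace M) : Scheme.{u} :=
  pullback (toA1 k h) (Spec.map (CommRingCat.ofHom (Polynomial.evalRingHom (0 : k))))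

/-- The special fiber with its reduced scheme structure. -/
def reducedSpecialFiber {Δ : Fan (M × ℤ)} (h : Δ.support ⊆ halfSpace M) : Scheme.{u} :=
  (specialFiber k h).nilradical.subscheme

/-- The inclusion of the reduced special fiber in `Y_Δ`. -/
def reducedSpecialFiberι {Δ : Fan (M × ℤ)} (h : Δ.support ⊆ halfSpace M) :
    reducedSpecialFiber k h ⟶ Δ.toricVariety k :=
  (specialFiber k h).nilradical.subschemeι ≫ pullback.fst _ _

/-- For cones `σ` in `N_ℝ` and `δ` in `N_ℝ × ℝ` with `σ × {0} ⊆ δ`, the ring homomorphism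
`k[S_δ] → k(t)[S_σ]` which sends `χ^{(u,n)}` to `t^n χ^u`. -/
def genericHom (σ : PointedCone ℝ (NR M)) (δ : PointedCone ℝ (NR (M × ℤ)))
    (h : σ.map (heightZero M) ≤ δ) : semigroupRing k δ →+* semigroupRing (RatFunc k) σ :=
  (AddMonoidAlgebra.lift k (semigroupRing (RatFunc k) σ) (dualMonoid δ)
    { toFun := fun m =>
        AddMonoidAlgebra.single
          ⟨(m.toAdd : M × ℤ).1, fun v hv => by
            have := m.toAdd.2 (heightZero M v) (h ⟨v, hv, rfl⟩)
            simpa using this⟩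
          ((RatFunc.X : RatFunc k) ^ (m.toAdd : M × ℤ).2)
      map_one' := by
        simp [AddMonoidAlgebra.one_def]
        rfl
      map_mul' := by
        intro a b
        rw [AddMonoidAlgebra.single_mul_single, ← zpow_add₀ RatFunc.X_ne_zero]
        rfl }).toRingHom

end Degeneration

end

end Toric

open Toric

/-!
The proof is combinatorial: everything is reduced to faces of cones and to characters.

A point `x` of a toric variety lies on the orbit of a smallest cone `orbitCone x`, and on a chart the
characters that do not vanish at `x` are those orthogonal to this cone
(`single_notMem_pointIdeal`).  Since the ideal of the orbit closure `starι τ` is spanned by the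
characters not orthogonal to `τ`, orbit closures are determined by the order of the cones: `starι τ`
has image `{x | τ ≤ orbitCone x}` (`range_starι`), and orbit closures intersect
scheme-theoretically in the orbit closure of the smallest common cone (`isPullback_starHom`).

The special fiber is the union of the orbits of the cones that reach positive height.  Orbit closures
are reduced, so those of the cells factor through the reduced special fiber `X₀`; each cell has a
vertex (`exists_vertex_le`), so those of the vertices cover `X₀`.  The cone over an edge becomes a ray
modulo the cone over one of its vertices, and the ideal of the orbit closure of a ray is principal
on the chart of the ray, which gives codimension one (`isPrimeDivisor_range_starι`).

For the gluing property, regular functions on the strata glue chart by chart: a character `χ^m` may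
occur in the functions on several strata, but all of these strata contain the stratum of the face cut
out by `m`, where the coefficients are compared (`sectionsGlue_chartOpen`).  As the family of closed
subschemes is finite, this passes to basic opens, and to morphisms to an arbitrary scheme
(`existsUnique_glue`).  Compatibility on the intersections follows from that along the edges,
because two vertices of a cell are connected by a path of edges of that cell, as in the simplex
algorithm (`vertex_induction`).

If the vertices are lattice points, a character of `S_δ` that is positive on all the vertices of `δ`
is at least `1` there, so it is divisible by `χ^{(0,1)}` (`sub_mem_of_lattice`); hence
`χ^{(0,1)}` generates the ideal of `X₀` on every chart.

For the generic fiber, with `σ` the part of `δ` at height zero, `k(t)[S_σ]` is the base change of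
`k[S_δ]` from `k[t]` to `k(t)`, because each `u ∈ S_σ` has a lift `(u, n) ∈ S_δ`
(`existsUnique_ringHom`); and the preimage of the chart of `δ` is the chart of `σ`
(`isPullback_ι_genericι`).
-/

namespace Toric

noncomputable section

/-! ### Faces and generators of cones, and the cells of the complex at height one -/

section ConeLemmas

variable {M : Type u} [AddCommGroup M]

lemma mem_hull_singleton {g x : NR M} :
    x ∈ PointedCone.hull ℝ {g} ↔ ∃ a : ℝ, 0 ≤ a ∧ x = a • g := by
  unfold PointedCone.hull
  rw [Submodule.mem_span_singleton]
  constructor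
  · rintro ⟨a, rfl⟩; exact ⟨a, a.2, rfl⟩
  · rintro ⟨a, ha, rfl⟩; exact ⟨⟨a, ha⟩, rfl⟩

lemma mem_hull_insert {g x : NR M} {s : Set (NR M)} :
    x ∈ PointedCone.hull ℝ (insert g s) ↔
      ∃ a : ℝ, 0 ≤ a ∧ ∃ z ∈ PointedCone.hull ℝ s, x = a • g + z := by
  unfold PointedCone.hull
  rw [Submodule.mem_span_insert]
  constructor
  · rintro ⟨a, z, hz, rfl⟩; exact ⟨a, a.2, z, hz, rfl⟩
  · rintro ⟨a, ha, z, hz, rfl⟩; exact ⟨⟨a, ha⟩, z, hz, rfl⟩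

lemma mem_dualMonoid_hull {s : Set (NR M)} {m : M} (h : ∀ g ∈ s, 0 ≤ g m) :
    m ∈ dualMonoid (PointedCone.hull ℝ s) := by
  intro v hv
  induction hv using Submodule.span_induction with
  | mem y hy => exact h y hy
  | zero => simp
  | add y z _ _ hy hz => exact add_nonneg hy hz
  | smul c y _ hy => exact mul_nonneg c.2 hy

/-- A strongly convex rational cone is generated by lattice vectors that span extremal rays. -/
theorem exists_extremal_generators {σ : PointedCone ℝ (NR M)} (hσ : IsRational σ)
    (hp : σ.lineal = ⊥) :
    ∃ G : Finset (M →+ ℤ), σ = PointedCone.hull ℝ (toNR '' (G : Set (M →+ ℤ))) ∧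
      ∀ g ∈ G, toNR g ≠ 0 ∧ (PointedCone.hull ℝ {toNR g}).IsFaceOf σ := by
  classical
  -- a generating set of least cardinality is irredundant
  obtain ⟨G, hG, hmin⟩ := exists_minimalFor_of_wellFoundedLT
    (fun G : Finset (M →+ ℤ) => σ = PointedCone.hull ℝ (toNR '' (G : Set (M →+ ℤ))))
    Finset.card hσ
  have hirr : ∀ g ∈ G,
      toNR g ∉ PointedCone.hull ℝ (toNR '' ((G.erase g : Finset _) : Set (M →+ ℤ))) := by
    intro g hg hmem
    have h1 : σ = PointedCone.hull ℝ (toNR '' ((G.erase g : Finset _) : Set (M →+ ℤ))) := by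
      rw [hG]
      refine le_antisymm (Submodule.span_le.mpr ?_) (Submodule.span_mono (Set.image_mono ?_))
      · rintro _ ⟨a, ha, rfl⟩
        by_cases hag : a = g
        · rw [hag]; exact hmem
        · exact Submodule.subset_span ⟨a, by simpa [hag] using ha, rfl⟩
      · intro a ha
        exact Finset.mem_of_mem_erase ha
    have h2 := hmin h1 (Finset.card_erase_lt_of_mem hg).le
    exact absurd h2 (not_le.mpr (Finset.card_erase_lt_of_mem hg))
  refine ⟨G, hG, fun g hg => ⟨fun h0 => hirr g hg (h0 ▸ zero_mem _), ?_⟩⟩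
  have hgσ : toNR g ∈ σ := hG ▸ Submodule.subset_span ⟨g, hg, rfl⟩
  set τ := PointedCone.hull ℝ (toNR '' ((G.erase g : Finset _) : Set (M →+ ℤ))) with hτ
  have hτσ : τ ≤ σ := by
    rw [hG]
    exact Submodule.span_mono (Set.image_mono fun a ha => Finset.mem_of_mem_erase ha)
  have hdec : ∀ x ∈ σ, ∃ a : ℝ, 0 ≤ a ∧ ∃ z ∈ τ, x = a • toNR g + z := by
    intro x hx
    rw [hτ, ← mem_hull_insert, ← Set.image_insert_eq, ← Finset.coe_insert, Finset.insert_erase hg,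
      ← hG]
    exact hx
  refine PointedCone.IsFaceOf.of_mem_of_add_mem_left ?_ ?_
  · refine Submodule.span_le.mpr ?_
    rintro _ rfl
    exact hgσ
  · intro x y hx hy hxy
    obtain ⟨a, ha, x', hx', rfl⟩ := hdec x hx
    obtain ⟨b, hb, y', hy', rfl⟩ := hdec y hy
    obtain ⟨c, hc, hc'⟩ := mem_hull_singleton.mp hxy
    rcases lt_or_ge (a + b) c with hlt | hge
    · exfalso
      refine hirr g hg ?_
      have h1 : (c - (a + b)) • toNR g = x' + y' := by
        rw [sub_smul, ← hc', add_smul]; abel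
      have h2 : toNR g = (c - (a + b))⁻¹ • (x' + y') := by
        rw [← h1, smul_smul, inv_mul_cancel₀ (by linarith), one_smul]
      rw [h2]
      exact τ.smul_mem (inv_nonneg.mpr (by linarith)) (add_mem hx' hy')
    · have h1 : -x' = (a + b - c) • toNR g + y' := by
        rw [sub_smul, ← hc', add_smul]; abel
      have h2 : x' ∈ σ.lineal := by
        refine ⟨hτσ hx', ?_⟩
        have : -x' ∈ σ := h1 ▸ add_mem (σ.smul_mem (by linarith) hgσ) (hτσ hy')
        simpa using this
      rw [hp, Submodule.mem_bot] at h2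
      rw [h2, add_zero]
      exact mem_hull_singleton.mpr ⟨a, ha, rfl⟩

/-- The face of `σ` on which the character `m` vanishes. -/
def cutFace (σ : PointedCone ℝ (NR M)) (m : M) : PointedCone ℝ (NR M) where
  carrier := {x | x ∈ σ ∧ x m = 0}
  zero_mem' := ⟨zero_mem _, rfl⟩
  add_mem' := by
    rintro a b ⟨ha, ha'⟩ ⟨hb, hb'⟩
    exact ⟨add_mem ha hb, by simp [ha', hb']⟩
  smul_mem' := by
    rintro c a ⟨ha, ha'⟩
    refine ⟨Submodule.smul_mem _ c ha, ?_⟩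
    change (c : ℝ) * a m = 0
    rw [ha', mul_zero]

lemma isFaceOf_cutFace {σ : PointedCone ℝ (NR M)} {m : M} (hm : m ∈ dualMonoid σ) :
    (cutFace σ m).IsFaceOf σ := by
  refine PointedCone.IsFaceOf.of_mem_of_add_mem_left (fun x hx => hx.1) ?_
  rintro x y hx hy ⟨-, hxy⟩
  refine ⟨hx, ?_⟩
  have h1 := hm x hx
  have h2 := hm y hy
  rw [AddMonoidHom.add_apply] at hxy
  linarith

end ConeLemmas

namespace Fan

variable {M : Type u} [AddCommGroup M] (Δ : Fan M)

/-- The intersection of two cones of a fan, as a cone of the fan. -/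
def inter (σ τ : Δ.Cone) : Δ.Cone :=
  ⟨σ.1 ⊓ τ.1, Δ.face_mem _ σ.2 _ (Δ.inter_face _ σ.2 _ τ.2)⟩

variable {Δ}

lemma inter_le_left (σ τ : Δ.Cone) : Δ.inter σ τ ≤ σ := show σ.1 ⊓ τ.1 ≤ σ.1 from inf_le_left

lemma inter_le_right (σ τ : Δ.Cone) : Δ.inter σ τ ≤ τ := show σ.1 ⊓ τ.1 ≤ τ.1 from inf_le_right

lemma le_inter {ρ σ τ : Δ.Cone} (h : ρ ≤ σ) (h' : ρ ≤ τ) : ρ ≤ Δ.inter σ τ :=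
  show ρ.1 ≤ σ.1 ⊓ τ.1 from le_inf h h'

/-- The face of the cone `σ` of a fan on which a character `m ∈ S_σ` vanishes. -/
def cut (σ : Δ.Cone) (m : M) (hm : m ∈ dualMonoid σ.1) : Δ.Cone :=
  ⟨cutFace σ.1 m, Δ.face_mem _ σ.2 _ (isFaceOf_cutFace hm)⟩

lemma cut_le (σ : Δ.Cone) (m : M) (hm : m ∈ dualMonoid σ.1) : cut σ m hm ≤ σ :=
  fun _ => And.left

lemma mem_perp_iff_le_cut {τ σ : Δ.Cone} (h : τ ≤ σ) (m : M) (hm : m ∈ dualMonoid σ.1) :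
    m ∈ perp τ.1 ↔ τ ≤ cut σ m hm :=
  ⟨fun hmτ _ hx => ⟨h hx, hmτ _ hx⟩, fun hle _ hx => (hle hx).2⟩

lemma exists_exposing {τ σ : Δ.Cone} (h : τ ≤ σ) :
    ∃ u ∈ dualMonoid σ.1, ∀ x ∈ σ.1, (x ∈ τ.1 ↔ x u = 0) :=
  Toric.exists_exposing (Δ.rational _ σ.2) (Δ.isFaceOf h)

lemma starCone_le_iff {τ σ σ' : Δ.Cone} (h : τ ≤ σ) (h' : τ ≤ σ') :
    Δ.starCone h ≤ Δ.starCone h' ↔ σ ≤ σ' := by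
  constructor
  · intro hle x hx
    obtain ⟨y, hy, hxy⟩ : res τ.1 x ∈ (Δ.starCone h').1 := hle ⟨x, hx, rfl⟩
    obtain ⟨s, hs, t, ht, hst⟩ := res_eq_res (Δ.rational _ τ.2) (show res τ.1 y = res τ.1 x from hxy)
    have h1 : x + t ∈ σ.1 ⊓ σ'.1 := by
      refine ⟨add_mem hx (h ht), ?_⟩
      rw [← hst]
      exact add_mem (show y ∈ σ'.1 from hy) (h' hs)
    exact ((Δ.inter_face _ σ.2 _ σ'.2).mem_of_add_mem_left hx (h ht) h1).2
  · rintro hle _ ⟨x, hx, rfl⟩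
    exact ⟨x, hle hx, rfl⟩

lemma exists_eq_starCone {τ : Δ.Cone} (ρ : (Δ.star τ).Cone) :
    ∃ (σ : Δ.Cone) (h : τ ≤ σ), ρ = Δ.starCone h := by
  obtain ⟨σ, h, e⟩ := ρ.2
  exact ⟨σ, h, Subtype.ext e⟩

end Fan

section Cells

variable {M : Type u} [AddCommGroup M]

lemma eq_pt (x : NR (M × ℤ)) : x = pt (x.comp (AddMonoidHom.inl M ℤ)) (x (0, 1)) := by
  ext m
  have e : m = (m.1, 0) + m.2 • ((0, 1) : M × ℤ) := by ext <;> simp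
  conv_lhs => rw [e, map_add, map_zsmul]
  simp [mul_comm]

lemma pt_add (v w : NR M) (r s : ℝ) : pt v r + pt w s = pt (v + w) (r + s) := by
  ext m
  simp only [pt_apply, AddMonoidHom.add_apply]
  ring

lemma smul_pt (c : ℝ) (v : NR M) (r : ℝ) : c • pt v r = pt (c • v) (c * r) := by
  ext m
  simp only [pt_apply, AddMonoidHom.smul_apply, smul_eq_mul]
  ring

lemma pt_inj {v w : NR M} {r : ℝ} (h : pt v r = pt w r) : v = w := by
  ext m
  simpa using DFunLike.congr_fun h (m, 0)

lemma pt_height (v : NR M) (r : ℝ) : pt v r (0, 1) = r := by simp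

lemma exists_slice_of_height_pos {δ : PointedCone ℝ (NR (M × ℤ))} {x : NR (M × ℤ)} (hx : x ∈ δ)
    (h : 0 < x (0, 1)) : ∃ v ∈ slice δ, x = (x (0, 1)) • pt v 1 := by
  have e : x = (x (0, 1)) • pt ((x (0, 1))⁻¹ • x.comp (AddMonoidHom.inl M ℤ)) 1 := by
    rw [smul_pt, smul_smul, mul_inv_cancel₀ h.ne', one_smul, mul_one]
    exact eq_pt x
  refine ⟨_, ?_, e⟩
  change pt _ 1 ∈ δ
  have : pt ((x (0, 1))⁻¹ • x.comp (AddMonoidHom.inl M ℤ)) 1 = (x (0, 1))⁻¹ • x := by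
    generalize x (0, 1) = c at e h ⊢
    conv_rhs => rw [e, smul_smul, inv_mul_cancel₀ h.ne', one_smul]
  rw [this]
  exact δ.smul_mem (inv_nonneg.mpr h.le) hx

variable {Δ : Fan (M × ℤ)}

namespace Cell

/-- A cone of the fan that contains a cell is a cell. -/
def ofLE (P : Cell Δ) {δ : Δ.Cone} (h : P.1 ≤ δ) : Cell Δ :=
  ⟨δ, P.2.mono fun _ hv => h hv⟩

/-- A cone of the fan containing a point of positive height is a cell. -/
def ofHeightPos (δ : Δ.Cone) (h : ∃ x ∈ δ.1, 0 < x (0, 1)) : Cell Δ :=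
  ⟨δ, by
    obtain ⟨x, hx, hx'⟩ := h
    obtain ⟨v, hv, -⟩ := exists_slice_of_height_pos hx hx'
    exact ⟨v, hv⟩⟩

lemma exists_height_pos (P : Cell Δ) : ∃ x ∈ P.1.1, 0 < x (0, 1) := by
  obtain ⟨v, hv⟩ := P.2
  exact ⟨_, hv, by rw [pt_height]; exact one_pos⟩

/-- A ray of the fan spanned by a vector of positive height is a vertex. -/
lemma isVertex_of_ray {P : Cell Δ} {g : NR (M × ℤ)} (hg : 0 < g (0, 1))
    (h : P.1.1 = PointedCone.hull ℝ {g}) : P.IsVertex := by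
  have hgP : g ∈ P.1.1 := h ▸ Submodule.subset_span rfl
  obtain ⟨v, hv, hgv⟩ := exists_slice_of_height_pos hgP hg
  refine ⟨v, Set.eq_singleton_iff_unique_mem.mpr ⟨hv, fun w hw => ?_⟩⟩
  have hw : pt w 1 ∈ P.1.1 := hw
  rw [h, mem_hull_singleton] at hw
  obtain ⟨a, -, ha⟩ := hw
  have h1 := DFunLike.congr_fun ha (0, 1)
  rw [pt_height, AddMonoidHom.smul_apply, smul_eq_mul] at h1
  rw [hgv, smul_smul, ← h1, one_smul] at ha
  exact pt_inj ha

end Cell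

variable (hΔ : Δ.support ⊆ halfSpace M)
include hΔ

lemma height_nonneg (δ : Δ.Cone) {x : NR (M × ℤ)} (hx : x ∈ δ.1) : 0 ≤ x (0, 1) :=
  hΔ (Set.mem_biUnion δ.2 hx)

/-- The cone over a vertex `v` is the ray through `(v, 1)`. -/
lemma Cell.IsVertex.eq_hull {P : Cell Δ} {v : NR M} (hv : P.polyhedron = {v}) :
    P.1.1 = PointedCone.hull ℝ {pt v 1} := by
  have hvP : pt v 1 ∈ P.1.1 := by
    change v ∈ P.polyhedron
    rw [hv]; rfl
  refine le_antisymm ?_ (Submodule.span_le.mpr (by rintro _ rfl; exact hvP))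
  intro x hx
  rw [mem_hull_singleton]
  rcases (height_nonneg hΔ P.1 hx).eq_or_lt with h0 | h0
  · have h1 : (v + x.comp (AddMonoidHom.inl M ℤ)) ∈ P.polyhedron := by
      change pt _ 1 ∈ P.1.1
      have : pt (v + x.comp (AddMonoidHom.inl M ℤ)) 1 = pt v 1 + x := by
        conv_rhs => rw [eq_pt x, pt_add, ← h0, add_zero]
      rw [this]; exact add_mem hvP hx
    rw [hv] at h1
    have h2 : x.comp (AddMonoidHom.inl M ℤ) = 0 := by simpa using h1
    refine ⟨0, le_rfl, ?_⟩
    rw [zero_smul, eq_pt x, h2, ← h0]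
    ext m; simp
  · obtain ⟨w, hw, hxw⟩ := exists_slice_of_height_pos hx h0
    have hw : w ∈ P.polyhedron := hw
    rw [hv] at hw
    exact ⟨_, h0.le, by rw [← (show w = v from hw)]; exact hxw⟩

/-- Extremal generators of a cone of the fan either have height zero or span a vertex. -/
lemma exists_vertex_generators (δ : Δ.Cone) :
    ∃ G : Finset (M × ℤ →+ ℤ), δ.1 = PointedCone.hull ℝ (toNR '' (G : Set (M × ℤ →+ ℤ))) ∧
      ∀ g ∈ G, g (0, 1) = 0 ∨ (0 < g (0, 1) ∧ ∃ V : Cell Δ, V.IsVertex ∧ V.1 ≤ δ ∧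
        V.1.1 = PointedCone.hull ℝ {toNR g}) := by
  obtain ⟨G, hG, hface⟩ := exists_extremal_generators (Δ.rational _ δ.2) (Δ.pointed _ δ.2)
  refine ⟨G, hG, fun g hg => ?_⟩
  have hgδ : toNR g ∈ δ.1 := hG ▸ Submodule.subset_span ⟨g, hg, rfl⟩
  have h0 : (0 : ℝ) ≤ (g (0, 1) : ℝ) := height_nonneg hΔ δ hgδ
  have h0 : 0 ≤ g (0, 1) := by exact_mod_cast h0
  rcases h0.eq_or_lt with h | h
  · exact Or.inl h.symm
  · right
    have hpos : 0 < toNR g (0, 1) := by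
      rw [toNR_apply]; exact_mod_cast h
    let ρ : Δ.Cone := ⟨_, Δ.face_mem _ δ.2 _ (hface g hg).2⟩
    exact ⟨h, Cell.ofHeightPos ρ ⟨toNR g, Submodule.subset_span rfl, hpos⟩,
      Cell.isVertex_of_ray hpos rfl, (hface g hg).2.le, rfl⟩

/-- Every cell has a vertex. -/
lemma exists_vertex_le (P : Cell Δ) : ∃ V : Cell Δ, V.IsVertex ∧ V ≤ P := by
  obtain ⟨G, hG, hV⟩ := exists_vertex_generators hΔ P.1
  by_contra hcon
  have h0 : ∀ g ∈ G, g (0, 1) = 0 := by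
    intro g hg
    refine (hV g hg).resolve_right ?_
    rintro ⟨-, V, hV, hVP, -⟩
    exact hcon ⟨V, hV, hVP⟩
  have h1 : -(0, 1) ∈ dualMonoid P.1.1 := by
    rw [hG]
    refine mem_dualMonoid_hull ?_
    rintro _ ⟨g, hg, rfl⟩
    rw [toNR_apply, map_neg, h0 g hg]; simp
  obtain ⟨x, hx, hx'⟩ := P.exists_height_pos
  have := h1 x hx
  rw [map_neg] at this
  linarith

/-- If the vertices of `δ` are lattice points, a character that is positive on all of them is at
least the height. -/
lemma sub_mem_of_lattice (δ : Δ.Cone) {m : M × ℤ} (hm : m ∈ dualMonoid δ.1)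
    (hlat : ∀ V : Cell Δ, V.IsVertex → ∃ n : M →+ ℤ, V.polyhedron = {toNR n})
    (h : ∀ V : Cell Δ, V.IsVertex → V.1 ≤ δ → m ∉ perp V.1.1) :
    m - (0, 1) ∈ dualMonoid δ.1 := by
  obtain ⟨G, hG, hV⟩ := exists_vertex_generators hΔ δ
  rw [hG]
  refine mem_dualMonoid_hull ?_
  rintro _ ⟨g, hg, rfl⟩
  have hgδ : toNR g ∈ δ.1 := hG ▸ Submodule.subset_span ⟨g, hg, rfl⟩
  rw [map_sub]
  rcases hV g hg with h0 | ⟨h0, V, hVv, hVδ, hVg⟩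
  · rw [toNR_apply _ (0, 1), h0, Int.cast_zero, sub_zero]; exact hm _ hgδ
  · obtain ⟨w, hw⟩ := hlat V hVv
    have hVw := Cell.IsVertex.eq_hull hΔ hw
    -- the value of `m` at the vertex is a positive integer
    have hval : pt (toNR w) 1 m = ((w m.1 + m.2 : ℤ) : ℝ) := by simp
    have hwV : pt (toNR w) 1 ∈ V.1.1 := hVw ▸ Submodule.subset_span rfl
    have h1 : 0 ≤ w m.1 + m.2 := by
      have := hm _ (hVδ hwV)
      rw [hval] at this
      exact_mod_cast this
    have h2 : w m.1 + m.2 ≠ 0 := by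
      intro hz
      refine h V hVv hVδ ?_
      rw [hVw]
      intro x hx
      obtain ⟨a, -, rfl⟩ := mem_hull_singleton.mp hx
      rw [AddMonoidHom.smul_apply, hval, hz]; simp
    have h3 : (1 : ℝ) ≤ pt (toNR w) 1 m := by
      rw [hval]
      exact_mod_cast (show 1 ≤ w m.1 + m.2 by omega)
    have hgV : toNR g ∈ V.1.1 := hVg ▸ Submodule.subset_span rfl
    rw [hVw] at hgV
    obtain ⟨a, ha, hga⟩ := mem_hull_singleton.mp hgV
    rw [hga, AddMonoidHom.smul_apply, AddMonoidHom.smul_apply, pt_height, smul_eq_mul, smul_eq_mul]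
    nlinarith

end Cells

/-! ### Edges: connectedness of the graph of a cell -/

lemma exists_generator_of_finrank_eq_one {V : Type*} [AddCommGroup V] [Module ℝ V]
    {p : Submodule ℝ V} (h : Module.finrank ℝ p = 1) :
    ∃ d ∈ p, d ≠ 0 ∧ ∀ w ∈ p, ∃ c : ℝ, w = c • d := by
  obtain ⟨d, hd0, hd⟩ := finrank_eq_one_iff'.mp h
  refine ⟨d, d.2, fun h0 => hd0 (Subtype.ext h0), fun w hw => ?_⟩
  obtain ⟨c, hc⟩ := hd ⟨w, hw⟩
  exact ⟨c, (congrArg Subtype.val hc).symm⟩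

section Edges

variable {M : Type u} [AddCommGroup M] {Δ : Fan (M × ℤ)} (hΔ : Δ.support ⊆ halfSpace M)
include hΔ

/-- If a character `m ∈ V^⊥` is negative somewhere on the cell `R`, but nonnegative on its
recession cone, then an edge of `R` leads from the vertex `V` to a vertex at which `m` is
negative. -/
lemma exists_edge {V R : Cell Δ} (hV : V.IsVertex) (hVR : V ≤ R) {m : M × ℤ} (hm : m ∈ perp V.1.1)
    (hneg : ∃ x ∈ R.1.1, x m < 0) (hrec : ∀ x ∈ R.1.1, x (0, 1) = 0 → 0 ≤ x m) :
    ∃ E V' : Cell Δ, E.IsEdge ∧ V'.IsVertex ∧ V ≤ E ∧ V' ≤ E ∧ E ≤ R ∧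
      ∀ v, V'.polyhedron = {v} → pt v 1 m < 0 := by
  have hVR' : V.1 ≤ R.1 := hVR
  -- an extremal ray of the star of `V` on which `m` is negative
  obtain ⟨G, hG, hface⟩ := exists_extremal_generators
    ((Δ.star V.1).rational _ (Δ.starCone hVR').2) ((Δ.star V.1).pointed _ (Δ.starCone hVR').2)
  obtain ⟨g, hg, hgm⟩ : ∃ g ∈ G, toNR g ⟨m, hm⟩ < 0 := by
    by_contra! hcon
    have h1 : (⟨m, hm⟩ : perp V.1.1) ∈ dualMonoid (Δ.starCone hVR').1 := by
      rw [hG]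
      refine mem_dualMonoid_hull ?_
      rintro _ ⟨g, hg, rfl⟩
      exact hcon g hg
    obtain ⟨x, hx, hx'⟩ := hneg
    have := h1 _ ⟨x, hx, rfl⟩
    exact absurd hx' (not_lt.mpr this)
  obtain ⟨ε, hVε, hε⟩ := Fan.exists_eq_starCone
    (⟨_, (Δ.star V.1).face_mem _ (Δ.starCone hVR').2 _ (hface g hg).2⟩ : (Δ.star V.1).Cone)
  have hε : PointedCone.hull ℝ {toNR g} = (Δ.starCone hVε).1 := congrArg Subtype.val hε
  have hεR : ε ≤ R.1 := by
    rw [← Fan.starCone_le_iff hVε hVR']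
    change (Δ.starCone hVε).1 ≤ (Δ.starCone hVR').1
    rw [← hε]; exact (hface g hg).2.le
  -- the corresponding cone has a further vertex
  obtain ⟨G', hG', hV'⟩ := exists_vertex_generators hΔ ε
  obtain ⟨g', hg', hgm'⟩ : ∃ g' ∈ G', toNR g' m < 0 := by
    by_contra! hcon
    have h1 : m ∈ dualMonoid ε.1 := by
      rw [hG']
      refine mem_dualMonoid_hull ?_
      rintro _ ⟨g, hg, rfl⟩
      exact hcon g hg
    obtain ⟨x, hx, hx'⟩ : toNR g ∈ (Δ.starCone hVε).1 := hε ▸ Submodule.subset_span rfl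
    have h2 := h1 x hx
    have h3 : res V.1.1 x ⟨m, hm⟩ = toNR g ⟨m, hm⟩ := DFunLike.congr_fun hx' _
    rw [← h3] at hgm
    exact absurd hgm (not_lt.mpr h2)
  have hgε : toNR g' ∈ ε.1 := hG' ▸ Submodule.subset_span ⟨g', hg', rfl⟩
  rcases hV' g' hg' with h0 | ⟨h0, V', hV'v, hV'ε, hV'g⟩
  · exact absurd hgm' (not_lt.mpr (hrec _ (hεR hgε) (by simp [h0])))
  obtain ⟨v, hv⟩ := hV
  obtain ⟨v', hv'⟩ := hV'v
  have hVh := Cell.IsVertex.eq_hull hΔ hv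
  have hVh' := Cell.IsVertex.eq_hull hΔ hv'
  have hvV : pt v 1 ∈ V.1.1 := hVh ▸ Submodule.subset_span rfl
  have hvV' : pt v' 1 ∈ V'.1.1 := hVh' ▸ Submodule.subset_span rfl
  have hv'm : pt v' 1 m < 0 := by
    have h1 : toNR g' ∈ V'.1.1 := hV'g ▸ Submodule.subset_span rfl
    rw [hVh'] at h1
    obtain ⟨a, ha, hga⟩ := mem_hull_singleton.mp h1
    rw [hga, AddMonoidHom.smul_apply, smul_eq_mul] at hgm'
    by_contra! hcon
    exact absurd hgm' (not_lt.mpr (mul_nonneg ha hcon))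
  refine ⟨V.ofLE hVε, V', ?_, ⟨v', hv'⟩, hVε, hV'ε, hεR, ?_⟩
  · -- every point of the slice lies on the line through `v` and `v'`
    have hray : ∀ x ∈ ε.1, ∃ a : ℝ, 0 ≤ a ∧ res V.1.1 x = a • toNR g := by
      intro x hx
      have : res V.1.1 x ∈ PointedCone.hull ℝ {toNR g} := by rw [hε]; exact ⟨x, hx, rfl⟩
      exact mem_hull_singleton.mp this
    obtain ⟨b, hb, hbg⟩ := hray _ (hV'ε hvV')
    have hb0 : b ≠ 0 := by
      rintro rfl
      have := DFunLike.congr_fun hbg ⟨m, hm⟩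
      rw [zero_smul] at this
      exact absurd hv'm (by rw [show pt v' 1 m = 0 from this]; exact lt_irrefl _)
    have hline : ∀ x ∈ slice ε.1, ∃ c : ℝ, x - v = c • (v' - v) := by
      intro x hx
      obtain ⟨a, ha, hag⟩ := hray _ hx
      have h1 : res V.1.1 (pt x 1) = res V.1.1 ((a / b) • pt v' 1) := by
        rw [map_smul, hbg, smul_smul, div_mul_cancel₀ _ hb0, hag]
      obtain ⟨s, hs, t, ht, hst⟩ := res_eq_res (Δ.rational _ V.1.2) h1
      rw [hVh] at hs ht
      obtain ⟨p, -, rfl⟩ := mem_hull_singleton.mp hs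
      obtain ⟨q, -, rfl⟩ := mem_hull_singleton.mp ht
      simp only [smul_pt, pt_add] at hst
      have hh := DFunLike.congr_fun hst (0, 1)
      simp only [pt_height, mul_one] at hh
      refine ⟨a / b, ?_⟩
      ext u
      have hu := DFunLike.congr_fun hst (u, 0)
      simp only [pt_apply, AddMonoidHom.add_apply, AddMonoidHom.smul_apply, smul_eq_mul,
        Int.cast_zero, mul_zero, add_zero] at hu
      simp only [AddMonoidHom.sub_apply, AddMonoidHom.smul_apply, smul_eq_mul]
      have hp : p = a / b + q - 1 := by linarith
      rw [hp] at hu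
      linear_combination hu
    have hvε : v ∈ slice ε.1 := hVε hvV
    have hvε' : v' ∈ slice ε.1 := hV'ε hvV'
    have hspan : vectorSpan ℝ (slice ε.1) = Submodule.span ℝ {v' - v} := by
      refine le_antisymm ?_ ?_
      · rw [vectorSpan_eq_span_vsub_set_right ℝ hvε, Submodule.span_le]
        rintro _ ⟨x, hx, rfl⟩
        obtain ⟨c, hc⟩ := hline x hx
        exact Submodule.mem_span_singleton.mpr ⟨c, hc.symm⟩
      · rw [Submodule.span_le]
        rintro _ rfl
        exact vsub_mem_vectorSpan ℝ hvε' hvε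
    change Module.finrank ℝ (vectorSpan ℝ (slice ε.1)) = 1
    rw [hspan]
    refine finrank_span_singleton fun h0 => ?_
    have : v' = v := sub_eq_zero.mp h0
    rw [this] at hv'm
    exact absurd (hm _ hvV) hv'm.ne
  · intro w hw
    rw [hv'] at hw
    rw [← Set.singleton_injective hw]
    exact hv'm

/-- The graph of vertices and edges of a cell is connected, in the form of an induction principle.
Along an edge that decreases a functional exposing `W`, one comes closer to `W`. -/
theorem vertex_induction {R W : Cell Δ} (hW : W.IsVertex) (hWR : W ≤ R) {p : Cell Δ → Prop}
    (hpW : p W) (step : ∀ V V' E : Cell Δ, V.IsVertex → V'.IsVertex → E.IsEdge → V ≤ E → V' ≤ E →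
      E ≤ R → p V' → p V) {V : Cell Δ} (hV : V.IsVertex) (hVR : V ≤ R) : p V := by
  obtain ⟨u, hu, huW⟩ := Fan.exists_exposing (show W.1 ≤ R.1 from hWR)
  have hfin : {V : Cell Δ | V.IsVertex ∧ V ≤ R ∧ ¬ p V}.Finite := by
    have := Δ.finite.to_subtype
    exact Set.toFinite _
  by_contra hpV
  -- among the vertices of `R` without the property, take one at which `u` is smallest
  choose! w hw using fun (V : Cell Δ) (hV : V.IsVertex) => hV
  obtain ⟨V, ⟨hV, hVR, hpV⟩, hmin⟩ := hfin.exists_minimalFor (fun V => pt (w V) 1 u) _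
    ⟨V, hV, hVR, hpV⟩
  have hVh := Cell.IsVertex.eq_hull hΔ (hw V hV)
  -- a lattice generator of the ray over `V`
  obtain ⟨n, hn0, hnV⟩ : ∃ n : M × ℤ →+ ℤ, 0 < n (0, 1) ∧ V.1.1 = PointedCone.hull ℝ {toNR n} := by
    obtain ⟨G, hG, hgen⟩ := exists_vertex_generators hΔ V.1
    obtain ⟨g, hg, hg0⟩ : ∃ g ∈ G, g (0, 1) ≠ 0 := by
      by_contra! hcon
      obtain ⟨x, hx, hx'⟩ := V.exists_height_pos
      have h1 : -(0, 1) ∈ dualMonoid V.1.1 := by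
        rw [hG]
        refine mem_dualMonoid_hull ?_
        rintro _ ⟨g, hg, rfl⟩
        rw [toNR_apply, map_neg, hcon g hg]; simp
      have := h1 x hx
      rw [map_neg] at this
      linarith
    obtain ⟨hpos, -⟩ := (hgen g hg).resolve_left hg0
    refine ⟨g, hpos, ?_⟩
    have hgV : toNR g ∈ V.1.1 := hG ▸ Submodule.subset_span ⟨g, hg, rfl⟩
    refine le_antisymm ?_ (Submodule.span_le.mpr (by rintro _ rfl; exact hgV))
    rw [hVh] at hgV ⊢
    obtain ⟨a, ha, hga⟩ := mem_hull_singleton.mp hgV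
    have ha0 : a ≠ 0 := by
      rintro rfl
      have := DFunLike.congr_fun hga (0, 1)
      simp at this
      omega
    refine Submodule.span_le.mpr ?_
    rintro _ rfl
    refine mem_hull_singleton.mpr ⟨a⁻¹, inv_nonneg.mpr ha, ?_⟩
    rw [hga, smul_smul, inv_mul_cancel₀ ha0, one_smul]
  have hnV' : toNR n ∈ V.1.1 := hnV ▸ Submodule.subset_span rfl
  -- a positive multiple of `u`, corrected by a multiple of the height so as to vanish on `V`
  set m : M × ℤ := n (0, 1) • u - n u • (0, 1) with hmdef
  have hval : ∀ x : NR (M × ℤ), x m = n (0, 1) * x u - n u * x (0, 1) := by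
    intro x
    rw [hmdef, map_sub, map_zsmul, map_zsmul, zsmul_eq_mul, zsmul_eq_mul]
  have hm : m ∈ perp V.1.1 := by
    rw [hnV]
    intro x hx
    obtain ⟨a, -, rfl⟩ := mem_hull_singleton.mp hx
    rw [hval]
    simp
    ring
  have hn0' : (0 : ℝ) < n (0, 1) := by exact_mod_cast hn0
  have hWV : ¬ V ≤ W := by
    intro hle
    refine hpV ?_
    have h1 : W.1.1 = PointedCone.hull ℝ {pt (w W) 1} := Cell.IsVertex.eq_hull hΔ (hw W hW)
    have h2 : pt (w V) 1 ∈ V.1.1 := hVh ▸ Submodule.subset_span rfl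
    have h3 : w V ∈ W.polyhedron := hle h2
    rw [hw W hW] at h3
    have h4 : V = W := by
      refine Subtype.ext (Subtype.ext ?_)
      rw [hVh, h1, show w V = w W from h3]
    rw [h4]; exact hpW
  have hnu : (0 : ℝ) < n u := by
    have h1 : 0 ≤ toNR n u := hu _ (hVR hnV')
    rcases h1.eq_or_lt with h2 | h2
    · exfalso
      refine hWV ?_
      change V.1.1 ≤ W.1.1
      rw [hnV]
      refine Submodule.span_le.mpr ?_
      rintro _ rfl
      exact (huW _ (hVR hnV')).mpr h2.symm
    · exact h2
  obtain ⟨E, V', hE, hV', hVE, hVE', hER, hlt⟩ := exists_edge hΔ hV hVR hm (by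
      refine ⟨pt (w W) 1, hWR ?_, ?_⟩
      · rw [Cell.IsVertex.eq_hull hΔ (hw W hW)]; exact Submodule.subset_span rfl
      · have h1 : pt (w W) 1 ∈ W.1.1 := by
          rw [Cell.IsVertex.eq_hull hΔ (hw W hW)]; exact Submodule.subset_span rfl
        rw [hval, (huW _ (hWR h1)).mp h1, pt_height]
        linarith) (by
      intro x hx hx0
      rw [hval, hx0, mul_zero, sub_zero]
      exact mul_nonneg hn0'.le (hu x hx))
  have hlt' := hlt _ (hw V' hV')
  have hVm : pt (w V) 1 m = 0 := hm _ (hVh ▸ Submodule.subset_span rfl)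
  rw [hval, pt_height] at hlt' hVm
  have hless : pt (w V') 1 u < pt (w V) 1 u := by
    nlinarith
  refine hpV (step V V' E hV hV' hE hVE hVE' hER ?_)
  by_contra hpV'
  have := hmin ⟨hV', hVE'.trans hER, hpV'⟩ hless.le
  exact absurd hless (not_lt.mpr this)

/-- In the star of a vertex, the cone over an edge is a ray. -/
lemma exists_starCone_eq_ray {V E : Cell Δ} (hV : V.IsVertex) (hE : E.IsEdge) (h : V.1 ≤ E.1) :
    ∃ g : perp V.1.1 →+ ℤ, toNR g ≠ 0 ∧ (Δ.starCone h).1 = PointedCone.hull ℝ {toNR g} := by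
  obtain ⟨v, hv⟩ := hV
  have hVh := Cell.IsVertex.eq_hull hΔ hv
  have hvV : pt v 1 ∈ V.1.1 := hVh ▸ Submodule.subset_span rfl
  obtain ⟨d, hdE, hd0, hd⟩ := exists_generator_of_finrank_eq_one hE
  have hvE : v ∈ E.polyhedron := h hvV
  have hdiff : ∀ x ∈ E.polyhedron, ∃ s : ℝ, x - v = s • d := by
    intro x hx
    exact hd _ (vsub_mem_vectorSpan ℝ hx hvE)
  have hres0 : ∀ r : ℝ, res V.1.1 (r • pt v 1) = 0 := by
    intro r
    ext m
    change (r • pt v 1) m = 0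
    rw [AddMonoidHom.smul_apply, m.2 _ hvV, smul_zero]
  -- modulo the ray over `V`, all of `E` lies on a line
  have hline : ∀ x ∈ E.1.1, ∃ s : ℝ, res V.1.1 x = s • res V.1.1 (pt d 0) := by
    intro x hx
    have hx0 := height_nonneg hΔ E.1 hx
    obtain ⟨r, y, hy, hxy⟩ : ∃ (r : ℝ) (y : NR M), y ∈ E.polyhedron ∧
        ∃ c : ℝ, x + r • pt v 1 = c • pt y 1 := by
      rcases hx0.eq_or_lt with h0 | h0
      · refine ⟨1, v + x.comp (AddMonoidHom.inl M ℤ), ?_, 1, ?_⟩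
        · change pt _ 1 ∈ E.1.1
          have : pt (v + x.comp (AddMonoidHom.inl M ℤ)) 1 = pt v 1 + x := by
            conv_rhs => rw [eq_pt x, pt_add, ← h0, add_zero]
          rw [this]; exact add_mem (h hvV) hx
        · conv_lhs => rw [eq_pt x, ← h0]
          rw [one_smul, one_smul, pt_add, zero_add, add_comm]
      · obtain ⟨y, hy, hxy⟩ := exists_slice_of_height_pos hx h0
        exact ⟨0, y, hy, _, by rw [zero_smul, add_zero]; exact hxy⟩
    obtain ⟨c, hc⟩ := hxy
    obtain ⟨s, hs⟩ := hdiff y hy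
    have e : pt y 1 = (1 : ℝ) • pt v 1 + s • pt d 0 := by
      rw [smul_pt, smul_pt, pt_add, ← hs]; simp
    refine ⟨c * s, ?_⟩
    have := congrArg (res V.1.1) hc
    rw [map_add, hres0, add_zero, map_smul, e, map_add, hres0, zero_add, map_smul, smul_smul] at this
    exact this
  have hrat := (Δ.star V.1).rational _ (Δ.starCone h).2
  have hpt := (Δ.star V.1).pointed _ (Δ.starCone h).2
  obtain ⟨G, hG, hgen⟩ := exists_extremal_generators hrat hpt
  obtain ⟨g, hg⟩ : ∃ g, g ∈ G := by
    by_contra! hcon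
    have hG0 : G = ∅ := Finset.eq_empty_of_forall_notMem hcon
    have hbot : (Δ.starCone h).1 = ⊥ := by
      rw [hG, hG0]; simp
    have hEV : E.1 ≤ V.1 := by
      rw [← Fan.starCone_le_iff h le_rfl]
      change (Δ.starCone h).1 ≤ _
      rw [hbot]; exact bot_le
    have hsub : E.polyhedron ⊆ {v} := by
      rw [← hv]
      exact fun x hx => hEV hx
    have h1 : vectorSpan ℝ E.polyhedron = ⊥ :=
      vectorSpan_of_subsingleton ℝ (Set.subsingleton_singleton.anti hsub)
    exact hd0 ((Submodule.eq_bot_iff _).mp h1 _ hdE)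
  have hmem : ∀ a ∈ G, toNR a ∈ (Δ.starCone h).1 := fun a ha => by
    rw [hG]; exact Submodule.subset_span ⟨a, ha, rfl⟩
  -- all extremal generators lie on this line; by strong convexity, on the same side of the origin
  have hmul : ∀ a ∈ G, ∃ s : ℝ, s ≠ 0 ∧ toNR a = s • res V.1.1 (pt d 0) := by
    intro a ha
    obtain ⟨x, hx, hxa⟩ := hmem a ha
    obtain ⟨s, hs⟩ := hline x hx
    have e : toNR a = s • res V.1.1 (pt d 0) := by rw [← hs]; exact hxa.symm
    exact ⟨s, fun h0 => (hgen a ha).1 (by rw [e, h0, zero_smul]), e⟩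
  refine ⟨g, (hgen g hg).1, le_antisymm ?_ (Submodule.span_le.mpr (by rintro _ rfl; exact hmem g hg))⟩
  conv_lhs => rw [hG]
  refine Submodule.span_le.mpr ?_
  rintro _ ⟨a, ha, rfl⟩
  obtain ⟨s, hs0, hs⟩ := hmul g hg
  obtain ⟨t, ht0, ht⟩ := hmul a ha
  have e : toNR a = (t / s) • toNR g := by rw [hs, ht, smul_smul, div_mul_cancel₀ _ hs0]
  rcases le_or_gt 0 (t / s) with h0 | h0
  · exact mem_hull_singleton.mpr ⟨_, h0, e⟩
  · exfalso
    refine (hgen a ha).1 ?_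
    have : toNR a ∈ (Δ.starCone h).1.lineal := by
      refine ⟨hmem a ha, ?_⟩
      change -toNR a ∈ (Δ.starCone h).1
      rw [e, ← neg_smul]
      exact (Δ.starCone h).1.smul_mem (by linarith) (hmem g hg)
    rw [hpt] at this
    exact this

end Edges

/-! ### Charts and orbits of a toric variety -/

namespace Fan

variable (k : Type u) [Field k] {M : Type u} [AddCommGroup M] (Δ : Fan M)

/-- The open cover of a toric variety by its affine charts. -/
def openCover : (Δ.toricVariety k).OpenCover :=
  Scheme.IsLocallyDirected.openCover (Δ.functor k)

instance (σ : Δ.Cone) : IsOpenImmersion (Δ.ι k σ) :=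
  inferInstanceAs (IsOpenImmersion (colimit.ι (Δ.functor k) σ))

instance {σ τ : Δ.Cone} (h : τ ≤ σ) : IsOpenImmersion (chartMap k (show τ.1 ≤ σ.1 from h)) :=
  isOpenImmersion_chartMap k _ (Δ.rational _ σ.2) (Δ.isFaceOf h)

@[simp] lemma chartMap_ι {τ σ : Δ.Cone} (h : τ ≤ σ) :
    chartMap k (show τ.1 ≤ σ.1 from h) ≫ Δ.ι k σ = Δ.ι k τ :=
  colimit.w (Δ.functor k) (homOfLE h)

lemma ι_chartMap_apply {τ σ : Δ.Cone} (h : τ ≤ σ) (y : chart k τ.1) :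
    Δ.ι k σ (chartMap k (show τ.1 ≤ σ.1 from h) y) = Δ.ι k τ y := by
  rw [← chartMap_ι k Δ h]; rfl

lemma exists_ι_eq (x : Δ.toricVariety k) : ∃ (σ : Δ.Cone) (y : chart k σ.1), Δ.ι k σ y = x :=
  Scheme.IsLocallyDirected.ι_jointly_surjective (Δ.functor k) x

variable {k Δ} in
lemma hom_ext {T : Scheme.{u}} {f g : Δ.toricVariety k ⟶ T}
    (h : ∀ σ, Δ.ι k σ ≫ f = Δ.ι k σ ≫ g) : f = g :=
  colimit.hom_ext h

lemma exists_of_ι_eq_ι {σ τ : Δ.Cone} {y : chart k σ.1} {y' : chart k τ.1}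
    (h : Δ.ι k σ y = Δ.ι k τ y') : ∃ (ρ : Δ.Cone) (hσ : ρ ≤ σ) (hτ : ρ ≤ τ) (z : chart k ρ.1),
      chartMap k (show ρ.1 ≤ σ.1 from hσ) z = y ∧ chartMap k (show ρ.1 ≤ τ.1 from hτ) z = y' := by
  obtain ⟨ρ, f, g, z, hz, hz'⟩ := (Scheme.IsLocallyDirected.ι_eq_ι_iff (Δ.functor k)).mp h
  exact ⟨ρ, leOfHom f, leOfHom g, z, hz, hz'⟩

lemma mem_range_ι_inter {σ τ : Δ.Cone} {x : Δ.toricVariety k} (hσ : x ∈ Set.range (Δ.ι k σ))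
    (hτ : x ∈ Set.range (Δ.ι k τ)) : x ∈ Set.range (Δ.ι k (Δ.inter σ τ)) := by
  obtain ⟨y, rfl⟩ := hσ
  obtain ⟨y', hy'⟩ := hτ
  obtain ⟨ρ, hρσ, hρτ, z, rfl, -⟩ := Δ.exists_of_ι_eq_ι k hy'.symm
  have hρ : ρ ≤ Δ.inter σ τ := le_inter hρσ hρτ
  refine ⟨chartMap k (show ρ.1 ≤ (Δ.inter σ τ).1 from hρ) z, ?_⟩
  rw [ι_chartMap_apply k Δ hρ, ι_chartMap_apply k Δ hρσ]

lemma exists_orbitCone (x : Δ.toricVariety k) :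
    ∃ σ : Δ.Cone, ∀ τ : Δ.Cone, x ∈ Set.range (Δ.ι k τ) ↔ σ ≤ τ := by
  have := Δ.finite.to_subtype
  obtain ⟨σ₀, y, hy⟩ := Δ.exists_ι_eq k x
  obtain ⟨σ, hσ, hmin⟩ := (Set.toFinite {σ : Δ.Cone | x ∈ Set.range (Δ.ι k σ)}).exists_minimal
    ⟨σ₀, y, hy⟩
  refine ⟨σ, fun τ => ⟨fun hτ => ?_, fun h => ?_⟩⟩
  · exact (hmin (Δ.mem_range_ι_inter k hσ hτ) (inter_le_left σ τ)).trans (inter_le_right σ τ)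
  · obtain ⟨y, rfl⟩ := hσ
    exact ⟨_, Δ.ι_chartMap_apply k h y⟩

variable {k Δ}

/-- The smallest cone `σ` such that `x` lies in the chart `U_σ`; it indexes the torus orbit that
contains `x`. -/
def orbitCone (x : Δ.toricVariety k) : Δ.Cone := (Δ.exists_orbitCone k x).choose

lemma mem_range_ι_iff {x : Δ.toricVariety k} {σ : Δ.Cone} :
    x ∈ Set.range (Δ.ι k σ) ↔ orbitCone x ≤ σ :=
  (Δ.exists_orbitCone k x).choose_spec σ

lemma orbitCone_ι_le {σ : Δ.Cone} (y : chart k σ.1) : orbitCone (Δ.ι k σ y) ≤ σ :=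
  mem_range_ι_iff.mp ⟨y, rfl⟩

lemma exists_ι_orbitCone_eq (x : Δ.toricVariety k) :
    ∃ y : chart k (orbitCone x).1, Δ.ι k (orbitCone x) y = x :=
  mem_range_ι_iff.mpr le_rfl

lemma ι_injective (σ : Δ.Cone) : Function.Injective (Δ.ι k σ) :=
  (Δ.ι k σ).isOpenEmbedding.injective

/-- The ideal of functions in the chart `U_σ` vanishing at a point of it. -/
def pointIdeal {σ : PointedCone ℝ (NR M)} (y : chart k σ) : Ideal (semigroupRing k σ) :=
  PrimeSpectrum.asIdeal (R := semigroupRing k σ) y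

lemma pointIdeal_chartMap {τ σ : PointedCone ℝ (NR M)} (h : τ ≤ σ) (y : chart k τ) :
    pointIdeal (chartMap k h y) = (pointIdeal y).comap (restr k h) := rfl

/-- The characters that do not vanish at a point are those orthogonal to the cone of its orbit. -/
theorem single_notMem_pointIdeal {σ : Δ.Cone} (y : chart k σ.1) (m : dualMonoid σ.1) :
    AddMonoidAlgebra.single m (1 : k) ∉ pointIdeal y ↔ (m : M) ∈ perp (orbitCone (Δ.ι k σ y)).1 := by
  set ρ := orbitCone (Δ.ι k σ y) with hρdef
  have hρ : ρ ≤ σ := orbitCone_ι_le y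
  constructor
  · intro hm
    have hcut : cut σ m m.2 ≤ σ := cut_le σ m m.2
    have hr := range_chartMap k (show (cut σ m m.2).1 ≤ σ.1 from hcut) (Δ.rational _ σ.2) m
      (fun x hx => ⟨fun h => h.2, fun h => ⟨hx, h⟩⟩)
    have hy : y ∈ Set.range (chartMap k (show (cut σ m m.2).1 ≤ σ.1 from hcut)) := by
      rw [hr]; exact hm
    obtain ⟨z, hz⟩ := hy
    rw [mem_perp_iff_le_cut hρ m m.2, hρdef, ← mem_range_ι_iff]
    exact ⟨z, by rw [← hz, ι_chartMap_apply k Δ hcut]⟩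
  · intro hm hmem
    obtain ⟨z, hz⟩ : ∃ z : chart k ρ.1, Δ.ι k ρ z = Δ.ι k σ y := exists_ι_orbitCone_eq _
    have hzy : chartMap k (show ρ.1 ≤ σ.1 from hρ) z = y :=
      ι_injective σ (by rw [ι_chartMap_apply k Δ hρ]; exact hz)
    rw [← hzy, pointIdeal_chartMap, Ideal.mem_comap, restr_single] at hmem
    -- the character is invertible on the chart of `ρ`
    refine (PrimeSpectrum.isPrime (R := semigroupRing k ρ.1) z).ne_top
      (Ideal.eq_top_of_isUnit_mem _ hmem ?_)
    have hneg : -(m : M) ∈ dualMonoid ρ.1 := fun v hv => by rw [map_neg, hm v hv, neg_zero]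
    refine IsUnit.of_mul_eq_one (AddMonoidAlgebra.single ⟨-(m : M), hneg⟩ 1) ?_
    rw [AddMonoidAlgebra.single_mul_single, AddMonoidAlgebra.one_def]
    congr 1
    · ext; simp
    · simp

end Fan

/-! ### Orbit closures -/

section SemigroupRing

variable {k : Type u} [Field k] {M : Type u} [AddCommGroup M]

lemma semigroupRing_hom_ext {σ : PointedCone ℝ (NR M)} {R : Type*} [Semiring R]
    {f g : semigroupRing k σ →+* R}
    (h : ∀ m a, f (AddMonoidAlgebra.single m a) = g (AddMonoidAlgebra.single m a)) : f = g :=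
  AddMonoidAlgebra.ringHom_ext (fun a => h 0 a) (fun m => h m 1)

lemma single_eq_mul (σ : PointedCone ℝ (NR M)) (m : dualMonoid σ) (a : k) :
    (AddMonoidAlgebra.single m a : semigroupRing k σ) =
      AddMonoidAlgebra.single 0 a * AddMonoidAlgebra.single m 1 := by
  rw [AddMonoidAlgebra.single_mul_single, zero_add, mul_one]

/-- An ideal contains every element that is a combination of characters in it. -/
lemma mem_ideal_of_support {σ : PointedCone ℝ (NR M)} {I : Ideal (semigroupRing k σ)}
    {f : semigroupRing k σ} (h : ∀ m, f.coeff m ≠ 0 → AddMonoidAlgebra.single m (1 : k) ∈ I) :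
    f ∈ I := by
  have hf : f = ∑ m ∈ f.coeff.support, AddMonoidAlgebra.single m (f.coeff m) := by
    apply AddMonoidAlgebra.coeff_injective
    rw [AddMonoidAlgebra.coeff_sum]
    exact (Finsupp.sum_single f.coeff).symm
  rw [hf]
  refine Ideal.sum_mem _ fun m hm => ?_
  rw [single_eq_mul]
  exact Ideal.mul_mem_left _ _ (h m (Finsupp.mem_support_iff.mp hm))

end SemigroupRing

namespace Fan

variable (k : Type u) [Field k] {M : Type u} [AddCommGroup M] (Δ : Fan M)

variable {Δ} in
lemma mem_dualMonoid_starCone {τ σ : Δ.Cone} (h : τ ≤ σ) {m : perp τ.1} :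
    m ∈ dualMonoid (Δ.starCone h).1 ↔ (m : M) ∈ dualMonoid σ.1 :=
  ⟨fun hm x hx => hm _ ⟨x, hx, rfl⟩, by
    rintro hm _ ⟨x, hx, rfl⟩
    exact hm x hx⟩

/-- A character of `S_σ` that is orthogonal to `τ`, as a character on the star of `τ`. -/
def starChar {τ σ : Δ.Cone} (h : τ ≤ σ) (m : dualMonoid σ.1) (hm : (m : M) ∈ perp τ.1) :
    dualMonoid (Δ.starCone h).1 :=
  ⟨⟨m, hm⟩, (mem_dualMonoid_starCone h).mpr m.2⟩

/-- A character on the star of `τ`, as a character on `σ`. -/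
def unstarChar {τ σ : Δ.Cone} (h : τ ≤ σ) (m : dualMonoid (Δ.starCone h).1) : dualMonoid σ.1 :=
  ⟨(m : perp τ.1), (mem_dualMonoid_starCone h).mp m.2⟩

lemma truncate_single {τ σ : Δ.Cone} (h : τ ≤ σ) (m : dualMonoid σ.1)
    (hm : (m : M) ∈ perp τ.1) (a : k) :
    Δ.truncate k h (AddMonoidAlgebra.single m a) =
      AddMonoidAlgebra.single (Δ.starChar h m hm) a := by
  classical
  change AddMonoidAlgebra.lift _ _ _ _ _ = _
  rw [AddMonoidAlgebra.lift_single]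
  change a • dite _ _ _ = _
  rw [dif_pos (by exact hm), AddMonoidAlgebra.smul_single, smul_eq_mul, mul_one]
  rfl

lemma truncate_single_of_notMem {τ σ : Δ.Cone} (h : τ ≤ σ) (m : dualMonoid σ.1)
    (hm : (m : M) ∉ perp τ.1) (a : k) :
    Δ.truncate k h (AddMonoidAlgebra.single m a) = 0 := by
  classical
  change AddMonoidAlgebra.lift _ _ _ _ _ = _
  rw [AddMonoidAlgebra.lift_single]
  change a • dite _ _ _ = _
  rw [dif_neg (by exact hm), smul_zero]

lemma truncate_surjective {τ σ : Δ.Cone} (h : τ ≤ σ) : Function.Surjective (Δ.truncate k h) := by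
  intro f
  induction f using AddMonoidAlgebra.induction_linear with
  | zero => exact ⟨0, map_zero _⟩
  | add x y hx hy =>
    obtain ⟨a, rfl⟩ := hx
    obtain ⟨b, rfl⟩ := hy
    exact ⟨a + b, map_add _ _ _⟩
  | single m a =>
    exact ⟨_, Δ.truncate_single k h (Δ.unstarChar h m) (m : perp τ.1).2 a⟩

lemma coeff_truncate {τ σ : Δ.Cone} (h : τ ≤ σ) (f : semigroupRing k σ.1)
    (m : dualMonoid (Δ.starCone h).1) :
    (Δ.truncate k h f).coeff m = f.coeff (Δ.unstarChar h m) := by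
  classical
  induction f using AddMonoidAlgebra.induction_linear with
  | zero => rw [map_zero]; rfl
  | add x y hx hy =>
    rw [map_add, AddMonoidAlgebra.coeff_add, AddMonoidAlgebra.coeff_add, Finsupp.add_apply, hx, hy,
      Finsupp.add_apply]
  | single n a =>
    by_cases hn : (n : M) ∈ perp τ.1
    · rw [truncate_single k Δ h n hn, AddMonoidAlgebra.coeff_single, AddMonoidAlgebra.coeff_single,
        Finsupp.single_apply, Finsupp.single_apply]
      refine if_congr ⟨?_, ?_⟩ rfl rfl
      · rintro rfl; rfl
      · rintro rfl; rfl
    · rw [truncate_single_of_notMem k Δ h n hn, AddMonoidAlgebra.coeff_single,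
        Finsupp.single_apply, if_neg]
      · rfl
      · rintro rfl
        exact hn (m : perp τ.1).2

/-- The kernel of the truncation is generated by the characters not orthogonal to `τ`. -/
lemma ker_truncate_le_iff {τ σ : Δ.Cone} (h : τ ≤ σ) {I : Ideal (semigroupRing k σ.1)} :
    RingHom.ker (Δ.truncate k h) ≤ I ↔
      ∀ m : dualMonoid σ.1, (m : M) ∉ perp τ.1 → AddMonoidAlgebra.single m (1 : k) ∈ I := by
  constructor
  · intro hI m hm
    exact hI (Δ.truncate_single_of_notMem k h m hm 1)
  · intro hI f hf
    refine mem_ideal_of_support fun m hm => hI m fun hmτ => hm ?_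
    have := Δ.coeff_truncate k h f (Δ.starChar h m hmτ)
    rw [(show Δ.truncate k h f = 0 from hf)] at this
    exact this.symm

lemma restr_comp_truncate {τ σ σ' : Δ.Cone} (h : τ ≤ σ) (h' : σ ≤ σ') :
    (restr k (show (Δ.starCone h).1 ≤ (Δ.starCone (h.trans h')).1 from
      (starCone_le_iff h (h.trans h')).mpr h')).comp (Δ.truncate k (h.trans h')) =
    (Δ.truncate k h).comp (restr k (show σ.1 ≤ σ'.1 from h')) := by
  refine semigroupRing_hom_ext fun m a => ?_
  rw [RingHom.comp_apply, RingHom.comp_apply, restr_single]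
  by_cases hm : (m : M) ∈ perp τ.1
  · rw [truncate_single k Δ _ m hm, restr_single, truncate_single k Δ h _ hm]
    rfl
  · rw [truncate_single_of_notMem k Δ _ m hm, truncate_single_of_notMem k Δ h _ hm, map_zero]

/-- The closed immersion of affine charts given by the truncation of characters. -/
def truncateMap {τ σ : Δ.Cone} (h : τ ≤ σ) : chart k (Δ.starCone h).1 ⟶ chart k σ.1 :=
  Spec.map (CommRingCat.ofHom (Δ.truncate k h))

instance {τ σ : Δ.Cone} (h : τ ≤ σ) : IsClosedImmersion (Δ.truncateMap k h) :=
  IsClosedImmersion.spec_of_surjective _ (Δ.truncate_surjective k h)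

lemma chartMap_truncateMap {τ σ σ' : Δ.Cone} (h : τ ≤ σ) (h' : σ ≤ σ') :
    chartMap k (show (Δ.starCone h).1 ≤ (Δ.starCone (h.trans h')).1 from
      (starCone_le_iff h (h.trans h')).mpr h') ≫ Δ.truncateMap k (h.trans h') =
    Δ.truncateMap k h ≫ chartMap k (show σ.1 ≤ σ'.1 from h') := by
  rw [chartMap, chartMap, truncateMap, truncateMap, ← Spec.map_comp, ← Spec.map_comp,
    ← CommRingCat.ofHom_comp, ← CommRingCat.ofHom_comp, restr_comp_truncate k Δ h h']

variable {Δ} in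
/-- The cone of a fan that gives a cone of the star. -/
def overCone {τ : Δ.Cone} (ρ : (Δ.star τ).Cone) : Δ.Cone := (exists_eq_starCone ρ).choose

variable {Δ} in
lemma le_overCone {τ : Δ.Cone} (ρ : (Δ.star τ).Cone) : τ ≤ overCone ρ :=
  (exists_eq_starCone ρ).choose_spec.choose

variable {Δ} in
lemma starCone_overCone {τ : Δ.Cone} (ρ : (Δ.star τ).Cone) :
    Δ.starCone (le_overCone ρ) = ρ :=
  (exists_eq_starCone ρ).choose_spec.choose_spec.symm

/-- The restriction to the chart of `ρ` of the morphism from the star of `τ`. -/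
def overMap {τ : Δ.Cone} (ρ : (Δ.star τ).Cone) : chart k ρ.1 ⟶ Δ.toricVariety k :=
  chartMap k (show ρ.1 ≤ (Δ.starCone (le_overCone ρ)).1 from (starCone_overCone ρ).ge) ≫
    Δ.truncateMap k (le_overCone ρ) ≫ Δ.ι k (overCone ρ)

lemma chartMap_overMap {τ : Δ.Cone} {ρ ρ' : (Δ.star τ).Cone} (f : ρ ≤ ρ') :
    chartMap k (show ρ.1 ≤ ρ'.1 from f) ≫ Δ.overMap k ρ' = Δ.overMap k ρ := by
  have h : overCone ρ ≤ overCone ρ' := by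
    rw [← starCone_le_iff (le_overCone ρ) (le_overCone ρ'), starCone_overCone, starCone_overCone]
    exact f
  have e := chartMap_truncateMap k Δ (le_overCone ρ) h
  rw [overMap, overMap, ← chartMap_ι k Δ h, ← reassoc_of% e, ← Category.assoc,
    ← Category.assoc (chartMap k _) (chartMap k _), chartMap_comp, chartMap_comp]

/-- The orbit closure `Y_star(τ) ⟶ Y_Δ` of a cone `τ`. -/
def starι (τ : Δ.Cone) : (Δ.star τ).toricVariety k ⟶ Δ.toricVariety k :=
  colimit.desc ((Δ.star τ).functor k)
    { pt := Δ.toricVariety k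
      ι :=
        { app := fun ρ => Δ.overMap k ρ
          naturality := fun _ _ f =>
            (chartMap_overMap k Δ (leOfHom f)).trans (Category.comp_id _).symm } }

/-- The orbit closure on charts. -/
lemma ι_starι {τ σ : Δ.Cone} (h : τ ≤ σ) :
    (Δ.star τ).ι k (Δ.starCone h) ≫ Δ.starι k τ = Δ.truncateMap k h ≫ Δ.ι k σ := by
  have h1 : (Δ.star τ).ι k (Δ.starCone h) ≫ Δ.starι k τ = _ := colimit.ι_desc _ _
  rw [h1]
  change Δ.overMap k _ = _
  rw [overMap]
  have h2 : overCone (Δ.starCone h) ≤ σ := by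
    rw [← starCone_le_iff (le_overCone _) h, starCone_overCone]
  rw [← chartMap_ι k Δ h2, ← reassoc_of% chartMap_truncateMap k Δ (le_overCone _) h2,
    ← Category.assoc, chartMap_comp, chartMap, restr_refl]
  erw [Spec.map_id, Category.id_comp]

variable {k Δ}

lemma starι_ι_apply {τ σ : Δ.Cone} (h : τ ≤ σ) (y : chart k (Δ.starCone h).1) :
    Δ.starι k τ ((Δ.star τ).ι k (Δ.starCone h) y) = Δ.ι k σ (Δ.truncateMap k h y) := by
  rw [← Scheme.Hom.comp_apply, ι_starι]; rfl

lemma exists_star_ι_eq {τ : Δ.Cone} (x : (Δ.star τ).toricVariety k) :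
    ∃ (σ : Δ.Cone) (h : τ ≤ σ) (y : chart k (Δ.starCone h).1),
      (Δ.star τ).ι k (Δ.starCone h) y = x := by
  obtain ⟨ρ, y, rfl⟩ := (Δ.star τ).exists_ι_eq k x
  obtain ⟨σ, h, rfl⟩ := exists_eq_starCone ρ
  exact ⟨σ, h, y, rfl⟩

lemma pointIdeal_truncateMap {τ σ : Δ.Cone} (h : τ ≤ σ) (y : chart k (Δ.starCone h).1) :
    pointIdeal (Δ.truncateMap k h y) = (pointIdeal y).comap (Δ.truncate k h) := rfl

lemma le_orbitCone_starι {τ : Δ.Cone} (x : (Δ.star τ).toricVariety k) :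
    τ ≤ orbitCone (Δ.starι k τ x) := by
  obtain ⟨σ, h, y, rfl⟩ := exists_star_ι_eq x
  rw [starι_ι_apply]
  obtain ⟨u, hu, hux⟩ := exists_exposing (orbitCone_ι_le (Δ.truncateMap k h y))
  have h1 : AddMonoidAlgebra.single ⟨u, hu⟩ (1 : k) ∉ pointIdeal (Δ.truncateMap k h y) := by
    rw [single_notMem_pointIdeal]
    exact fun x hx => (hux x (orbitCone_ι_le _ hx)).mp hx
  have h2 : u ∈ perp τ.1 := by
    by_contra hcon
    refine h1 ?_
    rw [pointIdeal_truncateMap, Ideal.mem_comap, truncate_single_of_notMem k Δ h _ hcon]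
    exact zero_mem _
  exact fun x hx => (hux x (h hx)).mpr (h2 x hx)

/-- The preimage of a chart under the closure of an orbit is a chart. -/
lemma mem_range_star_ι_iff {τ σ : Δ.Cone} (h : τ ≤ σ) {x : (Δ.star τ).toricVariety k} :
    x ∈ Set.range ((Δ.star τ).ι k (Δ.starCone h)) ↔ orbitCone (Δ.starι k τ x) ≤ σ := by
  constructor
  · rintro ⟨y, rfl⟩
    rw [starι_ι_apply]
    exact orbitCone_ι_le _
  · intro hle
    have hτ := le_orbitCone_starι x
    obtain ⟨σ', h', y, rfl⟩ := exists_star_ι_eq x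
    have hle' : orbitCone (Δ.starι k τ ((Δ.star τ).ι k (Δ.starCone h') y)) ≤ σ' := by
      rw [starι_ι_apply]; exact orbitCone_ι_le _
    obtain ⟨ρ, hρ⟩ : ∃ ρ, ρ = orbitCone (Δ.starι k τ ((Δ.star τ).ι k (Δ.starCone h') y)) :=
      ⟨_, rfl⟩
    rw [← hρ] at hle hτ hle'
    obtain ⟨u, hu, hux⟩ := exists_exposing hle'
    have hρu : u ∈ perp ρ.1 := fun x hx => (hux x (hle' hx)).mp hx
    have huτ : u ∈ perp τ.1 := fun x hx => hρu x (hτ hx)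
    have h1 : AddMonoidAlgebra.single ⟨u, hu⟩ (1 : k) ∉ pointIdeal (Δ.truncateMap k h' y) := by
      rw [single_notMem_pointIdeal, ← starι_ι_apply, ← hρ]
      exact hρu
    rw [pointIdeal_truncateMap, Ideal.mem_comap, truncate_single k Δ h' _ huτ] at h1
    have h2 : y ∈ Set.range (chartMap k (show (Δ.starCone hτ).1 ≤ (Δ.starCone h').1 from
        (starCone_le_iff hτ h').mpr hle')) := by
      rw [range_chartMap k _ ((Δ.star τ).rational _ (Δ.starCone h').2) (Δ.starChar h' ⟨u, hu⟩ huτ)]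
      · exact h1
      · rintro _ ⟨x, hx, rfl⟩
        constructor
        · rintro ⟨x', hx', hxx'⟩
          have : res τ.1 x' ⟨u, huτ⟩ = res τ.1 x ⟨u, huτ⟩ := DFunLike.congr_fun hxx' _
          exact this.symm.trans (hρu x' hx')
        · intro hx0
          exact ⟨x, (hux x hx).mpr hx0, rfl⟩
    obtain ⟨z, hz⟩ := h2
    have hle2 : Δ.starCone hτ ≤ Δ.starCone h := (starCone_le_iff hτ h).mpr hle
    have hle3 : Δ.starCone hτ ≤ Δ.starCone h' := (starCone_le_iff hτ h').mpr hle'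
    refine ⟨chartMap k (show (Δ.starCone hτ).1 ≤ (Δ.starCone h).1 from hle2) z, ?_⟩
    rw [← hz, ι_chartMap_apply k (Δ.star τ) hle2, ι_chartMap_apply k (Δ.star τ) hle3]

lemma isPullback_starι {τ σ : Δ.Cone} (h : τ ≤ σ) :
    IsPullback (Δ.truncateMap k h) ((Δ.star τ).ι k (Δ.starCone h)) (Δ.ι k σ) (Δ.starι k τ) := by
  refine IsOpenImmersion.isPullback _ _ _ _ (ι_starι k Δ h) ?_
  ext x
  change Δ.starι k τ x ∈ Set.range (Δ.ι k σ) ↔ x ∈ Set.range ((Δ.star τ).ι k (Δ.starCone h))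
  rw [mem_range_star_ι_iff h, mem_range_ι_iff]

lemma range_starι (τ : Δ.Cone) : Set.range (Δ.starι k τ) = {x | τ ≤ orbitCone x} := by
  ext x
  constructor
  · rintro ⟨y, rfl⟩
    exact le_orbitCone_starι y
  · intro (hx : τ ≤ orbitCone x)
    obtain ⟨y, hy⟩ := exists_ι_orbitCone_eq x
    have h1 : RingHom.ker (Δ.truncate k hx) ≤ pointIdeal y := by
      rw [ker_truncate_le_iff]
      intro m hm
      by_contra hcon
      rw [single_notMem_pointIdeal, hy] at hcon
      exact hm fun v hv => hcon v (hx hv)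
    have h2 : y ∈ Set.range (Δ.truncateMap k hx) := by
      have := range_comap_of_surjective (semigroupRing k (Δ.starCone hx).1)
        (Δ.truncate k hx) (Δ.truncate_surjective k hx)
      change y ∈ Set.range (PrimeSpectrum.comap (Δ.truncate k hx))
      rw [this]
      exact h1
    obtain ⟨z, rfl⟩ := h2
    exact ⟨_, (starι_ι_apply hx z).trans hy⟩

instance (τ : Δ.Cone) : IsClosedImmersion (Δ.starι k τ) := by
  refine IsZariskiLocalAtTarget.of_openCover (Δ.openCover k) fun σ => ?_
  change IsClosedImmersion (pullback.snd (Δ.starι k τ) (Δ.ι k σ))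
  by_cases h : τ ≤ σ
  · have := (isPullback_starι (k := k) h).flip
    rw [← this.isoPullback_inv_snd]
    have h2 : IsClosedImmersion (Δ.truncateMap k h) :=
      IsClosedImmersion.spec_of_surjective _ (Δ.truncate_surjective k h)
    exact IsClosedImmersion.comp _ _
  · have : IsEmpty ↑(pullback (Δ.starι k τ) (Δ.ι k σ)) := by
      refine ⟨fun z => h ?_⟩
      have h1 := le_orbitCone_starι (pullback.fst (Δ.starι k τ) (Δ.ι k σ) z)
      refine h1.trans (mem_range_ι_iff.mp ⟨pullback.snd (Δ.starι k τ) (Δ.ι k σ) z, ?_⟩)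
      rw [← Scheme.Hom.comp_apply, ← pullback.condition]; rfl
    infer_instance

end Fan

/-! ### Intersections of orbit closures -/

section Schemes

/-- A morphism from a reduced scheme factors through a closed subscheme that contains its image. -/
lemma exists_lift_of_isReduced {X Y Z : Scheme.{u}} [IsReduced X] (i : Z ⟶ Y)
    [IsClosedImmersion i] (f : X ⟶ Y) (h : Set.range f ⊆ Set.range i) :
    ∃ l : X ⟶ Z, l ≫ i = f := by
  refine ⟨IsClosedImmersion.lift i f ?_, IsClosedImmersion.lift_fac _ _ _⟩
  refine Scheme.IdealSheafData.le_ofIdeals_iff.mpr fun U s hs => ?_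
  rw [Scheme.Hom.ker_apply] at hs
  have hs : i.app U.1 s = 0 := hs
  change f.app U.1 s = 0
  rw [← AlgebraicGeometry.basicOpen_eq_bot_iff, ← Scheme.preimage_basicOpen]
  have h1 : i ⁻¹ᵁ (Y.basicOpen s) = ⊥ := by
    rw [Scheme.preimage_basicOpen, hs, Scheme.basicOpen_zero]
  ext x
  refine ⟨fun hx => ?_, fun hx => hx.elim⟩
  obtain ⟨z, hz⟩ := h ⟨x, rfl⟩
  have hz' : z ∈ i ⁻¹ᵁ (Y.basicOpen s) := by
    change i z ∈ Y.basicOpen s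
    rw [hz]; exact hx
  rw [h1] at hz'
  exact hz'

/-- Factoring through a monomorphism is local on the target. -/
lemma exists_lift_of_openCover {Z Y T : Scheme.{u}} (i : Z ⟶ Y) [Mono i] (f : T ⟶ Y)
    (𝒰 : Y.OpenCover) (H : ∀ a, ∃ l : pullback f (𝒰.f a) ⟶ Z, l ≫ i = pullback.fst _ _ ≫ f) :
    ∃ l : T ⟶ Z, l ≫ i = f := by
  choose l hl using H
  have hcomp (a b : 𝒰.I₀) :
      pullback.fst (pullback.fst f (𝒰.f a)) (pullback.fst f (𝒰.f b)) ≫ l a =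
        pullback.snd (pullback.fst f (𝒰.f a)) (pullback.fst f (𝒰.f b)) ≫ l b := by
    rw [← cancel_mono i, Category.assoc, Category.assoc, hl, hl]
    exact pullback.condition_assoc _
  refine ⟨Scheme.Cover.glueMorphisms (𝒰.pullback₁ f) l hcomp, ?_⟩
  refine Scheme.Cover.hom_ext (𝒰.pullback₁ f) _ _ fun a => ?_
  exact (Category.assoc _ _ _).symm.trans ((congr_arg (· ≫ i)
    (Scheme.Cover.ι_glueMorphisms (𝒰.pullback₁ f) l hcomp a)).trans (hl a))

/-- The homomorphism on global sections corresponding to a morphism to an affine scheme. -/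
def toSections {T : Scheme.{u}} {A : CommRingCat.{u}} (f : T ⟶ Spec A) : A ⟶ Γ(T, ⊤) :=
  (Scheme.ΓSpecIso A).inv ≫ f.appTop

lemma toSpecΓ_map_toSections {T : Scheme.{u}} {A : CommRingCat.{u}} (f : T ⟶ Spec A) :
    T.toSpecΓ ≫ Spec.map (toSections f) = f := by
  rw [toSections, Spec.map_comp, ← Scheme.toSpecΓ_naturality_assoc]
  simp

lemma toSections_comp_map {T : Scheme.{u}} {A B : CommRingCat.{u}} (f : T ⟶ Spec B) (φ : A ⟶ B) :
    toSections (f ≫ Spec.map φ) = φ ≫ toSections f := by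
  rw [toSections, toSections, Scheme.Hom.comp_appTop, Scheme.ΓSpecIso_inv_naturality_assoc]

/-- A morphism to `Spec A` factors through the closed subscheme `Spec B` if it kills the kernel of
`A → B`. -/
lemma exists_lift_Spec {T : Scheme.{u}} {A B : Type u} [CommRing A] [CommRing B] (φ : A →+* B)
    (hφ : Function.Surjective φ) (f : T ⟶ Spec (CommRingCat.of A))
    (h : RingHom.ker φ ≤ RingHom.ker (toSections f).hom) :
    ∃ l : T ⟶ Spec (CommRingCat.of B), l ≫ Spec.map (CommRingCat.ofHom φ) = f := by
  refine ⟨T.toSpecΓ ≫ Spec.map (CommRingCat.ofHom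
    (RingHom.liftOfSurjective φ hφ ⟨(toSections f).hom, h⟩)), ?_⟩
  rw [Category.assoc, ← Spec.map_comp]
  have : CommRingCat.ofHom φ ≫ CommRingCat.ofHom
      (RingHom.liftOfSurjective φ hφ ⟨(toSections f).hom, h⟩) = toSections f := by
    ext x
    exact RingHom.liftOfRightInverse_comp_apply φ _ (Function.rightInverse_surjInv hφ)
      ⟨(toSections f).hom, h⟩ x
  rw [this, toSpecΓ_map_toSections]

end Schemes

section Reduced

variable (k : Type u) [Field k] {M : Type u} [AddCommGroup M] [UniqueSums M]

instance (H : AddSubgroup M) : UniqueSums H :=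
  UniqueSums.of_injective_addHom H.subtype.toAddHom H.subtype_injective inferInstance

instance (H : AddSubmonoid M) : UniqueSums H :=
  UniqueSums.of_injective_addHom H.subtype.toAddHom H.subtype_injective inferInstance

variable (Δ : Fan M)

instance : IsReduced (Δ.toricVariety k) := by
  have (σ : (Δ.openCover k).I₀) : IsReduced ((Δ.openCover k).X σ) :=
    inferInstanceAs (IsReduced (Spec (CommRingCat.of (semigroupRing k σ.1))))
  exact IsReduced.of_openCover _ (Δ.openCover k)

end Reduced

namespace Fan

variable (k : Type u) [Field k] {M : Type u} [AddCommGroup M] [UniqueSums M] (Δ : Fan M)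

lemma exists_starHom {τ τ' : Δ.Cone} (h : τ ≤ τ') :
    ∃ j : (Δ.star τ').toricVariety k ⟶ (Δ.star τ).toricVariety k,
      j ≫ Δ.starι k τ = Δ.starι k τ' := by
  refine exists_lift_of_isReduced _ _ ?_
  rw [range_starι, range_starι]
  exact fun x hx => h.trans hx

/-- The inclusion of orbit closures `Y_star(τ') ⟶ Y_star(τ)` for cones `τ ⊆ τ'`. -/
def starHom {τ τ' : Δ.Cone} (h : τ ≤ τ') :
    (Δ.star τ').toricVariety k ⟶ (Δ.star τ).toricVariety k :=
  (Δ.exists_starHom k h).choose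

@[simp] lemma starHom_starι {τ τ' : Δ.Cone} (h : τ ≤ τ') :
    Δ.starHom k h ≫ Δ.starι k τ = Δ.starι k τ' :=
  (Δ.exists_starHom k h).choose_spec

/-- If `R` is the smallest cone containing `P` and `Q`, the orbit closure of `R` is the
scheme-theoretic intersection of those of `P` and `Q`: on a chart `U_σ`, the ideals of the orbit
closures are generated by characters. -/
theorem isPullback_starHom {P Q R : Δ.Cone} (hP : P ≤ R) (hQ : Q ≤ R)
    (hR : ∀ σ, P ≤ σ → Q ≤ σ → R ≤ σ) :
    IsPullback (Δ.starHom k hP) (Δ.starHom k hQ) (Δ.starι k P) (Δ.starι k Q) := by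
  have key (T : Scheme.{u}) (a : T ⟶ (Δ.star P).toricVariety k)
      (b : T ⟶ (Δ.star Q).toricVariety k) (hab : a ≫ Δ.starι k P = b ≫ Δ.starι k Q) :
      ∃ l : T ⟶ (Δ.star R).toricVariety k, l ≫ Δ.starι k R = a ≫ Δ.starι k P := by
    suffices H : ∀ σ : Δ.Cone, ∃ l : pullback (a ≫ Δ.starι k P) (Δ.ι k σ) ⟶ _, l ≫ Δ.starι k R =
        pullback.fst (a ≫ Δ.starι k P) (Δ.ι k σ) ≫ a ≫ Δ.starι k P from
      exists_lift_of_openCover _ _ (Δ.openCover k) H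
    intro σ
    set c := pullback.fst (a ≫ Δ.starι k P) (Δ.ι k σ) with hc
    set d := pullback.snd (a ≫ Δ.starι k P) (Δ.ι k σ) with hd
    have hcd : c ≫ a ≫ Δ.starι k P = d ≫ Δ.ι k σ := pullback.condition
    have hpt (x : ↑(pullback (a ≫ Δ.starι k P) (Δ.ι k σ))) :
        Δ.starι k P (a (c x)) = Δ.ι k σ (d x) :=
      congr_arg (fun f : pullback (a ≫ Δ.starι k P) (Δ.ι k σ) ⟶ _ => f x) hcd
    have hpt' (x : ↑(pullback (a ≫ Δ.starι k P) (Δ.ι k σ))) :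
        Δ.starι k Q (b (c x)) = Δ.starι k P (a (c x)) :=
      congr_arg (fun f : T ⟶ _ => f (c x)) hab.symm
    by_cases hσ : P ≤ σ ∧ Q ≤ σ
    · have hRσ := hR σ hσ.1 hσ.2
      have h1 := (isPullback_starι (k := k) hσ.1).lift_fst d (c ≫ a) (by rw [Category.assoc, hcd])
      have h2 := (isPullback_starι (k := k) hσ.2).lift_fst d (c ≫ b)
        (by rw [Category.assoc, ← hab, hcd])
      have hker {τ : Δ.Cone} (h : τ ≤ σ) {l : pullback (a ≫ Δ.starι k P) (Δ.ι k σ) ⟶ _}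
          (hl : l ≫ Δ.truncateMap k h = d) :
          RingHom.ker (Δ.truncate k h) ≤ RingHom.ker (toSections d).hom := by
        have e : toSections d = CommRingCat.ofHom (Δ.truncate k h) ≫ toSections l := by
          rw [← hl]; exact toSections_comp_map _ _
        rw [e]
        intro x hx
        rw [RingHom.mem_ker] at hx ⊢
        change (toSections l).hom (Δ.truncate k h x) = 0
        rw [hx, map_zero]
      have h3 := (ker_truncate_le_iff k Δ hσ.1).mp (hker hσ.1 h1)
      have h4 := (ker_truncate_le_iff k Δ hσ.2).mp (hker hσ.2 h2)
      obtain ⟨l, hl⟩ := exists_lift_Spec (Δ.truncate k hRσ) (Δ.truncate_surjective k hRσ) d <| by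
        refine (ker_truncate_le_iff k Δ hRσ).mpr fun m hm => ?_
        -- if `m` is orthogonal to `P` and `Q`, the face of `σ` it cuts out contains both, hence `R`
        by_cases hmP : (m : M) ∈ perp P.1
        · refine h4 m fun hmQ => hm ?_
          have := hR (cut σ m m.2) ((mem_perp_iff_le_cut hσ.1 _ m.2).mp hmP)
            ((mem_perp_iff_le_cut hσ.2 _ m.2).mp hmQ)
          exact (mem_perp_iff_le_cut hRσ _ m.2).mpr this
        · exact h3 m hmP
      refine ⟨l ≫ (Δ.star R).ι k (Δ.starCone hRσ), ?_⟩
      rw [Category.assoc, ι_starι, hcd, ← hl, Category.assoc]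
      rfl
    · have : IsEmpty ↑(pullback (a ≫ Δ.starι k P) (Δ.ι k σ)) := by
        refine ⟨fun x => hσ ?_⟩
        have h1 : orbitCone (Δ.starι k P (a (c x))) ≤ σ := by
          rw [hpt]; exact orbitCone_ι_le _
        refine ⟨(le_orbitCone_starι _).trans h1, ?_⟩
        rw [← hpt'] at h1
        exact (le_orbitCone_starι _).trans h1
      exact ⟨isInitialOfIsEmpty.to _, isInitialOfIsEmpty.hom_ext _ _⟩
  refine ⟨⟨by rw [starHom_starι, starHom_starι]⟩, ⟨PullbackCone.IsLimit.mk _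
    (fun s => (key s.pt s.fst s.snd s.condition).choose) (fun s => ?_) (fun s => ?_)
    fun s m h1 _ => ?_⟩⟩
  · rw [← cancel_mono (Δ.starι k P), Category.assoc, starHom_starι]
    exact (key s.pt s.fst s.snd s.condition).choose_spec
  · rw [← cancel_mono (Δ.starι k Q), Category.assoc, starHom_starι, ← s.condition]
    exact (key s.pt s.fst s.snd s.condition).choose_spec
  · rw [← cancel_mono (Δ.starι k R), (key s.pt s.fst s.snd s.condition).choose_spec, ← h1,
      Category.assoc, starHom_starι]

end Fan

/-! ### Orbit closures of rays are prime divisors -/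

section Height

/-- A principal prime `(a)` with `⋂ (aⁿ) = 0` in a domain has height one. -/
lemma height_eq_one_of_principal {R : Type*} [CommRing R] [IsDomain R] (x : PrimeSpectrum R)
    {a : R} (hx : x.asIdeal = Ideal.span {a}) (ha : a ≠ 0)
    (h : ∀ f, (∀ n : ℕ, a ^ n ∣ f) → f = 0) : Order.height x = 1 := by
  refine le_antisymm ?_ ?_
  · refine (Order.height_le_coe_iff (n := 1)).mpr fun y hy => ?_
    have hay : a ∉ y.asIdeal := fun hmem => hy.not_ge <| by
      change x.asIdeal ≤ y.asIdeal
      rw [hx, Ideal.span_le, Set.singleton_subset_iff]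
      exact hmem
    -- a prime `y ⊂ (a)` does not contain `a`, hence it is divisible by all powers of `a`
    have hdiv (n : ℕ) : ∀ f ∈ y.asIdeal, ∃ f' ∈ y.asIdeal, f = a ^ n * f' := by
      induction n with
      | zero => exact fun f hf => ⟨f, hf, by simp⟩
      | succ n ih =>
        intro f hf
        obtain ⟨f', hf', rfl⟩ := ih f hf
        have h1 : f' ∈ x.asIdeal := hy.le hf'
        rw [hx, Ideal.mem_span_singleton] at h1
        obtain ⟨f'', rfl⟩ := h1
        exact ⟨f'', (y.2.mem_or_mem hf').resolve_left hay, by ring⟩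
    have hbot : y.asIdeal = ⊥ := by
      rw [eq_bot_iff]
      intro f hf
      refine h f fun n => ?_
      obtain ⟨f', -, rfl⟩ := hdiv n f hf
      exact dvd_mul_right _ _
    have : Order.height y = 0 := by
      rw [Order.height_eq_zero]
      intro z _
      change y.asIdeal ≤ z.asIdeal
      rw [hbot]; exact bot_le
    rw [this]; exact Nat.cast_one (R := ℕ∞) ▸ zero_lt_one
  · rw [Order.one_le_iff_pos, pos_iff_ne_zero, Order.height_ne_zero]
    intro hmin
    have h1 : x ≤ ⊥ := hmin bot_le
    have h2 : a ∈ (⊥ : PrimeSpectrum R).asIdeal := by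
      refine (show x.asIdeal ≤ _ from h1) ?_
      rw [hx]; exact Ideal.mem_span_singleton_self a
    exact ha h2

attribute [local instance] specializationOrder in
/-- The codimension of the closure of a point can be computed in an affine open neighbourhood. -/
lemma coheight_closure_eq {X : Scheme.{u}} {R : CommRingCat.{u}} (f : Spec R ⟶ X)
    [IsOpenImmersion f] (x : Spec R) (W : TopologicalSpace.IrreducibleCloseds X)
    (hW : (W : Set X) = closure {f x}) :
    Order.coheight W = Order.height (α := PrimeSpectrum R) x := by
  have h1 : W = (irreducibleSetEquivPoints (α := X)).symm (f x) :=
    TopologicalSpace.IrreducibleCloseds.ext hW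
  rw [h1, Order.coheight_orderIso]
  have h2 := coheight_eq_of_isOpenImmersion (x := x) f
  have h3 := idealHeight_eq_coheight R x
  exact h2.trans (h3.symm.trans (PrimeSpectrum.height_eq_orderHeight (R := R) x))

end Height

namespace Fan

variable {k : Type u} [Field k] {M : Type u} [AddCommGroup M] [UniqueSums M] {Δ : Fan M}

/-- The generic point of an affine toric variety. -/
def chartGeneric (k : Type u) [Field k] (σ : PointedCone ℝ (NR M)) : chart k σ :=
  (⊥ : PrimeSpectrum (semigroupRing k σ))

lemma chartMap_chartGeneric {τ σ : PointedCone ℝ (NR M)} (h : τ ≤ σ) :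
    chartMap k h (chartGeneric k τ) = chartGeneric k σ := by
  refine PrimeSpectrum.ext ?_
  change RingHom.ker (restr k h) = ⊥
  rw [← RingHom.injective_iff_ker_eq_bot]
  exact restr_injective k h

lemma chartGeneric_specializes {σ : PointedCone ℝ (NR M)} (y : chart k σ) :
    chartGeneric k σ ⤳ y :=
  (PrimeSpectrum.le_iff_specializes (R := semigroupRing k σ) ⊥ y).mp bot_le

/-- The generic point of the orbit of `τ`. -/
def orbitGeneric (k : Type u) [Field k] (τ : Δ.Cone) : Δ.toricVariety k :=
  Δ.ι k τ (Δ.truncateMap k (le_refl τ) (chartGeneric k _))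

lemma orbitGeneric_eq {τ σ : Δ.Cone} (h : τ ≤ σ) :
    Δ.ι k σ (Δ.truncateMap k h (chartGeneric k _)) = orbitGeneric k τ := by
  have hle : Δ.starCone (le_refl τ) ≤ Δ.starCone h := (starCone_le_iff _ _).mpr h
  rw [orbitGeneric, ← starι_ι_apply, ← starι_ι_apply, ← chartMap_chartGeneric
    (show (Δ.starCone (le_refl τ)).1 ≤ (Δ.starCone h).1 from hle),
    ι_chartMap_apply k (Δ.star τ) hle]

omit [UniqueSums M] in
lemma exists_truncateMap_of_mem_range {τ σ : Δ.Cone} (y : chart k σ.1)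
    (hy : Δ.ι k σ y ∈ Set.range (Δ.starι k τ)) :
    ∃ (h : τ ≤ σ) (z : chart k (Δ.starCone h).1), Δ.truncateMap k h z = y := by
  have hle : τ ≤ σ := by
    rw [range_starι] at hy
    exact le_trans (show τ ≤ orbitCone (Δ.ι k σ y) from hy) (orbitCone_ι_le y)
  obtain ⟨x, hx⟩ := hy
  have h1 : x ∈ Set.range ((Δ.star τ).ι k (Δ.starCone hle)) := by
    rw [mem_range_star_ι_iff, hx]; exact orbitCone_ι_le y
  obtain ⟨z, rfl⟩ := h1
  refine ⟨hle, z, Δ.ι_injective (k := k) σ ?_⟩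
  rw [← hx, starι_ι_apply]

/-- Orbit closures are irreducible. -/
lemma range_starι_eq_closure (τ : Δ.Cone) :
    Set.range (Δ.starι k τ) = closure {orbitGeneric k τ} := by
  refine Set.Subset.antisymm ?_ ?_
  · rintro _ ⟨x, rfl⟩
    obtain ⟨σ, h, y, rfl⟩ := exists_star_ι_eq x
    rw [starι_ι_apply, ← specializes_iff_mem_closure, ← orbitGeneric_eq h]
    exact ((chartGeneric_specializes y).map (Δ.truncateMap k h).continuous).map
      (Δ.ι k σ).continuous
  · refine closure_minimal ?_ (Δ.starι k τ).isClosedEmbedding.isClosed_range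
    rw [Set.singleton_subset_iff, orbitGeneric, ← starι_ι_apply]
    exact ⟨_, rfl⟩

/-- Orbit closures are torus-invariant. -/
theorem isTorusInvariant_range_starι (τ : Δ.Cone) :
    Δ.IsTorusInvariant k (Set.range (Δ.starι k τ)) := by
  intro σ f m hf
  rw [PrimeSpectrum.mem_vanishingIdeal] at hf ⊢
  intro y hy
  obtain ⟨h, z, rfl⟩ := exists_truncateMap_of_mem_range y hy
  by_cases hm : (m : M) ∈ perp τ.1
  · have h1 : Δ.truncate k h f = 0 := hf (Δ.truncateMap k h (chartGeneric k _))
      ⟨_, starι_ι_apply h _⟩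
    have h2 := Δ.coeff_truncate k h f (Δ.starChar h m hm)
    rw [h1] at h2
    have h3 : f.coeff m = 0 := h2.symm
    rw [h3, AddMonoidAlgebra.single_zero]
    exact zero_mem _
  · change Δ.truncate k h (AddMonoidAlgebra.single m _) ∈ pointIdeal z
    rw [truncate_single_of_notMem k Δ h m hm]
    exact zero_mem _

/-- The closure of the orbit of a ray is a prime divisor. -/
theorem isPrimeDivisor_range_starι (τ : Δ.Cone) (g : M →+ ℤ) (hg : toNR g ≠ 0)
    (hτ : τ.1 = PointedCone.hull ℝ {toNR g}) : IsPrimeDivisor (Set.range (Δ.starι k τ)) := by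
  have hclosed : IsClosed (Set.range (Δ.starι k τ)) :=
    (Δ.starι k τ).isClosedEmbedding.isClosed_range
  refine ⟨⟨closure {orbitGeneric k τ}, isIrreducible_singleton.closure, isClosed_closure⟩,
    (range_starι_eq_closure τ).symm, ?_⟩
  rw [coheight_closure_eq (Δ.ι k τ) (Δ.truncateMap k (le_refl τ) (chartGeneric k _)) _ rfl]
  have hdual (m : M) : m ∈ dualMonoid τ.1 ↔ 0 ≤ g m := by
    constructor
    · intro hm
      have := hm (toNR g) (by rw [hτ]; exact Submodule.mem_span_singleton_self _)
      simpa using this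
    · intro hm
      rw [hτ]
      refine mem_dualMonoid_hull ?_
      rintro _ rfl
      simpa using hm
  have hperp (m : M) : m ∈ perp τ.1 ↔ g m = 0 := by
    constructor
    · intro hm
      have := hm (toNR g) (by rw [hτ]; exact Submodule.mem_span_singleton_self _)
      simpa using this
    · intro hm v hv
      rw [hτ, mem_hull_singleton] at hv
      obtain ⟨c, -, rfl⟩ := hv
      change c * toNR g m = 0
      simp [hm]
  -- a character on which `g` takes its smallest positive value
  obtain ⟨m₀, hm₀, hmin⟩ : ∃ m₀, 0 < g m₀ ∧ ∀ m, 0 < g m → g m₀ ≤ g m := by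
    have hne : ∃ n : ℕ, ∃ m, g m = n ∧ 0 < n := by
      obtain ⟨m, hm⟩ := DFunLike.ne_iff.mp hg
      have hm : g m ≠ 0 := by simpa using hm
      rcases lt_or_gt_of_ne hm with h | h
      · exact ⟨(g m).natAbs, -m, by rw [map_neg]; omega, by omega⟩
      · exact ⟨(g m).natAbs, m, by omega, by omega⟩
    classical
    obtain ⟨m₀, h1, h2⟩ := Nat.find_spec hne
    refine ⟨m₀, by omega, fun m hm => ?_⟩
    have := Nat.find_min' hne ⟨m, (show g m = (g m).natAbs by omega), by omega⟩
    omega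
  let a : semigroupRing k τ.1 := AddMonoidAlgebra.single ⟨m₀, (hdual m₀).mpr hm₀.le⟩ 1
  refine height_eq_one_of_principal _ (a := a) ?_ ?_ ?_
  · change RingHom.ker (Δ.truncate k (le_refl τ)) = _
    refine le_antisymm ?_ ?_
    · rw [ker_truncate_le_iff]
      intro m hm
      rw [hperp] at hm
      have h1 := (hdual _).mp m.2
      have h2 := hmin m (by omega)
      rw [Ideal.mem_span_singleton]
      refine ⟨AddMonoidAlgebra.single ⟨m - m₀, (hdual _).mpr (by rw [map_sub]; omega)⟩ 1, ?_⟩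
      rw [AddMonoidAlgebra.single_mul_single, mul_one]
      congr 1
      ext; simp
    · rw [Ideal.span_le, Set.singleton_subset_iff]
      refine truncate_single_of_notMem k Δ _ _ ?_ 1
      rw [hperp]; exact hm₀.ne'
  · exact fun h => one_ne_zero (AddMonoidAlgebra.single_eq_zero.mp h)
  · intro f hf
    apply AddMonoidAlgebra.coeff_injective
    refine Finsupp.ext fun m => ?_
    by_contra hm
    -- the characters of the multiples of `aⁿ` have `g`-degree at least `n`
    have key (n : ℕ) : ∀ f' : semigroupRing k τ.1, ∀ m, (a ^ n * f').coeff m ≠ 0 → n ≤ g m := by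
      induction n with
      | zero => exact fun f' m _ => (hdual _).mp m.2
      | succ n ih =>
        intro f' m hm
        classical
        rw [pow_succ', mul_assoc] at hm
        have h1 := AddMonoidAlgebra.support_coeff_single_mul_subset (a ^ n * f') (1 : k) _
          (Finsupp.mem_support_iff.mpr hm)
        obtain ⟨m', hm', rfl⟩ := Finset.mem_image.mp h1
        have h2 := ih f' m' (Finsupp.mem_support_iff.mp hm')
        simp
        omega
    obtain ⟨f', rfl⟩ := hf ((g m).natAbs + 1)
    have := key _ f' m hm
    omega

/-- For `τ ⊆ τ'`, the orbit closure of `τ'` is, inside that of `τ`, the orbit closure of the image of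
`τ'` in the star of `τ`. -/
lemma range_starHom {τ τ' : Δ.Cone} (h : τ ≤ τ') :
    Set.range (Δ.starHom k h) = Set.range ((Δ.star τ).starι k (Δ.starCone h)) := by
  have hinj : Function.Injective (Δ.starι k τ) := (Δ.starι k τ).isClosedEmbedding.injective
  ext x
  have h1 : x ∈ Set.range (Δ.starHom k h) ↔ τ' ≤ orbitCone (Δ.starι k τ x) := by
    have : Δ.starι k τ x ∈ Set.range (Δ.starι k τ') ↔ τ' ≤ orbitCone (Δ.starι k τ x) := by
      rw [range_starι]; rfl
    rw [← this]
    constructor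
    · rintro ⟨y, rfl⟩
      exact ⟨y, by rw [← Scheme.Hom.comp_apply, starHom_starι]⟩
    · rintro ⟨y, hy⟩
      refine ⟨y, hinj ?_⟩
      rw [← hy, ← Scheme.Hom.comp_apply, starHom_starι]
  rw [h1, range_starι]
  have hx : τ ≤ orbitCone (Δ.starι k τ x) := le_orbitCone_starι x
  have h2 : orbitCone x = Δ.starCone hx := by
    obtain ⟨σ, hσ, hσ'⟩ := exists_eq_starCone (orbitCone x)
    rw [hσ']
    refine le_antisymm ?_ ?_
    · rw [← hσ', ← mem_range_ι_iff, mem_range_star_ι_iff]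
    · rw [starCone_le_iff, ← mem_range_star_ι_iff hσ, mem_range_ι_iff, hσ']
  change _ ↔ _ ≤ orbitCone x
  rw [h2, starCone_le_iff]

end Fan

/-! ### Gluing of morphisms along closed subschemes -/

section Gluing

/-- Morphisms from a reduced scheme that agree on a jointly surjective family are equal. -/
lemma hom_ext_of_jointly_surjective {Q T : Scheme.{u}} [IsReduced Q] {f f' : Q ⟶ T}
    (h : ∀ x : Q, ∃ (P : Scheme.{u}) (b : P ⟶ Q), x ∈ Set.range b ∧ b ≫ f = b ≫ f') : f = f' := by
  have hsurj : Function.Surjective (equalizer.ι f f') := by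
    intro x
    obtain ⟨P, b, ⟨y, rfl⟩, hb⟩ := h x
    refine ⟨equalizer.lift b hb y, ?_⟩
    rw [← Scheme.Hom.comp_apply, equalizer.lift_ι]
  have : IsClosedImmersion (equalizer.ι f f') :=
    IsClosedImmersion.of_isPreimmersion _ (by rw [hsurj.range_eq]; exact isClosed_univ)
  have : Surjective (equalizer.ι f f') := ⟨hsurj⟩
  have := isIso_of_isClosedImmersion_of_surjective (equalizer.ι f f')
  rw [← cancel_epi (equalizer.ι f f')]
  exact equalizer.condition f f'

/-- A section over a reduced scheme vanishes if its pullbacks along a jointly surjective family of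
morphisms vanish. -/
lemma section_eq_zero {X : Scheme.{u}} [IsReduced X] {I : Type*} {Z : I → Scheme.{u}}
    (ι : ∀ v, Z v ⟶ X) (hι : ∀ x, ∃ v y, ι v y = x) (U : X.Opens) (r : Γ(X, U))
    (h : ∀ v, (ι v).app U r = 0) : r = 0 := by
  rw [← AlgebraicGeometry.basicOpen_eq_bot_iff]
  ext x
  refine ⟨fun hx => ?_, fun hx => hx.elim⟩
  obtain ⟨v, y, rfl⟩ := hι x
  have h1 : y ∈ ι v ⁻¹ᵁ X.basicOpen r := hx
  rw [Scheme.preimage_basicOpen, h v, Scheme.basicOpen_zero] at h1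
  exact h1.elim

/-- For closed subschemes `K v` and closed subschemes `L a` of overlaps of `K (p a)` and `K (q a)`:
over the affine open `U`, functions on the `K v` which agree on the overlaps come from a function
on `U`. -/
def SectionsGlue {Y : Scheme.{u}} {I J : Type*} (K : I → Y.IdealSheafData)
    (L : J → Y.IdealSheafData) (p q : J → I) (U : Y.affineOpens) : Prop :=
  ∀ s : I → Γ(Y, U.1), (∀ a, s (p a) - s (q a) ∈ (L a).ideal U) →
    ∃ r, ∀ v, r - s v ∈ (K v).ideal U

/-- The gluing of functions passes from an affine open to its basic opens. -/
lemma SectionsGlue.basicOpen {Y : Scheme.{u}} {I J : Type*} [Finite I] [Finite J]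
    {K : I → Y.IdealSheafData} {L : J → Y.IdealSheafData} {p q : J → I} {U : Y.affineOpens}
    (h : SectionsGlue K L p q U) (f : Γ(Y, U.1)) : SectionsGlue K L p q (Y.affineBasicOpen f) := by
  intro (s : I → Γ(Y, Y.basicOpen f)) hs
  have hloc : IsLocalization.Away f Γ(Y, Y.basicOpen f) := U.2.isLocalization_basicOpen f
  have hmap (N : Y.IdealSheafData) :
      (N.ideal U).map (algebraMap Γ(Y, U.1) Γ(Y, Y.basicOpen f)) =
        N.ideal (Y.affineBasicOpen f) := N.map_ideal_basicOpen U f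
  obtain ⟨⟨_, n, rfl⟩, hb⟩ := IsLocalization.exist_integer_multiples_of_finite
    (Submonoid.powers f) (S := Γ(Y, Y.basicOpen f)) s
  choose x hx using hb
  have hx (v : I) : algebraMap Γ(Y, U.1) Γ(Y, Y.basicOpen f) (x v) =
      algebraMap Γ(Y, U.1) Γ(Y, Y.basicOpen f) (f ^ n) * s v := by
    rw [hx v, Algebra.smul_def]
  have hy (a : J) : ∃ N : ℕ, f ^ N * (x (p a) - x (q a)) ∈ (L a).ideal U := by
    have h1 : algebraMap Γ(Y, U.1) Γ(Y, Y.basicOpen f) (x (p a) - x (q a)) ∈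
        ((L a).ideal U).map (algebraMap Γ(Y, U.1) Γ(Y, Y.basicOpen f)) := by
      rw [hmap, map_sub, hx, hx, ← mul_sub]
      exact Ideal.mul_mem_left _ _ (hs a)
    rw [IsLocalization.algebraMap_mem_map_algebraMap_iff (Submonoid.powers f)] at h1
    obtain ⟨_, ⟨N, rfl⟩, hN⟩ := h1
    exact ⟨N, hN⟩
  choose N hN using hy
  cases nonempty_fintype J
  obtain ⟨N₀, hN₀⟩ : ∃ N₀, ∀ a, N a ≤ N₀ :=
    ⟨∑ a, N a, fun a => Finset.single_le_sum (fun _ _ => Nat.zero_le _) (Finset.mem_univ a)⟩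
  obtain ⟨r, hr⟩ := h (fun v => f ^ N₀ * x v) fun a => by
    rw [← mul_sub, ← Nat.sub_add_cancel (hN₀ a), pow_add, mul_assoc]
    exact Ideal.mul_mem_left _ _ (hN a)
  have hunit : IsUnit (algebraMap Γ(Y, U.1) Γ(Y, Y.basicOpen f) (f ^ (N₀ + n))) :=
    IsLocalization.map_units Γ(Y, Y.basicOpen f) (⟨_, N₀ + n, rfl⟩ : Submonoid.powers f)
  obtain ⟨w, hw⟩ := hunit
  refine ⟨w⁻¹.1 * algebraMap Γ(Y, U.1) Γ(Y, Y.basicOpen f) r, fun v => ?_⟩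
  have h2 : w⁻¹.1 * algebraMap Γ(Y, U.1) Γ(Y, Y.basicOpen f) r - s v =
      w⁻¹.1 * algebraMap Γ(Y, U.1) Γ(Y, Y.basicOpen f) (r - f ^ N₀ * x v) := by
    rw [map_sub, map_mul, hx, ← mul_assoc, ← map_mul, ← pow_add, ← hw, mul_sub, ← mul_assoc,
      Units.inv_mul, one_mul]
  have h3 : w⁻¹.1 * algebraMap Γ(Y, U.1) Γ(Y, Y.basicOpen f) r - s v ∈
      ((K v).ideal U).map (algebraMap Γ(Y, U.1) Γ(Y, Y.basicOpen f)) := by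
    rw [h2]
    exact Ideal.mul_mem_left _ _ (Ideal.mem_map_of_mem _ (hr v))
  rw [hmap] at h3
  exact h3

/-- A family of ring homomorphisms `a v` factors through a jointly injective family `b v` as soon as
it does so elementwise. -/
lemma exists_ringHom_factor {I : Type*} {A C : Type*} {B : I → Type*} [CommRing A] [CommRing C]
    [∀ v, CommRing (B v)] (a : ∀ v, A →+* B v) (b : ∀ v, C →+* B v)
    (hb : ∀ c, (∀ v, b v c = 0) → c = 0) (h : ∀ x, ∃ c, ∀ v, b v c = a v x) :
    ∃ ψ : A →+* C, ∀ v, (b v).comp ψ = a v := by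
  choose ψ hψ using h
  have hinj {c c' : C} (hc : ∀ v, b v c = b v c') : c = c' :=
    sub_eq_zero.mp (hb _ fun v => by rw [map_sub, hc, sub_self])
  refine ⟨{ toFun := ψ, map_one' := ?_, map_mul' := ?_, map_zero' := ?_, map_add' := ?_ }, ?_⟩
  · exact hinj fun v => by rw [hψ, map_one, map_one]
  · exact fun x y => hinj fun v => by rw [map_mul, hψ, hψ, hψ, map_mul]
  · exact hinj fun v => by rw [hψ, map_zero, map_zero]
  · exact fun x y => hinj fun v => by rw [map_add, hψ, hψ, hψ, map_add]
  · exact fun v => RingHom.ext (hψ · v)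

variable {X Y T : Scheme.{u}} [IsReduced X] (i : X ⟶ Y) [IsClosedImmersion i]
  {I J : Type u} [Finite I] {Z : I → Scheme.{u}} (ι : ∀ v, Z v ⟶ X)
  [∀ v, IsClosedImmersion (ι v)] (hι : ∀ x, ∃ v y, ι v y = x)
  (p q : J → I) {Q : J → Scheme.{u}} (e : ∀ a, Q a ⟶ Z (p a)) (e' : ∀ a, Q a ⟶ Z (q a))
  (he : ∀ a, e a ≫ ι (p a) = e' a ≫ ι (q a)) [∀ a, QuasiCompact (e a ≫ ι (p a) ≫ i)]
  (g : ∀ v, Z v ⟶ T) (hg : ∀ a, e a ≫ g (p a) = e' a ≫ g (q a))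

/-- Pullback of an identity between the sections `κ^* s` and `g^* c`. -/
lemma app_eq_appLE_of_comp {P Z Y T : Scheme.{u}} (e : P ⟶ Z) (κ : Z ⟶ Y) (g : Z ⟶ T)
    {U : Y.Opens} {W : T.Opens} (hle : κ ⁻¹ᵁ U ≤ g ⁻¹ᵁ W) {s : Γ(Y, U)} {c : Γ(T, W)}
    (hs : κ.app U s = g.appLE W (κ ⁻¹ᵁ U) hle c) {f : P ⟶ Y} (hf : f = e ≫ κ) {g' : P ⟶ T}
    (hg' : g' = e ≫ g) (hle' : f ⁻¹ᵁ U ≤ g' ⁻¹ᵁ W) :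
    f.app U s = g'.appLE W (f ⁻¹ᵁ U) hle' c := by
  subst hf hg'
  have h1 : (e ≫ g).appLE W ((e ≫ κ) ⁻¹ᵁ U) hle' = g.appLE W (κ ⁻¹ᵁ U) hle ≫ e.app (κ ⁻¹ᵁ U) := by
    rw [Scheme.Hom.app_eq_appLE, Scheme.Hom.appLE_comp_appLE]
    rfl
  rw [h1, Scheme.Hom.comp_app]
  exact congr_arg (e.app (κ ⁻¹ᵁ U)) hs

omit [Finite I] in
include hι he hg in
/-- The homomorphism on sections defining the glued morphism over an affine open. -/
lemma exists_sections_hom (U : Y.affineOpens)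
    (hU : SectionsGlue (fun v => (ι v ≫ i).ker) (fun a => (e a ≫ ι (p a) ≫ i).ker) p q U)
    (W : T.Opens) (hW : ∀ v, ι v ⁻¹ᵁ i ⁻¹ᵁ U.1 ≤ g v ⁻¹ᵁ W) :
    ∃ ψ : Γ(T, W) ⟶ Γ(X, i ⁻¹ᵁ U.1), ∀ v,
      ψ ≫ (ι v).app (i ⁻¹ᵁ U.1) = (g v).appLE W (ι v ⁻¹ᵁ i ⁻¹ᵁ U.1) (hW v) := by
  have hlift (c : Γ(T, W)) : ∃ r : Γ(X, i ⁻¹ᵁ U.1), ∀ v, (ι v).app (i ⁻¹ᵁ U.1) r =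
      (g v).appLE W (ι v ⁻¹ᵁ i ⁻¹ᵁ U.1) (hW v) c := by
    have hs (v : I) : ∃ s : Γ(Y, U.1), (ι v ≫ i).app U.1 s =
        (g v).appLE W (ι v ⁻¹ᵁ i ⁻¹ᵁ U.1) (hW v) c := Scheme.Hom.app_surjective (ι v ≫ i) U.1 U.2 _
    choose s hs using hs
    obtain ⟨r, hr⟩ := hU s fun a => by
      rw [Scheme.Hom.ker_apply, RingHom.mem_ker, map_sub, sub_eq_zero]
      have hle : (e a ≫ ι (p a) ≫ i) ⁻¹ᵁ U.1 ≤ (e a ≫ g (p a)) ⁻¹ᵁ W := fun z hz => hW (p a) hz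
      have h1 := app_eq_appLE_of_comp (e a) (ι (p a) ≫ i) (g (p a)) (hW (p a)) (hs (p a)) rfl rfl hle
      have h2 := app_eq_appLE_of_comp (e' a) (ι (q a) ≫ i) (g (q a)) (hW (q a)) (hs (q a))
        (by rw [← Category.assoc, he a, Category.assoc]) (hg a) hle
      exact h1.trans h2.symm
    refine ⟨i.app U.1 r, fun v => ?_⟩
    have := hr v
    rw [Scheme.Hom.ker_apply, RingHom.mem_ker, map_sub, sub_eq_zero] at this
    rw [← hs]
    exact this
  obtain ⟨ψ, hψ⟩ := exists_ringHom_factor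
    (fun v => ((g v).appLE W (ι v ⁻¹ᵁ i ⁻¹ᵁ U.1) (hW v)).hom)
    (fun v => ((ι v).app (i ⁻¹ᵁ U.1)).hom)
    (fun c hc => section_eq_zero ι hι _ c hc) (fun c => hlift c)
  exact ⟨CommRingCat.ofHom ψ, fun v => CommRingCat.hom_ext (hψ v)⟩

include hι he hg in
/-- Gluing of morphisms along closed subschemes: a reduced scheme `X` covered by finitely many
closed subschemes `Z v` is their colimit over the overlaps `Q a`, if functions glue on affine opens
of an ambient scheme `Y` forming an open cover. -/
theorem existsUnique_glue [Finite J]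
    (hcov : ∀ x : X, ∃ U : Y.affineOpens, i x ∈ U.1 ∧
      SectionsGlue (fun v => (ι v ≫ i).ker) (fun a => (e a ≫ ι (p a) ≫ i).ker) p q U)
    (hpt : ∀ v w y y', ι v y = ι w y' → g v y = g w y') :
    ∃! φ : X ⟶ T, ∀ v, ι v ≫ φ = g v := by
  have hlocal (x : X) : ∃ (R : CommRingCat.{u}) (c : Spec R ⟶ X) (φ : Spec R ⟶ T),
      IsOpenImmersion c ∧ x ∈ Set.range c ∧
      ∀ (v : I) (P : Scheme.{u}) (α : P ⟶ Z v) (β : P ⟶ Spec R), α ≫ ι v = β ≫ c →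
        β ≫ φ = α ≫ g v := by
    obtain ⟨U, hxU, hU⟩ := hcov x
    obtain ⟨v₀, y₀, hy₀⟩ := hι x
    obtain ⟨W, hW, hyW, -⟩ := exists_isAffineOpen_mem_and_subset
      (x := g v₀ y₀) (U := ⊤) trivial
    -- a neighbourhood of `x` whose preimages in the `Z v` map to `W`
    obtain ⟨O, hxO, hO⟩ : ∃ O : Y.Opens, i x ∈ O ∧ ∀ v, ι v ⁻¹ᵁ i ⁻¹ᵁ O ≤ g v ⁻¹ᵁ W := by
      have hcl (v : I) : IsClosed ((ι v ≫ i) '' ((g v ⁻¹ᵁ W : (Z v).Opens) : Set (Z v))ᶜ) :=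
        (ι v ≫ i).isClosedEmbedding.isClosedMap _ (g v ⁻¹ᵁ W).2.isClosed_compl
      refine ⟨⟨_, (isClosed_iUnion_of_finite hcl).isOpen_compl⟩, ?_, ?_⟩
      · intro hmem
        obtain ⟨v, y, hy, hyx⟩ := Set.mem_iUnion.mp hmem
        have h1 : ι v y = x := i.isClosedEmbedding.injective hyx
        refine hy ?_
        change g v y ∈ W
        rw [hpt v v₀ y y₀ (h1.trans hy₀.symm)]
        exact hyW
      · intro v y hy
        by_contra hcon
        exact hy (Set.mem_iUnion.mpr ⟨v, y, hcon, rfl⟩)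
    obtain ⟨f, hfO, hxf⟩ := U.2.exists_basicOpen_le ⟨i x, hxO⟩ hxU
    have hf := hU.basicOpen f
    have hle (v : I) : ι v ⁻¹ᵁ i ⁻¹ᵁ (Y.affineBasicOpen f).1 ≤ g v ⁻¹ᵁ W :=
      fun y hy => hO v (hfO hy)
    obtain ⟨ψ, hψ⟩ := exists_sections_hom i ι hι p q e e' he g hg (Y.affineBasicOpen f) hf W hle
    have hD : IsAffineOpen (i ⁻¹ᵁ (Y.affineBasicOpen f).1) := (Y.affineBasicOpen f).2.preimage i
    refine ⟨_, hD.fromSpec, Spec.map ψ ≫ hW.fromSpec, inferInstance, ?_, ?_⟩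
    · rw [hD.range_fromSpec]; exact hxf
    · intro v P α β hαβ
      have hDv : IsAffineOpen (ι v ⁻¹ᵁ i ⁻¹ᵁ (Y.affineBasicOpen f).1) := hD.preimage (ι v)
      have hα : Set.range α ⊆ Set.range hDv.fromSpec := by
        rw [hDv.range_fromSpec]
        rintro _ ⟨z, rfl⟩
        have h1 : (α ≫ ι v) z ∈ Set.range hD.fromSpec := by
          rw [hαβ]; exact ⟨β z, rfl⟩
        rw [hD.range_fromSpec] at h1
        exact h1
      obtain ⟨γ, hγ⟩ : ∃ γ, γ ≫ hDv.fromSpec = α :=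
        ⟨IsOpenImmersion.lift hDv.fromSpec α hα, IsOpenImmersion.lift_fac _ _ _⟩
      have h2 : Spec.map ((ι v).app (i ⁻¹ᵁ (Y.affineBasicOpen f).1)) ≫ hD.fromSpec =
          hDv.fromSpec ≫ ι v := by
        rw [Scheme.Hom.app_eq_appLE]
        exact hD.SpecMap_appLE_fromSpec (ι v) hDv le_rfl
      have h3 : γ ≫ Spec.map ((ι v).app (i ⁻¹ᵁ (Y.affineBasicOpen f).1)) = β := by
        rw [← cancel_mono hD.fromSpec, Category.assoc, h2, reassoc_of% hγ, hαβ]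
      rw [← h3, ← hγ, Category.assoc, Category.assoc, ← hW.SpecMap_appLE_fromSpec (g v) hDv (hle v),
        ← Category.assoc (Spec.map _) (Spec.map ψ), ← Spec.map_comp, hψ]
  choose R c φ hc hxc hφ using hlocal
  let 𝒰 : X.OpenCover := Scheme.Cover.mkOfCovers (P := @IsOpenImmersion) X (fun x => Spec (R x)) c
    (fun x => ⟨x, hxc x⟩) hc
  have hcomp (x x' : X) : pullback.fst (c x) (c x') ≫ φ x = pullback.snd (c x) (c x') ≫ φ x' := by
    have := hc x
    have := hc x'
    have : IsReduced (pullback (c x) (c x')) :=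
      isReduced_of_isOpenImmersion (pullback.fst (c x) (c x') ≫ c x)
    refine hom_ext_of_jointly_surjective fun z => ?_
    obtain ⟨v, y, hy⟩ := hι ((pullback.fst (c x) (c x') ≫ c x) z)
    refine ⟨pullback (ι v) (pullback.fst (c x) (c x') ≫ c x), pullback.snd _ _, ?_, ?_⟩
    · obtain ⟨w, -, hw⟩ := Scheme.Pullback.exists_preimage_pullback y z hy
      exact ⟨w, hw⟩
    · have hab : pullback.fst (ι v) (pullback.fst (c x) (c x') ≫ c x) ≫ ι v =
          pullback.snd (ι v) (pullback.fst (c x) (c x') ≫ c x) ≫ pullback.fst (c x) (c x') ≫ c x :=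
        pullback.condition
      have h1 := hφ x v _ _ (pullback.snd _ _ ≫ pullback.fst (c x) (c x'))
        (hab.trans (Category.assoc _ _ _).symm)
      have h2 := hφ x' v _ _ (pullback.snd _ _ ≫ pullback.snd (c x) (c x'))
        (hab.trans (by rw [Category.assoc, pullback.condition (f := c x)]))
      rw [Category.assoc] at h1 h2
      exact h1.trans h2.symm
  have hglue (x : X) : c x ≫ Scheme.Cover.glueMorphisms 𝒰 φ hcomp = φ x :=
    Scheme.Cover.ι_glueMorphisms 𝒰 φ hcomp x
  have hfac (v : I) : ι v ≫ Scheme.Cover.glueMorphisms 𝒰 φ hcomp = g v := by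
    refine Scheme.Cover.hom_ext (𝒰.pullback₁ (ι v)) _ _ fun (x : X) => ?_
    change pullback.fst (ι v) (c x) ≫ ι v ≫ _ = pullback.fst (ι v) (c x) ≫ g v
    rw [pullback.condition_assoc, hglue]
    exact hφ x v _ _ _ pullback.condition
  refine ⟨Scheme.Cover.glueMorphisms 𝒰 φ hcomp, hfac, fun φ' hφ' => ?_⟩
  refine hom_ext_of_jointly_surjective fun x => ?_
  obtain ⟨v, y, rfl⟩ := hι x
  exact ⟨Z v, ι v, ⟨y, rfl⟩, (hφ' v).trans (hfac v).symm⟩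

end Gluing

/-! ### Gluing of orbit closures -/

namespace Fan

variable (k : Type u) [Field k] {M : Type u} [AddCommGroup M] (Δ : Fan M)

/-- The chart of `σ`, as an affine open of the toric variety. -/
def chartOpen (σ : Δ.Cone) : (Δ.toricVariety k).affineOpens :=
  ⟨Δ.ι k σ ''ᵁ ⊤, (isAffineOpen_top _).image_of_isOpenImmersion _⟩

lemma ι_mem_chartOpen (σ : Δ.Cone) (y : chart k σ.1) : Δ.ι k σ y ∈ (Δ.chartOpen k σ).1 :=
  ⟨y, trivial, rfl⟩

/-- The functions on the chart of `σ` are the elements of `k[S_σ]`. -/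
def chartSections (σ : Δ.Cone) :
    Γ(Δ.toricVariety k, (Δ.chartOpen k σ).1) ≅ CommRingCat.of (semigroupRing k σ.1) :=
  (Δ.ι k σ).appIso ⊤ ≪≫ Scheme.ΓSpecIso _

/-- The equations of the closure of the orbit of `τ` in the chart of `σ`. -/
lemma mem_ker_starι_ideal {τ σ : Δ.Cone} (h : τ ≤ σ)
    (s : Γ(Δ.toricVariety k, (Δ.chartOpen k σ).1)) :
    s ∈ (Δ.starι k τ).ker.ideal (Δ.chartOpen k σ) ↔
      Δ.truncate k h ((Δ.chartSections k σ).hom s) = 0 := by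
  obtain ⟨s, rfl⟩ : ∃ s', ((Δ.ι k σ).appIso ⊤).inv s' = s :=
    ⟨((Δ.ι k σ).appIso ⊤).hom s, CommRingCat.inv_hom_apply _ _⟩
  have h1 := Scheme.ker_ideal_of_isPullback_of_isOpenImmersion _ _ _ _
    (isPullback_starι (k := k) h) ⟨⊤, isAffineOpen_top _⟩
  have h2 : ((Δ.ι k σ).appIso ⊤).inv s ∈ (Δ.starι k τ).ker.ideal (Δ.chartOpen k σ) ↔
      s ∈ (Δ.truncateMap k h).ker.ideal ⟨⊤, isAffineOpen_top _⟩ := by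
    rw [h1]; rfl
  refine h2.trans ?_
  rw [Scheme.Hom.ker_apply, RingHom.mem_ker]
  have h3 : (Δ.chartSections k σ).hom (((Δ.ι k σ).appIso ⊤).inv s) =
      (Scheme.ΓSpecIso (CommRingCat.of (semigroupRing k σ.1))).hom s :=
    congr_arg _ (CommRingCat.hom_inv_apply ((Δ.ι k σ).appIso ⊤) s)
  have h4 : (Scheme.ΓSpecIso (CommRingCat.of (semigroupRing k (Δ.starCone h).1))).hom
      ((Δ.truncateMap k h).appTop s) = Δ.truncate k h
        ((Scheme.ΓSpecIso (CommRingCat.of (semigroupRing k σ.1))).hom s) :=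
    congr_arg (fun φ => φ.hom s)
      (Scheme.ΓSpecIso_naturality (CommRingCat.ofHom (Δ.truncate k h)))
  refine Iff.trans ?_ (Eq.congr_left ((congr_arg _ h3).trans h4.symm)).symm
  exact (map_eq_zero_iff _ (ConcreteCategory.bijective_of_isIso
    (Scheme.ΓSpecIso (CommRingCat.of (semigroupRing k (Δ.starCone h).1))).hom).1).symm

lemma ker_starι_ideal_eq_top {τ σ : Δ.Cone} (h : ¬ τ ≤ σ) :
    (Δ.starι k τ).ker.ideal (Δ.chartOpen k σ) = ⊤ := by
  rw [Scheme.Hom.ker_apply, Ideal.eq_top_iff_one, RingHom.mem_ker]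
  have h1 : Δ.starι k τ ⁻¹ᵁ (Δ.chartOpen k σ).1 = ⊥ := by
    ext x
    refine ⟨fun hx => h ?_, fun hx => hx.elim⟩
    obtain ⟨y, -, hy⟩ := hx
    exact (le_orbitCone_starι x).trans (mem_range_ι_iff.mp ⟨y, hy⟩)
  have : Subsingleton Γ((Δ.star τ).toricVariety k, Δ.starι k τ ⁻¹ᵁ (Δ.chartOpen k σ).1) := by
    rw [h1]; infer_instance
  exact Subsingleton.elim _ _

variable {Δ}

/-- Triples of two members of a family of cones and a cone of the fan containing both. -/
abbrev Overlap {I : Type u} (c : I → Δ.Cone) : Type u :=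
  {a : I × I × Δ.Cone // c a.1 ≤ a.2.2 ∧ c a.2.1 ≤ a.2.2}

/-- Functions glue along orbit closures: the coefficient of a character `χ^m` of `U_σ` in a
compatible family of functions is the same on all the orbit closures on which `χ^m` does not
vanish, since these have a common intersection with the same property. -/
lemma sectionsGlue_chartOpen {I : Type u} [Finite I] (c : I → Δ.Cone) (σ : Δ.Cone) :
    SectionsGlue (fun v => (Δ.starι k (c v)).ker)
      (fun a : Overlap c => (Δ.starι k a.1.2.2).ker) (fun a => a.1.1) (fun a => a.1.2.1)
      (Δ.chartOpen k σ) := by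
  classical
  intro s hs
  cases nonempty_fintype I
  let f (v : I) : semigroupRing k σ.1 := (Δ.chartSections k σ).hom (s v)
  have hcompat (v w : I) (hv : c v ≤ σ) (hw : c w ≤ σ) (m : dualMonoid σ.1)
      (hmv : (m : M) ∈ perp (c v).1) (hmw : (m : M) ∈ perp (c w).1) :
      (f v).coeff m = (f w).coeff m := by
    have hle : cut σ m m.2 ≤ σ := cut_le σ m m.2
    have h1 := hs ⟨(v, w, cut σ m m.2), (mem_perp_iff_le_cut hv _ m.2).mp hmv,
      (mem_perp_iff_le_cut hw _ m.2).mp hmw⟩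
    have hm : (m : M) ∈ perp (cut σ m m.2).1 := fun x hx => hx.2
    rw [mem_ker_starι_ideal k Δ hle] at h1
    have h2 := Δ.coeff_truncate k hle ((Δ.chartSections k σ).hom (s v - s w)) (Δ.starChar hle m hm)
    rw [h1] at h2
    have h3 : (f v - f w).coeff m = 0 := by
      rw [← map_sub] at *
      exact h2.symm
    rw [AddMonoidAlgebra.coeff_sub, Finsupp.sub_apply] at h3
    exact sub_eq_zero.mp h3
  let r₀ (m : dualMonoid σ.1) : k :=
    if h : ∃ v, c v ≤ σ ∧ (m : M) ∈ perp (c v).1 then (f h.choose).coeff m else 0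
  have hr₀ (v : I) (hv : c v ≤ σ) (m : dualMonoid σ.1) (hm : (m : M) ∈ perp (c v).1) :
      r₀ m = (f v).coeff m := by
    have h : ∃ v, c v ≤ σ ∧ (m : M) ∈ perp (c v).1 := ⟨v, hv, hm⟩
    change dite _ _ _ = _
    rw [dif_pos h]
    exact hcompat _ _ h.choose_spec.1 hv m h.choose_spec.2 hm
  let r : semigroupRing k σ.1 := AddMonoidAlgebra.ofCoeff <|
    Finsupp.onFinset (Finset.univ.biUnion fun v => (f v).coeff.support) r₀ fun m hm => by
      by_cases h : ∃ v, c v ≤ σ ∧ (m : M) ∈ perp (c v).1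
      · change dite _ _ _ ≠ 0 at hm
        rw [dif_pos h] at hm
        exact Finset.mem_biUnion.mpr ⟨_, Finset.mem_univ _, Finsupp.mem_support_iff.mpr hm⟩
      · exact (hm (dif_neg h)).elim
  refine ⟨(Δ.chartSections k σ).inv r, fun v => ?_⟩
  by_cases hv : c v ≤ σ
  · rw [mem_ker_starι_ideal k Δ hv, map_sub, CommRingCat.hom_inv_apply]
    apply AddMonoidAlgebra.coeff_injective
    ext m
    rw [coeff_truncate]
    change (r - f v).coeff _ = 0
    rw [AddMonoidAlgebra.coeff_sub, Finsupp.sub_apply, sub_eq_zero]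
    exact hr₀ v hv _ (m : perp (c v).1).2
  · rw [ker_starι_ideal_eq_top k Δ hv]
    trivial

section

variable [UniqueSums M]

lemma starHom_comp {τ₁ τ₂ τ₃ : Δ.Cone} (h : τ₁ ≤ τ₂) (h' : τ₂ ≤ τ₃) :
    Δ.starHom k h' ≫ Δ.starHom k h = Δ.starHom k (h.trans h') := by
  rw [← cancel_mono (Δ.starι k τ₁), Category.assoc, starHom_starι, starHom_starι, starHom_starι]

/-- A reduced union of orbit closures is glued from them along their intersections. -/
theorem existsUnique_glue_star {I : Type u} [Finite I] (c : I → Δ.Cone) {X T : Scheme.{u}}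
    [IsReduced X] (i : X ⟶ Δ.toricVariety k) [IsClosedImmersion i]
    (ι : ∀ v, (Δ.star (c v)).toricVariety k ⟶ X) (hι : ∀ v, ι v ≫ i = Δ.starι k (c v))
    (hsurj : ∀ x, ∃ v y, ι v y = x) (g : ∀ v, (Δ.star (c v)).toricVariety k ⟶ T)
    (hg : ∀ (v w : I) (R : Δ.Cone) (hv : c v ≤ R) (hw : c w ≤ R),
      Δ.starHom k hv ≫ g v = Δ.starHom k hw ≫ g w) :
    ∃! φ : X ⟶ T, ∀ v, ι v ≫ φ = g v := by
  have : Finite Δ.Cone := Δ.finite.to_subtype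
  have hcl (v : I) : IsClosedImmersion (ι v) := by
    have : IsClosedImmersion (ι v ≫ i) := by rw [hι]; infer_instance
    exact IsClosedImmersion.of_comp_isClosedImmersion (ι v) i
  have he (a : Overlap c) : Δ.starHom k a.2.1 ≫ ι a.1.1 ≫ i = Δ.starι k a.1.2.2 := by
    rw [hι, starHom_starι]
  have he' (a : Overlap c) : Δ.starHom k a.2.2 ≫ ι a.1.2.1 ≫ i = Δ.starι k a.1.2.2 := by
    rw [hι, starHom_starι]
  have hqc (a : Overlap c) : QuasiCompact (Δ.starHom k a.2.1 ≫ ι a.1.1 ≫ i) := by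
    rw [he]; infer_instance
  refine existsUnique_glue i ι hsurj (fun a : Overlap c => a.1.1) (fun a => a.1.2.1)
    (fun a => Δ.starHom k a.2.1) (fun a => Δ.starHom k a.2.2) (fun a => ?_) g
    (fun a => hg _ _ _ a.2.1 a.2.2) (fun x => ?_) fun v w y y' hyy' => ?_
  · rw [← cancel_mono i, Category.assoc, Category.assoc, he, he']
  · obtain ⟨σ, y, hy⟩ := Δ.exists_ι_eq k (i x)
    refine ⟨Δ.chartOpen k σ, hy ▸ Δ.ι_mem_chartOpen k σ y, ?_⟩
    have h1 : (fun v => (ι v ≫ i).ker) = fun v => (Δ.starι k (c v)).ker := by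
      funext v; rw [hι]
    have h2 : (fun a : Overlap c => (Δ.starHom k a.2.1 ≫ ι a.1.1 ≫ i).ker) =
        fun a => (Δ.starι k a.1.2.2).ker := by
      funext a; rw [he]
    rw [h1, h2]
    exact sectionsGlue_chartOpen k c σ
  · have hy : i (ι v y) = Δ.starι k (c v) y := by rw [← hι]; rfl
    have hy' : i (ι w y') = Δ.starι k (c w) y' := by rw [← hι]; rfl
    have hv : c v ≤ orbitCone (i (ι v y)) := by rw [hy]; exact le_orbitCone_starι y
    have hw : c w ≤ orbitCone (i (ι v y)) := by rw [hyy', hy']; exact le_orbitCone_starι y'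
    obtain ⟨z, hz⟩ : i (ι v y) ∈ Set.range (Δ.starι k (orbitCone (i (ι v y)))) := by
      rw [range_starι]; exact le_refl (orbitCone (i (ι v y)))
    have h1 : Δ.starHom k hv z = y := by
      refine (Δ.starι k (c v)).isClosedEmbedding.injective ?_
      rw [← Scheme.Hom.comp_apply, starHom_starι, hz, hy]
    have h2 : Δ.starHom k hw z = y' := by
      refine (Δ.starι k (c w)).isClosedEmbedding.injective ?_
      rw [← Scheme.Hom.comp_apply, starHom_starι, hz, hyy', hy']
    calc g v y = g v (Δ.starHom k hv z) := by rw [h1]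
      _ = g w (Δ.starHom k hw z) := congr_arg (fun f : _ ⟶ T => f z) (hg v w _ hv hw)
      _ = g w y' := by rw [h2]

end

end Fan

/-! ### The special fiber and its strata -/

instance isReduced_nilradical_subscheme (X : Scheme.{u}) : IsReduced X.nilradical.subscheme := by
  have (U : X.nilradical.subschemeCover.openCover.I₀) :
      IsReduced (X.nilradical.subschemeCover.openCover.X U) := by
    have hrad : (X.nilradical.ideal U).IsRadical := Ideal.radical_isRadical _
    have : _root_.IsReduced (Γ(X, U.1) ⧸ X.nilradical.ideal U) :=
      (Ideal.isRadical_iff_quotient_reduced _).mp hrad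
    exact inferInstanceAs (IsReduced (Spec (.of (Γ(X, U.1) ⧸ X.nilradical.ideal U))))
  exact IsReduced.of_openCover _ X.nilradical.subschemeCover.openCover

section SpecialFiber

variable (k : Type u) [Field k] {M : Type u} [AddCommGroup M] {Δ : Fan (M × ℤ)}
  (hΔ : Δ.support ⊆ halfSpace M)

instance : IsClosedImmersion (Spec.map (CommRingCat.ofHom (Polynomial.evalRingHom (0 : k)))) :=
  IsClosedImmersion.spec_of_surjective _ fun a => ⟨Polynomial.C a, by simp⟩

/-- The inclusion of the special fiber. -/
def specialFiberι : specialFiber k hΔ ⟶ Δ.toricVariety k := pullback.fst _ _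

instance : IsClosedImmersion (specialFiberι k hΔ) := by
  have h : IsClosedImmersion (pullback.fst (toA1 k hΔ)
      (Spec.map (CommRingCat.ofHom (Polynomial.evalRingHom (0 : k))))) := inferInstance
  exact h

instance : IsClosedImmersion (reducedSpecialFiberι k hΔ) := by
  have h : IsClosedImmersion ((specialFiber k hΔ).nilradical.subschemeι ≫ specialFiberι k hΔ) :=
    inferInstance
  exact h

instance : IsReduced (reducedSpecialFiber k hΔ) :=
  isReduced_nilradical_subscheme (specialFiber k hΔ)

@[simp] lemma ι_toA1 (δ : Δ.Cone) : Δ.ι k δ ≫ toA1 k hΔ =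
    Spec.map (CommRingCat.ofHom (tHom k δ.1 (t_mem hΔ δ))) :=
  colimit.ι_desc _ _

lemma tHom_X (δ : PointedCone ℝ (NR (M × ℤ))) (h : ((0, 1) : M × ℤ) ∈ dualMonoid δ) :
    tHom k δ h Polynomial.X = AddMonoidAlgebra.single (⟨(0, 1), h⟩ : dualMonoid δ) (1 : k) := by
  simp [tHom]

lemma tHom_C (δ : PointedCone ℝ (NR (M × ℤ))) (h : ((0, 1) : M × ℤ) ∈ dualMonoid δ) (a : k) :
    tHom k δ h (Polynomial.C a) = AddMonoidAlgebra.single 0 a := by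
  simp [tHom]

lemma mem_range_eval_iff (y : Spec (CommRingCat.of (Polynomial k))) :
    y ∈ Set.range (Spec.map (CommRingCat.ofHom (Polynomial.evalRingHom (0 : k)))) ↔
      Polynomial.X ∈ PrimeSpectrum.asIdeal (R := Polynomial k) y := by
  have h1 := range_comap_of_surjective k (Polynomial.evalRingHom (0 : k))
    fun a => ⟨Polynomial.C a, by simp⟩
  change y ∈ Set.range (PrimeSpectrum.comap (Polynomial.evalRingHom (0 : k))) ↔ _
  rw [h1]
  change RingHom.ker (Polynomial.evalRingHom (0 : k)) ≤
    PrimeSpectrum.asIdeal (R := Polynomial k) y ↔ _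
  have h2 : RingHom.ker (Polynomial.evalRingHom (0 : k)) = Ideal.span {Polynomial.X} := by
    have := Polynomial.ker_evalRingHom (0 : k)
    simpa using this
  rw [h2, Ideal.span_le, Set.singleton_subset_iff]
  rfl

/-- The points of the special fiber are those on the orbits of the cones that are not contained in
`N_ℝ × {0}`. -/
lemma range_reducedSpecialFiberι :
    Set.range (reducedSpecialFiberι k hΔ) =
      {x | ((0, 1) : M × ℤ) ∉ perp (Fan.orbitCone x).1} := by
  have h1 : Set.range (specialFiber k hΔ).nilradical.subschemeι = Set.univ := by
    rw [Scheme.IdealSheafData.range_subschemeι, Scheme.support_nilradical]; rfl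
  have h2 : Set.range (reducedSpecialFiberι k hΔ) = Set.range (specialFiberι k hΔ) := by
    rw [← Set.image_univ (f := specialFiberι k hΔ), ← h1, ← Set.range_comp]
    rfl
  have h4 : Set.range (specialFiberι k hΔ) = toA1 k hΔ ⁻¹' Set.range
      (Spec.map (CommRingCat.ofHom (Polynomial.evalRingHom (0 : k)))) :=
    Scheme.Pullback.range_fst _ _
  rw [h2, h4]
  ext x
  obtain ⟨δ, y, rfl⟩ := Δ.exists_ι_eq k x
  rw [Set.mem_preimage, mem_range_eval_iff]
  have h3 : toA1 k hΔ (Δ.ι k δ y) =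
      Spec.map (CommRingCat.ofHom (tHom k δ.1 (t_mem hΔ δ))) y := by
    rw [← Scheme.Hom.comp_apply, ι_toA1]
  rw [h3]
  change tHom k δ.1 (t_mem hΔ δ) Polynomial.X ∈ Fan.pointIdeal y ↔ _
  rw [tHom_X, ← not_iff_not, Fan.single_notMem_pointIdeal]
  change _ ↔ ¬ ¬ _
  rw [not_not]

variable {k hΔ}

lemma exists_height_pos_of_mem_range {x : Δ.toricVariety k}
    (hx : x ∈ Set.range (reducedSpecialFiberι k hΔ)) :
    ∃ v ∈ (Fan.orbitCone x).1, 0 < v (0, 1) := by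
  rw [range_reducedSpecialFiberι] at hx
  by_contra! hcon
  exact hx fun v hv => le_antisymm (hcon v hv) (height_nonneg hΔ _ hv)

variable (k hΔ)

lemma range_starι_subset (P : Cell Δ) :
    Set.range (Δ.starι k P.1) ⊆ Set.range (reducedSpecialFiberι k hΔ) := by
  rw [Fan.range_starι, range_reducedSpecialFiberι]
  intro x (hx : P.1 ≤ _) h0
  obtain ⟨v, hv, hpos⟩ := P.exists_height_pos
  exact hpos.ne' (h0 v (hx hv))

variable [UniqueSums M]

lemma exists_stratumι (P : Cell Δ) : ∃ l : P.starVariety k ⟶ reducedSpecialFiber k hΔ,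
    l ≫ reducedSpecialFiberι k hΔ = Δ.starι k P.1 :=
  exists_lift_of_isReduced _ _ (range_starι_subset k hΔ P)

/-- The embedding of the stratum of a cell in the reduced special fiber. -/
def stratumι (P : Cell Δ) : P.starVariety k ⟶ reducedSpecialFiber k hΔ :=
  (exists_stratumι k hΔ P).choose

@[simp] lemma stratumι_comp (P : Cell Δ) :
    stratumι k hΔ P ≫ reducedSpecialFiberι k hΔ = Δ.starι k P.1 :=
  (exists_stratumι k hΔ P).choose_spec

instance (P : Cell Δ) : IsClosedImmersion (stratumι k hΔ P) := by
  have : IsClosedImmersion (stratumι k hΔ P ≫ reducedSpecialFiberι k hΔ) := by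
    rw [stratumι_comp]; infer_instance
  exact IsClosedImmersion.of_comp_isClosedImmersion _ (reducedSpecialFiberι k hΔ)

lemma starHom_stratumι {P Q : Cell Δ} (h : P ≤ Q) :
    Δ.starHom k (show P.1 ≤ Q.1 from h) ≫ stratumι k hΔ P = stratumι k hΔ Q := by
  rw [← cancel_mono (reducedSpecialFiberι k hΔ), Category.assoc, stratumι_comp, stratumι_comp,
    Fan.starHom_starι]

variable {k hΔ} in
lemma mem_range_stratumι_iff {P : Cell Δ} {x : reducedSpecialFiber k hΔ} :
    x ∈ Set.range (stratumι k hΔ P) ↔ P.1 ≤ Fan.orbitCone (reducedSpecialFiberι k hΔ x) := by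
  have h1 : reducedSpecialFiberι k hΔ x ∈ Set.range (Δ.starι k P.1) ↔
      P.1 ≤ Fan.orbitCone (reducedSpecialFiberι k hΔ x) := by
    rw [Fan.range_starι]; rfl
  rw [← h1]
  constructor
  · rintro ⟨y, rfl⟩
    exact ⟨y, by rw [← Scheme.Hom.comp_apply, stratumι_comp]⟩
  · rintro ⟨y, hy⟩
    refine ⟨y, (reducedSpecialFiberι k hΔ).isClosedEmbedding.injective ?_⟩
    rw [← hy, ← Scheme.Hom.comp_apply, stratumι_comp]

lemma exists_vertex_mem_range (x : reducedSpecialFiber k hΔ) :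
    ∃ V : Cell Δ, V.IsVertex ∧ x ∈ Set.range (stratumι k hΔ V) := by
  obtain ⟨V, hV, hle⟩ := exists_vertex_le hΔ (Cell.ofHeightPos _
    (exists_height_pos_of_mem_range (k := k) (hΔ := hΔ) ⟨x, rfl⟩))
  exact ⟨V, hV, mem_range_stratumι_iff.mpr hle⟩

lemma isPullback_stratumι {P Q R : Cell Δ} (h : IsLeast {R : Cell Δ | P ≤ R ∧ Q ≤ R} R) :
    IsPullback (Δ.starHom k (show P.1 ≤ R.1 from h.1.1)) (Δ.starHom k (show Q.1 ≤ R.1 from h.1.2))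
      (stratumι k hΔ P) (stratumι k hΔ Q) := by
  have H := Δ.isPullback_starHom k (show P.1 ≤ R.1 from h.1.1) (show Q.1 ≤ R.1 from h.1.2)
    fun σ hP hQ => show R ≤ P.ofLE hP from h.2 ⟨hP, hQ⟩
  have hw {Z : Scheme.{u}} (a : Z ⟶ P.starVariety k) (b : Z ⟶ Q.starVariety k)
      (hab : a ≫ stratumι k hΔ P = b ≫ stratumι k hΔ Q) :
      a ≫ Δ.starι k P.1 = b ≫ Δ.starι k Q.1 := by
    rw [← stratumι_comp k hΔ, ← stratumι_comp k hΔ, reassoc_of% hab]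
  exact ⟨⟨by rw [starHom_stratumι k hΔ h.1.1, starHom_stratumι k hΔ h.1.2]⟩,
    ⟨PullbackCone.IsLimit.mk _ (fun s => H.lift s.fst s.snd (hw _ _ s.condition))
      (fun s => H.lift_fst _ _ _) (fun s => H.lift_snd _ _ _)
      fun s m h1 h2 => H.hom_ext (h1.trans (H.lift_fst _ _ _).symm)
        (h2.trans (H.lift_snd _ _ _).symm)⟩⟩

lemma disjoint_range_stratumι {P Q : Cell Δ} (h : ¬ ∃ R : Cell Δ, P ≤ R ∧ Q ≤ R) :
    Disjoint (Set.range (stratumι k hΔ P)) (Set.range (stratumι k hΔ Q)) := by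
  rw [Set.disjoint_left]
  intro x hx hx'
  rw [mem_range_stratumι_iff] at hx hx'
  exact h ⟨P.ofLE hx, hx, hx'⟩

include hΔ in
/-- The intersection with the stratum of an edge is a torus-invariant prime divisor in the stratum
of each vertex of the edge. -/
lemma isPrimeDivisor_range_starHom {V E : Cell Δ} (h : V ≤ E) (hV : V.IsVertex) (hE : E.IsEdge) :
    (Δ.star V.1).IsTorusInvariant k (Set.range (Δ.starHom k (show V.1 ≤ E.1 from h))) ∧
      IsPrimeDivisor (Set.range (Δ.starHom k (show V.1 ≤ E.1 from h))) := by
  rw [Fan.range_starHom]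
  obtain ⟨g, hg, hgE⟩ := exists_starCone_eq_ray hΔ hV hE h
  exact ⟨Fan.isTorusInvariant_range_starι _, Fan.isPrimeDivisor_range_starι _ g hg hgE⟩

/-- The special fiber is glued from the strata of the vertices along those of the edges: any two
vertices of a cell are connected by a path of edges of the cell. -/
theorem existsUnique_stratumι_comp (T : Scheme.{u})
    (g : ∀ V : Cell Δ, V.IsVertex → (V.starVariety k ⟶ T))
    (hg : ∀ (V W E : Cell Δ) (hV : V.IsVertex) (hW : W.IsVertex) (hVE : V.1 ≤ E.1)
      (hWE : W.1 ≤ E.1), E.IsEdge → Δ.starHom k hVE ≫ g V hV = Δ.starHom k hWE ≫ g W hW) :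
    ∃! φ : reducedSpecialFiber k hΔ ⟶ T,
      ∀ (V : Cell Δ) (hV : V.IsVertex), stratumι k hΔ V ≫ φ = g V hV := by
  have : Finite Δ.Cone := Δ.finite.to_subtype
  have key (V W R : Cell Δ) (hV : V.IsVertex) (hW : W.IsVertex) (hVR : V ≤ R) (hWR : W ≤ R) :
      Δ.starHom k (show V.1 ≤ R.1 from hVR) ≫ g V hV =
        Δ.starHom k (show W.1 ≤ R.1 from hWR) ≫ g W hW := by
    have := vertex_induction hΔ hW hWR (p := fun V => ∀ (hV : V.IsVertex) (hVR : V.1 ≤ R.1),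
      Δ.starHom k hVR ≫ g V hV = Δ.starHom k (show W.1 ≤ R.1 from hWR) ≫ g W hW)
      (fun _ _ => rfl) (fun V V' E hV hV' hE hVE hVE' hER ih hV'' hVR => by
        rw [← ih hV' (le_trans (show V'.1 ≤ E.1 from hVE') hER),
        ← Fan.starHom_comp k (show V.1 ≤ E.1 from hVE) (show E.1 ≤ R.1 from hER),
        ← Fan.starHom_comp k (show V'.1 ≤ E.1 from hVE') (show E.1 ≤ R.1 from hER),
        Category.assoc, Category.assoc, hg V V' E hV hV' hVE hVE' hE]) hV hVR
    exact this hV hVR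
  have hsurj (x : reducedSpecialFiber k hΔ) :
      ∃ (V : {V : Cell Δ // V.IsVertex}) (y : V.1.starVariety k), stratumι k hΔ V.1 y = x := by
    obtain ⟨V, hV, y, hy⟩ := exists_vertex_mem_range k hΔ x
    exact ⟨⟨V, hV⟩, y, hy⟩
  obtain ⟨φ, hφ, huniq⟩ := Fan.existsUnique_glue_star k
    (I := {V : Cell Δ // V.IsVertex}) (fun V => V.1.1) (reducedSpecialFiberι k hΔ)
    (fun V => stratumι k hΔ V.1) (fun V => stratumι_comp k hΔ V.1) hsurj
    (fun V => g V.1 V.2)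
    (fun V W R hV hW => key V.1 W.1 (V.1.ofLE hV) V.2 W.2 hV hW)
  exact ⟨φ, fun V hV => hφ ⟨V, hV⟩, fun φ' hφ' => huniq φ' fun V => hφ' V.1 V.2⟩

end SpecialFiber

/-! ### Surjectivity, and reducedness of the special fiber -/

section Surjectivity

variable (k : Type u) [Field k] {M : Type u} [AddCommGroup M] {Δ : Fan (M × ℤ)}

/-- Every chart maps onto the complement of the origin of the affine line: over the residue field of
a point `q ≠ 0`, where `t` is invertible, `χ^{(u,n)} ↦ t^n` is a point of the chart above `q`. -/
lemma exists_tHom_comap_eq (δ : PointedCone ℝ (NR (M × ℤ))) (h : ((0, 1) : M × ℤ) ∈ dualMonoid δ)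
    (q : PrimeSpectrum (Polynomial k)) (hq : Polynomial.X ∉ q.asIdeal) :
    ∃ y : PrimeSpectrum (semigroupRing k δ), y.comap (tHom k δ h) = q := by
  have htne : algebraMap (Polynomial k) q.asIdeal.ResidueField Polynomial.X ≠ 0 := by
    rwa [Ne, Ideal.algebraMap_residueField_eq_zero]
  set t := algebraMap (Polynomial k) q.asIdeal.ResidueField Polynomial.X with ht
  let ψ : semigroupRing k δ →+* q.asIdeal.ResidueField :=
    (AddMonoidAlgebra.lift k q.asIdeal.ResidueField (dualMonoid δ)
      { toFun := fun m => t ^ (m.toAdd : M × ℤ).2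
        map_one' := by simp
        map_mul' := fun a b => by
          rw [← zpow_add₀ htne]; rfl }).toRingHom
  have hψ : ψ.comp (tHom k δ h) = algebraMap (Polynomial k) q.asIdeal.ResidueField := by
    refine Polynomial.ringHom_ext (fun a => ?_) ?_
    · rw [RingHom.comp_apply, tHom_C]
      change AddMonoidAlgebra.lift _ _ _ _ _ = _
      rw [AddMonoidAlgebra.lift_single]
      change a • t ^ (0 : ℤ) = _
      rw [zpow_zero, Algebra.smul_def, mul_one, IsScalarTower.algebraMap_apply k (Polynomial k)]
      rfl
    · rw [RingHom.comp_apply, tHom_X]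
      change AddMonoidAlgebra.lift _ _ _ _ _ = _
      rw [AddMonoidAlgebra.lift_single]
      change (1 : k) • t ^ (1 : ℤ) = _
      rw [zpow_one, one_smul]
  refine ⟨(⊥ : PrimeSpectrum q.asIdeal.ResidueField).comap ψ, ?_⟩
  rw [← PrimeSpectrum.comap_comp_apply, hψ]
  refine PrimeSpectrum.ext ?_
  ext x
  exact Ideal.algebraMap_residueField_eq_zero

/-- The morphism to the affine line is surjective. -/
theorem surjective_toA1 (hΔ : Δ.support = halfSpace M) : Surjective (toA1 k hΔ.subset) := by
  refine ⟨fun q => ?_⟩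
  have hpt : pt (0 : NR M) 1 ∈ Δ.support := by rw [hΔ]; simp [halfSpace]
  obtain ⟨δ, hδ, hpt⟩ := Set.mem_iUnion₂.mp hpt
  -- the origin is the image of any point of the stratum of a cell
  by_cases hq : Polynomial.X ∈ PrimeSpectrum.asIdeal (R := Polynomial k) q
  · let P : Cell Δ := ⟨⟨δ, hδ⟩, ⟨0, hpt⟩⟩
    obtain ⟨z, hz⟩ := range_starι_subset k hΔ.subset P
      ⟨(Δ.star P.1).ι k (Δ.starCone (le_refl P.1))
        (PrimeSpectrum.comap (algebraMap _ _)
          (Classical.arbitrary (PrimeSpectrum (semigroupRing k (Δ.starCone (le_refl P.1)).1)))), rfl⟩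
    refine ⟨reducedSpecialFiberι k hΔ.subset z, ?_⟩
    have h1 : toA1 k hΔ.subset (reducedSpecialFiberι k hΔ.subset z) ∈
        Set.range (Spec.map (CommRingCat.ofHom (Polynomial.evalRingHom (0 : k)))) := by
      refine ⟨pullback.snd (toA1 k hΔ.subset) _ ((specialFiber k hΔ.subset).nilradical.subschemeι z),
        ?_⟩
      exact congr_arg (fun f : specialFiber k hΔ.subset ⟶ _ =>
        f ((specialFiber k hΔ.subset).nilradical.subschemeι z)) pullback.condition.symm
    obtain ⟨p, hp⟩ := h1
    obtain ⟨p', hp'⟩ := (mem_range_eval_iff k q).mpr hq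
    have : Subsingleton (Spec (CommRingCat.of k)) :=
      inferInstanceAs (Subsingleton (PrimeSpectrum k))
    rw [← hp, ← hp', Subsingleton.elim p p']
  · obtain ⟨y, hy⟩ := exists_tHom_comap_eq k δ (t_mem hΔ.subset ⟨δ, hδ⟩) q hq
    refine ⟨Δ.ι k ⟨δ, hδ⟩ y, ?_⟩
    exact (congr_arg (fun f : chart k δ ⟶ _ => f y) (ι_toA1 k hΔ.subset ⟨δ, hδ⟩)).trans hy

end Surjectivity

section ReducedFiber

variable (k : Type u) [Field k] {M : Type u} [AddCommGroup M] {Δ : Fan (M × ℤ)}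
  (hΔ : Δ.support ⊆ halfSpace M)

lemma app_appLE_eq_zero {X Y Z W : Scheme.{u}} (i : Z ⟶ X) (f : X ⟶ Y) (p : Z ⟶ W) (e : W ⟶ Y)
    (w : i ≫ f = p ≫ e) (U : X.Opens) (hU : U ≤ f ⁻¹ᵁ ⊤) (t : Γ(Y, ⊤)) (ht : e.appTop t = 0) :
    i.app U (f.appLE ⊤ U hU t) = 0 := by
  have h (q : Z ⟶ Y) (hq : i ≫ f = q) (hle : i ⁻¹ᵁ U ≤ q ⁻¹ᵁ ⊤) :
      f.appLE ⊤ U hU ≫ i.app U = q.appLE ⊤ (i ⁻¹ᵁ U) hle := by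
    subst hq
    rw [Scheme.Hom.app_eq_appLE, Scheme.Hom.appLE_comp_appLE]
  refine (congr_arg (fun φ => φ.hom t) (h _ w (le_top : _ ≤ (⊤ : Z.Opens)))).trans ?_
  have h' (hle : i ⁻¹ᵁ U ≤ (p ≫ e) ⁻¹ᵁ ⊤) :
      (p ≫ e).appLE ⊤ (i ⁻¹ᵁ U) hle = e.appTop ≫ p.appLE _ _ hle := Scheme.Hom.comp_appLE ..
  refine (congr_arg (fun φ => φ.hom t) (h' _)).trans ?_
  exact (congr_arg (p.appLE _ (i ⁻¹ᵁ U) _) ht).trans (map_zero _)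

lemma appLE_comp_appIso {X : Scheme.{u}} {R A : CommRingCat.{u}} (j : Spec A ⟶ X)
    [IsOpenImmersion j] (f : X ⟶ Spec R) (φ : R ⟶ A) (w : j ≫ f = Spec.map φ)
    (h : j ''ᵁ ⊤ ≤ f ⁻¹ᵁ ⊤) :
    f.appLE ⊤ (j ''ᵁ ⊤) h ≫ (j.appIso ⊤).hom ≫ (Scheme.ΓSpecIso A).hom =
      (Scheme.ΓSpecIso R).hom ≫ φ := by
  rw [← Scheme.ΓSpecIso_naturality, Scheme.Hom.appIso_hom', ← Category.assoc,
    Scheme.Hom.appLE_comp_appLE]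
  simp only [w]
  congr 1

/-- The character `χ^{(0,1)}` vanishes on the special fiber. -/
lemma inv_chartSections_mem_ker (δ : Δ.Cone) :
    (Δ.chartSections k δ).inv (AddMonoidAlgebra.single (⟨(0, 1), t_mem hΔ δ⟩ : dualMonoid δ.1) 1) ∈
      (specialFiberι k hΔ).ker.ideal (Δ.chartOpen k δ) := by
  let t : Γ(Spec (CommRingCat.of (Polynomial k)), ⊤) :=
    (Scheme.ΓSpecIso (CommRingCat.of (Polynomial k))).inv Polynomial.X
  have ht : (Scheme.ΓSpecIso (CommRingCat.of (Polynomial k))).hom t = Polynomial.X :=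
    CommRingCat.hom_inv_apply _ _
  have hle : (Δ.chartOpen k δ).1 ≤ toA1 k hΔ ⁻¹ᵁ ⊤ := le_top
  have h1 : (Δ.chartSections k δ).inv
      (AddMonoidAlgebra.single (⟨(0, 1), t_mem hΔ δ⟩ : dualMonoid δ.1) 1) =
      (toA1 k hΔ).appLE ⊤ (Δ.chartOpen k δ).1 hle t := by
    have h2 : (toA1 k hΔ).appLE ⊤ (Δ.chartOpen k δ).1 hle ≫ (Δ.chartSections k δ).hom =
        (Scheme.ΓSpecIso _).hom ≫ CommRingCat.ofHom (tHom k δ.1 (t_mem hΔ δ)) :=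
      appLE_comp_appIso (Δ.ι k δ) (toA1 k hΔ) _ (ι_toA1 k hΔ δ) _
    have h4 : (Δ.chartSections k δ).hom ((toA1 k hΔ).appLE ⊤ (Δ.chartOpen k δ).1 hle t) =
        AddMonoidAlgebra.single (⟨(0, 1), t_mem hΔ δ⟩ : dualMonoid δ.1) 1 :=
      (congr_arg (fun φ => φ.hom t) h2).trans
        ((congr_arg (tHom k δ.1 (t_mem hΔ δ)) ht).trans (tHom_X k δ.1 _))
    rw [← h4, CommRingCat.inv_hom_apply]
  have h5 : (Spec.map (CommRingCat.ofHom (Polynomial.evalRingHom (0 : k)))).appTop t = 0 := by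
    have h7 : (Scheme.ΓSpecIso (CommRingCat.of k)).hom
        ((Spec.map (CommRingCat.ofHom (Polynomial.evalRingHom (0 : k)))).appTop t) = 0 :=
      (congr_arg (fun φ => φ.hom t)
        (Scheme.ΓSpecIso_naturality (CommRingCat.ofHom (Polynomial.evalRingHom (0 : k))))).trans
        ((congr_arg (Polynomial.evalRingHom (0 : k)) ht).trans Polynomial.eval_X)
    exact (map_eq_zero_iff _ (ConcreteCategory.bijective_of_isIso
      (Scheme.ΓSpecIso (CommRingCat.of k)).hom).1).mp h7
  rw [h1, Scheme.Hom.ker_apply, RingHom.mem_ker]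
  exact app_appLE_eq_zero (specialFiberι k hΔ) (toA1 k hΔ) (pullback.snd _ _) _
    pullback.condition _ hle t h5

variable [UniqueSums M]

/-- If the vertices are lattice points, the special fiber is reduced: a function on a chart that
vanishes on the strata of all the vertices is divisible by `χ^{(0,1)}`. -/
lemma isReduced_specialFiber
    (hlat : ∀ V : Cell Δ, V.IsVertex → ∃ n : M →+ ℤ, V.polyhedron = {toNR n}) :
    IsReduced (specialFiber k hΔ) := by
  have hker : (reducedSpecialFiberι k hΔ).ker ≤ (specialFiberι k hΔ).ker := by
    refine Scheme.IdealSheafData.le_of_iSup_eq_top (fun δ : Δ.Cone => Δ.chartOpen k δ) ?_ ?_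
    · refine eq_top_iff.mpr fun x _ => ?_
      obtain ⟨δ, y, rfl⟩ := Δ.exists_ι_eq k x
      exact TopologicalSpace.Opens.mem_iSup.mpr ⟨δ, Δ.ι_mem_chartOpen k δ y⟩
    · intro δ s hs
      have hs' (V : Cell Δ) (hV : V.1 ≤ δ) : Δ.truncate k hV ((Δ.chartSections k δ).hom s) = 0 := by
        rw [← Fan.mem_ker_starι_ideal, ← stratumι_comp k hΔ]
        exact Scheme.Hom.le_ker_comp (stratumι k hΔ V) (reducedSpecialFiberι k hΔ) _ hs
      set f : semigroupRing k δ.1 := (Δ.chartSections k δ).hom s with hf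
      let χ : semigroupRing k δ.1 := AddMonoidAlgebra.single ⟨(0, 1), t_mem hΔ δ⟩ 1
      have hfχ : f ∈ Ideal.span {χ} := by
        refine mem_ideal_of_support fun m hm => ?_
        have hmem := sub_mem_of_lattice hΔ δ m.2 hlat fun V _ hVδ hmV => hm <| by
          have := Δ.coeff_truncate k hVδ f (Δ.starChar hVδ m hmV)
          rw [hs'] at this
          exact this.symm
        rw [Ideal.mem_span_singleton]
        refine ⟨AddMonoidAlgebra.single ⟨_, hmem⟩ 1, ?_⟩
        rw [AddMonoidAlgebra.single_mul_single, mul_one]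
        congr 1
        ext <;> simp
      obtain ⟨f', hf'⟩ := Ideal.mem_span_singleton.mp hfχ
      have h1 : s = (Δ.chartSections k δ).inv χ * (Δ.chartSections k δ).inv f' := by
        rw [← map_mul, ← hf', hf, CommRingCat.inv_hom_apply]
      rw [h1]
      exact Ideal.mul_mem_right _ _ (inv_chartSections_mem_ker k hΔ δ)
  let l := IsClosedImmersion.lift (reducedSpecialFiberι k hΔ) (specialFiberι k hΔ) hker
  have hl : l ≫ reducedSpecialFiberι k hΔ = specialFiberι k hΔ := IsClosedImmersion.lift_fac _ _ _
  let r : reducedSpecialFiber k hΔ ⟶ specialFiber k hΔ :=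
    (specialFiber k hΔ).nilradical.subschemeι
  have hr : r ≫ specialFiberι k hΔ = reducedSpecialFiberι k hΔ := rfl
  have : IsIso l := ⟨r, by
    rw [← cancel_mono (specialFiberι k hΔ), Category.assoc, hr, hl, Category.id_comp], by
    rw [← cancel_mono (reducedSpecialFiberι k hΔ), Category.assoc, hl, hr, Category.id_comp]⟩
  exact isReduced_of_isOpenImmersion l

end ReducedFiber

/-! ### The generic fiber -/

section GenericHom

variable (k : Type u) [Field k] {M : Type u} [AddCommGroup M]

lemma fst_mem_dualMonoid {σ : PointedCone ℝ (NR M)} {δ : PointedCone ℝ (NR (M × ℤ))}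
    (h : σ.map (heightZero M) ≤ δ) {m : M × ℤ} (hm : m ∈ dualMonoid δ) : m.1 ∈ dualMonoid σ :=
  fun v hv => by simpa using hm _ (h ⟨v, hv, rfl⟩)

lemma genericHom_single {σ : PointedCone ℝ (NR M)} {δ : PointedCone ℝ (NR (M × ℤ))}
    (h : σ.map (heightZero M) ≤ δ) (m : dualMonoid δ) (a : k) :
    genericHom k σ δ h (AddMonoidAlgebra.single m a) =
      AddMonoidAlgebra.single (⟨(m : M × ℤ).1, fst_mem_dualMonoid h m.2⟩ : dualMonoid σ)
        (algebraMap k (RatFunc k) a * RatFunc.X ^ (m : M × ℤ).2) := by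
  change AddMonoidAlgebra.lift _ _ _ _ _ = _
  rw [AddMonoidAlgebra.lift_single]
  change a • AddMonoidAlgebra.single _ _ = _
  rw [AddMonoidAlgebra.smul_single, Algebra.smul_def]
  rfl

lemma restr_comp_genericHom {σ σ' : PointedCone ℝ (NR M)} {δ δ' : PointedCone ℝ (NR (M × ℤ))}
    (hσ : σ ≤ σ') (hδ : δ ≤ δ') (h : σ.map (heightZero M) ≤ δ) (h' : σ'.map (heightZero M) ≤ δ') :
    (restr (RatFunc k) hσ).comp (genericHom k σ' δ' h') =
      (genericHom k σ δ h).comp (restr k hδ) := by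
  refine semigroupRing_hom_ext fun m a => ?_
  rw [RingHom.comp_apply, RingHom.comp_apply, restr_single, genericHom_single, genericHom_single,
    restr_single]
  rfl

lemma chartMap_comp_genericHom {σ σ' : PointedCone ℝ (NR M)} {δ δ' : PointedCone ℝ (NR (M × ℤ))}
    (hσ : σ ≤ σ') (hδ : δ ≤ δ') (h : σ.map (heightZero M) ≤ δ) (h' : σ'.map (heightZero M) ≤ δ') :
    chartMap (RatFunc k) hσ ≫ Spec.map (CommRingCat.ofHom (genericHom k σ' δ' h')) =
      Spec.map (CommRingCat.ofHom (genericHom k σ δ h)) ≫ chartMap k hδ := by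
  rw [chartMap, chartMap, ← Spec.map_comp, ← Spec.map_comp, ← CommRingCat.ofHom_comp,
    ← CommRingCat.ofHom_comp, restr_comp_genericHom k hσ hδ h h']

/-- A character that is nonnegative on the face of `σ` cut out by `u` becomes nonnegative on `σ`
after adding a multiple of `u`. -/
lemma exists_add_nsmul_mem_dualMonoid {L : Type u} [AddCommGroup L] {σ τ : PointedCone ℝ (NR L)}
    (h : τ ≤ σ) (hσ : IsRational σ) (u : dualMonoid σ)
    (hu : ∀ x ∈ σ, (x ∈ τ ↔ x (u : L) = 0)) (w : dualMonoid τ) :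
    ∃ n : ℕ, (w : L) + n • (u : L) ∈ dualMonoid σ := by
  -- over any field of coefficients, `χ^w` times a power of `χ^u` lies in the ring of `σ`
  let := (restr (ULift.{u} ℚ) h).toAlgebra
  have := isLocalization_restr (ULift.{u} ℚ) h hσ u hu
  obtain ⟨n, s, hs⟩ := IsLocalization.Away.surj
    (AddMonoidAlgebra.single u (1 : ULift.{u} ℚ) : semigroupRing (ULift.{u} ℚ) σ)
    (AddMonoidAlgebra.single w (1 : ULift.{u} ℚ) : semigroupRing (ULift.{u} ℚ) τ)
  refine ⟨n, ?_⟩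
  by_contra hn
  have h1 : (AddMonoidAlgebra.single (w + n • AddSubmonoid.inclusion (dualMonoid_anti h) u)
      (1 : ULift.{u} ℚ) : semigroupRing (ULift.{u} ℚ) τ) = restr (ULift.{u} ℚ) h s := by
    rw [← show _ = restr (ULift.{u} ℚ) h s from hs]
    change _ = _ * (restr (ULift.{u} ℚ) h _) ^ n
    rw [restr_single, AddMonoidAlgebra.single_pow, AddMonoidAlgebra.single_mul_single, one_pow,
      mul_one]
  have h2 := congr_arg
    (fun f => f.coeff (w + n • AddSubmonoid.inclusion (dualMonoid_anti h) u)) h1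
  simp only [AddMonoidAlgebra.coeff_single, Finsupp.single_eq_same] at h2
  refine one_ne_zero (h2.trans ?_)
  change (AddMonoidAlgebra.mapDomain _ s).coeff _ = 0
  rw [AddMonoidAlgebra.coeff_mapDomain]
  refine Finsupp.mapDomain_of_notMem_range _ _ ?_
  rintro ⟨m, hm⟩
  refine hn ?_
  have h3 : (m : L) = (w : L) + n • (u : L) := by
    have := congr_arg (fun z : dualMonoid τ => (z : L)) hm
    simpa using this
  rw [← h3]
  exact m.2

lemma map_comap_heightZero (δ : PointedCone ℝ (NR (M × ℤ))) :
    (δ.comap (heightZero M)).map (heightZero M) = cutFace δ (0, 1) := by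
  ext x
  constructor
  · rintro ⟨v, hv, rfl⟩
    refine ⟨hv, ?_⟩
    change pt v 0 (0, 1) = 0
    simp
  · rintro ⟨hx, hx0⟩
    have e : heightZero M (x.comp (AddMonoidHom.inl M ℤ)) = x := by
      conv_rhs => rw [eq_pt x, hx0]
      rfl
    refine ⟨x.comp (AddMonoidHom.inl M ℤ), ?_, e⟩
    change heightZero M _ ∈ δ
    rw [e]; exact hx

lemma map_comap_le (δ : PointedCone ℝ (NR (M × ℤ))) :
    (δ.comap (heightZero M)).map (heightZero M) ≤ δ :=
  map_comap_heightZero δ ▸ fun _ hx => hx.1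

variable {δ : PointedCone ℝ (NR (M × ℤ))}

/-- A nonnegative character on the bottom face of `δ` extends to a nonnegative one on `δ`. -/
lemma exists_prodMk_mem_dualMonoid (hδ : IsRational δ) (ht : ((0, 1) : M × ℤ) ∈ dualMonoid δ)
    (u : dualMonoid (δ.comap (heightZero M))) : ∃ n : ℤ, ((u : M), n) ∈ dualMonoid δ := by
  have hw : ((u : M), (0 : ℤ)) ∈ dualMonoid (cutFace δ (0, 1)) := by
    rw [← map_comap_heightZero]
    rintro _ ⟨v, hv, rfl⟩
    have := u.2 v hv
    change 0 ≤ pt v 0 _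
    simpa using this
  obtain ⟨n, hn⟩ := exists_add_nsmul_mem_dualMonoid (τ := cutFace δ (0, 1)) (fun x hx => hx.1) hδ
    ⟨(0, 1), ht⟩ (fun x hx => ⟨fun h => h.2, fun h => ⟨hx, h⟩⟩) ⟨_, hw⟩
  exact ⟨n, by simpa using hn⟩

section UniversalProperty

variable {R : Type*} [CommRing R] (a : semigroupRing k δ →+* R) (b : RatFunc k →+* R)
  (ht : ((0, 1) : M × ℤ) ∈ dualMonoid δ)
  (hab : a.comp (tHom k δ ht) = b.comp (algebraMap (Polynomial k) (RatFunc k)))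

include hab

/-- The expected value at `χ^u` of the homomorphism induced by `a` and `b` does not depend on the lift
`(u, n)` of `u`. -/
lemma apply_single_mul_zpow_eq {u : M} {n n' : ℤ} (h : (u, n) ∈ dualMonoid δ)
    (h' : (u, n') ∈ dualMonoid δ) :
    a (AddMonoidAlgebra.single ⟨_, h⟩ 1) * b (RatFunc.X ^ (-n)) =
      a (AddMonoidAlgebra.single ⟨_, h'⟩ 1) * b (RatFunc.X ^ (-n')) := by
  wlog hle : n ≤ n' generalizing n n'
  · exact (this h' h (le_of_not_ge hle)).symm
  obtain ⟨j, rfl⟩ := Int.le.dest hle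
  have hX : a (AddMonoidAlgebra.single ⟨_, ht⟩ 1) = b RatFunc.X := by
    have := congr_arg (fun f : Polynomial k →+* R => f Polynomial.X) hab
    simpa [tHom_X] using this
  have e : (AddMonoidAlgebra.single ⟨_, h'⟩ 1 : semigroupRing k δ) =
      AddMonoidAlgebra.single ⟨_, h⟩ 1 * AddMonoidAlgebra.single ⟨_, ht⟩ 1 ^ j := by
    rw [AddMonoidAlgebra.single_pow, AddMonoidAlgebra.single_mul_single]
    congr 1
    · ext <;> simp
    · simp
  rw [e, map_mul, map_pow, hX, ← map_pow, mul_assoc, ← map_mul, ← zpow_natCast,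
    ← zpow_add₀ RatFunc.X_ne_zero]
  congr 3
  ring

/-- The universal property of `k(t)[S_σ]`, for `σ` the bottom face of `δ`, as the pushout of `k[S_δ]`
and `k(t)` over `k[t]`. -/
lemma existsUnique_ringHom (hδ : IsRational δ) :
    ∃! c : semigroupRing (RatFunc k) (δ.comap (heightZero M)) →+* R,
      c.comp (genericHom k _ δ (map_comap_le δ)) = a ∧ c.comp (algebraMap (RatFunc k) _) = b := by
  choose n hn using exists_prodMk_mem_dualMonoid hδ ht
  have key (u : dualMonoid (δ.comap (heightZero M))) (n' : ℤ) (h : ((u : M), n') ∈ dualMonoid δ) :=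
    apply_single_mul_zpow_eq k a b ht hab (hn u) h
  let F : Multiplicative (dualMonoid (δ.comap (heightZero M))) →* R :=
    { toFun := fun u => a (AddMonoidAlgebra.single ⟨_, hn u.toAdd⟩ 1) * b (RatFunc.X ^ (-n u.toAdd))
      map_one' := by
        refine (key 0 0 (zero_mem _)).trans ?_
        rw [neg_zero, zpow_zero, map_one, mul_one, ← map_one a,
          AddMonoidAlgebra.one_def]
        rfl
      map_mul' := fun u v => by
        refine (key (u.toAdd + v.toAdd) (n u.toAdd + n v.toAdd)
          (add_mem (hn u.toAdd) (hn v.toAdd))).trans ?_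
        rw [neg_add,
          zpow_add₀ RatFunc.X_ne_zero, map_mul, mul_mul_mul_comm, ← map_mul a,
          AddMonoidAlgebra.single_mul_single, mul_one]
        rfl }
  let c := AddMonoidAlgebra.liftNCRingHom b F fun _ _ => mul_comm _ _
  have hc (u s) : c (AddMonoidAlgebra.single u s) = b s * F (Multiplicative.ofAdd u) :=
    AddMonoidAlgebra.liftNC_single _ _ _ _
  have hC (s : k) : b (algebraMap k (RatFunc k) s) = a (AddMonoidAlgebra.single 0 s) := by
    have := congr_arg (fun f : Polynomial k →+* R => f (Polynomial.C s)) hab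
    simp only [RingHom.comp_apply, tHom_C] at this
    rw [this, IsScalarTower.algebraMap_apply k (Polynomial k)]
    rfl
  refine ⟨c, ⟨semigroupRing_hom_ext fun m s => ?_, RingHom.ext fun s => ?_⟩, ?_⟩
  · rw [RingHom.comp_apply, genericHom_single, hc, map_mul, hC, single_eq_mul _ m s, map_mul]
    have h1 := key ⟨(m : M × ℤ).1, fst_mem_dualMonoid (map_comap_le δ) m.2⟩ (m : M × ℤ).2 m.2
    refine (congr_arg (fun z => _ * z) h1).trans ?_
    rw [mul_assoc, mul_left_comm (b _), ← map_mul b, ← zpow_add₀ RatFunc.X_ne_zero, add_neg_cancel,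
      zpow_zero, map_one, mul_one]
  · change c (AddMonoidAlgebra.single 0 s) = _
    rw [hc, ofAdd_zero, map_one, mul_one]
  · rintro c' ⟨h1, h2⟩
    refine semigroupRing_hom_ext fun u s => ?_
    have e : (AddMonoidAlgebra.single u s : semigroupRing (RatFunc k) (δ.comap (heightZero M))) =
        algebraMap (RatFunc k) _ (s * RatFunc.X ^ (-n u)) *
          genericHom k _ δ (map_comap_le δ) (AddMonoidAlgebra.single ⟨_, hn u⟩ 1) := by
      rw [genericHom_single, map_one, one_mul]
      change _ = AddMonoidAlgebra.single 0 _ * _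
      rw [AddMonoidAlgebra.single_mul_single, zero_add]
      change _ = AddMonoidAlgebra.single _ (s * RatFunc.X ^ (-n u) * RatFunc.X ^ n u)
      rw [mul_assoc, ← zpow_add₀ RatFunc.X_ne_zero, neg_add_cancel, zpow_zero, mul_one]
    have h3 : c' (AddMonoidAlgebra.single u s) = b (s * RatFunc.X ^ (-n u)) *
        a (AddMonoidAlgebra.single ⟨_, hn u⟩ 1) := by
      rw [e, map_mul, ← h1, ← h2]; rfl
    rw [h3, hc, map_mul]
    exact (mul_assoc _ _ _).trans (congr_arg (b s * ·) (mul_comm _ _))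

end UniversalProperty

/-- The affine case of the description of the generic fiber. -/
lemma isPullback_genericHom (hδ : IsRational δ) (ht : ((0, 1) : M × ℤ) ∈ dualMonoid δ) :
    IsPullback (Spec.map (CommRingCat.ofHom (genericHom k (δ.comap (heightZero M)) δ
        (map_comap_le δ))))
      (Spec.map (CommRingCat.ofHom
        (algebraMap (RatFunc k) (semigroupRing (RatFunc k) (δ.comap (heightZero M))))))
      (Spec.map (CommRingCat.ofHom (tHom k δ ht)))
      (Spec.map (CommRingCat.ofHom (algebraMap (Polynomial k) (RatFunc k)))) := by
  refine isPullback_SpecMap_of_isPushout _ _ _ _ ⟨⟨?_⟩, ⟨PushoutCocone.IsColimit.mk _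
    (fun s => CommRingCat.ofHom (existsUnique_ringHom k s.inl.hom s.inr.hom ht
      (congr_arg CommRingCat.Hom.hom s.condition) hδ).choose) (fun s => ?_) (fun s => ?_)
    (fun s c h1 h2 => ?_)⟩⟩
  · rw [← CommRingCat.ofHom_comp, ← CommRingCat.ofHom_comp]
    congr 1
    refine Polynomial.ringHom_ext (fun s => ?_) ?_
    · rw [RingHom.comp_apply, tHom_C, genericHom_single]
      simp only [Prod.snd_zero, ZeroMemClass.coe_zero, zpow_zero, mul_one, RingHom.comp_apply]
      rw [IsScalarTower.algebraMap_apply k (Polynomial k)]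
      rfl
    · rw [RingHom.comp_apply, tHom_X, genericHom_single]
      simp only [map_one, zpow_one, one_mul, RingHom.comp_apply, RatFunc.algebraMap_X]
      rfl
  · exact CommRingCat.hom_ext (existsUnique_ringHom k s.inl.hom s.inr.hom ht
      (congr_arg CommRingCat.Hom.hom s.condition) hδ).choose_spec.1.1
  · exact CommRingCat.hom_ext (existsUnique_ringHom k s.inl.hom s.inr.hom ht
      (congr_arg CommRingCat.Hom.hom s.condition) hδ).choose_spec.1.2
  · exact CommRingCat.hom_ext ((existsUnique_ringHom k s.inl.hom s.inr.hom ht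
      (congr_arg CommRingCat.Hom.hom s.condition) hδ).choose_spec.2 c.hom
      ⟨congr_arg CommRingCat.Hom.hom h1, congr_arg CommRingCat.Hom.hom h2⟩)

end GenericHom

section GenericFiber

variable (k : Type u) [Field k] {M : Type u} [AddCommGroup M] {Δ : Fan (M × ℤ)} {S : Fan M}
  (hS : S.cones = (fun δ => PointedCone.comap (heightZero M) δ) '' Δ.cones)
  (hΔ : Δ.support ⊆ halfSpace M)

/-- The cone at height zero of a cone of `Δ`. -/
def bottomCone (δ : Δ.Cone) : S.Cone := ⟨δ.1.comap (heightZero M), hS ▸ ⟨δ.1, δ.2, rfl⟩⟩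

include hS hΔ in
lemma map_heightZero_mem (σ : S.Cone) : σ.1.map (heightZero M) ∈ Δ.cones := by
  obtain ⟨δ, hδ, h⟩ : σ.1 ∈ (fun δ => PointedCone.comap (heightZero M) δ) '' Δ.cones := hS ▸ σ.2
  rw [← h]
  change (δ.comap (heightZero M)).map (heightZero M) ∈ _
  rw [map_comap_heightZero]
  exact Δ.face_mem δ hδ _ (isFaceOf_cutFace (t_mem hΔ ⟨δ, hδ⟩))

/-- A cone of `S`, as a cone of `Δ`. -/
def liftCone (σ : S.Cone) : Δ.Cone := ⟨σ.1.map (heightZero M), map_heightZero_mem hS hΔ σ⟩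

lemma map_le_liftCone (σ : S.Cone) : σ.1.map (heightZero M) ≤ (liftCone hS hΔ σ).1 := le_rfl

lemma map_bottomCone_le (δ : Δ.Cone) : (bottomCone hS δ).1.map (heightZero M) ≤ δ.1 :=
  map_comap_le δ.1

lemma liftCone_mono {σ σ' : S.Cone} (h : σ ≤ σ') : liftCone hS hΔ σ ≤ liftCone hS hΔ σ' := by
  rintro _ ⟨v, hv, rfl⟩
  exact ⟨v, h hv, rfl⟩

lemma le_bottomCone_iff {σ : S.Cone} {δ : Δ.Cone} :
    σ ≤ bottomCone hS δ ↔ liftCone hS hΔ σ ≤ δ := by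
  constructor
  · rintro h _ ⟨v, hv, rfl⟩
    exact h hv
  · exact fun h v hv => h ⟨v, hv, rfl⟩

lemma chartMap_comp_genericHom_ι {σ σ' : S.Cone} (h : σ ≤ σ') :
    chartMap (RatFunc k) (show σ.1 ≤ σ'.1 from h) ≫
      Spec.map (CommRingCat.ofHom (genericHom k σ'.1 (liftCone hS hΔ σ').1
        (map_le_liftCone hS hΔ σ'))) ≫ Δ.ι k (liftCone hS hΔ σ') =
    Spec.map (CommRingCat.ofHom (genericHom k σ.1 (liftCone hS hΔ σ).1
      (map_le_liftCone hS hΔ σ))) ≫ Δ.ι k (liftCone hS hΔ σ) := by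
  rw [← Fan.chartMap_ι k Δ (liftCone_mono hS hΔ h), ← Category.assoc, ← Category.assoc]
  congr 1
  exact chartMap_comp_genericHom k _ _ _ _

/-- The morphism from the toric variety of `S` over `k(t)` to the toric variety of `Δ` over `k`. -/
def genericι : S.toricVariety (RatFunc k) ⟶ Δ.toricVariety k :=
  colimit.desc (S.functor (RatFunc k))
    { pt := Δ.toricVariety k
      ι :=
        { app := fun σ => Spec.map (CommRingCat.ofHom (genericHom k σ.1 (liftCone hS hΔ σ).1
            (map_le_liftCone hS hΔ σ))) ≫ Δ.ι k (liftCone hS hΔ σ)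
          naturality := by
            intro σ σ' f
            refine Eq.trans ?_ (Category.comp_id _).symm
            exact chartMap_comp_genericHom_ι k hS hΔ (leOfHom f) } }

lemma ι_genericι (σ : S.Cone) (δ : Δ.Cone) (h : σ.1.map (heightZero M) ≤ δ.1) :
    S.ι (RatFunc k) σ ≫ genericι k hS hΔ =
      Spec.map (CommRingCat.ofHom (genericHom k σ.1 δ.1 h)) ≫ Δ.ι k δ := by
  have h1 : S.ι (RatFunc k) σ ≫ genericι k hS hΔ = Spec.map (CommRingCat.ofHom (genericHom k σ.1
      (liftCone hS hΔ σ).1 (map_le_liftCone hS hΔ σ))) ≫ Δ.ι k (liftCone hS hΔ σ) := colimit.ι_desc _ _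
  have hle : liftCone hS hΔ σ ≤ δ := h
  rw [h1, ← Fan.chartMap_ι k Δ hle, ← Category.assoc]
  congr 1
  rw [← chartMap_comp_genericHom k (le_refl σ.1) hle (map_le_liftCone hS hΔ σ) h, chartMap,
    restr_refl]
  exact (congr_arg (· ≫ _) (Spec.map_id _)).trans (Category.id_comp _)

/-- A point on the orbit of `σ` maps to an orbit of a cone containing `σ × {0}`: a character of
`σ × {0}` that does not vanish at the image is orthogonal to `σ`. -/
lemma orbitCone_genericι (x : S.toricVariety (RatFunc k)) :
    liftCone hS hΔ (Fan.orbitCone x) ≤ Fan.orbitCone (genericι k hS hΔ x) := by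
  set σ := Fan.orbitCone x with hσ
  obtain ⟨y, hy⟩ : ∃ y : chart (RatFunc k) σ.1, S.ι (RatFunc k) σ y = x :=
    Fan.exists_ι_orbitCone_eq x
  set δ := liftCone hS hΔ σ with hδ
  have hσδ : σ.1.map (heightZero M) ≤ δ.1 := map_le_liftCone hS hΔ σ
  let z : chart k δ.1 := Spec.map (CommRingCat.ofHom (genericHom k σ.1 δ.1 hσδ)) y
  have hz : genericι k hS hΔ x = Δ.ι k δ z := by
    rw [← hy]
    exact congr_arg (fun f : chart (RatFunc k) σ.1 ⟶ _ => f y) (ι_genericι k hS hΔ σ δ hσδ)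
  rw [hz]
  obtain ⟨m, hm, hexp⟩ := Fan.exists_exposing (Fan.orbitCone_ι_le z)
  have h1 : AddMonoidAlgebra.single (⟨m, hm⟩ : dualMonoid δ.1) (1 : k) ∉ Fan.pointIdeal z :=
    (Fan.single_notMem_pointIdeal z ⟨m, hm⟩).mpr fun v hv =>
      (hexp v (Fan.orbitCone_ι_le z hv)).mp hv
  have h2 : AddMonoidAlgebra.single
      (⟨m.1, fst_mem_dualMonoid hσδ hm⟩ : dualMonoid σ.1) (1 : RatFunc k) ∉
      Fan.pointIdeal y := by
    intro h
    refine h1 ?_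
    change genericHom k σ.1 δ.1 hσδ _ ∈ Fan.pointIdeal y
    rw [genericHom_single, single_eq_mul]
    exact Ideal.mul_mem_left _ _ h
  rw [Fan.single_notMem_pointIdeal, hy] at h2
  rintro _ ⟨v, hv, rfl⟩
  refine (hexp _ ⟨v, hv, rfl⟩).mpr ?_
  have := h2 v hv
  change pt v 0 m = 0
  simpa using this

/-- The preimage of the chart of `δ` is the chart of the cone of `δ` at height zero. -/
lemma isPullback_ι_genericι (δ : Δ.Cone) :
    IsPullback (Spec.map (CommRingCat.ofHom (genericHom k (bottomCone hS δ).1 δ.1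
        (map_bottomCone_le hS δ)))) (S.ι (RatFunc k) (bottomCone hS δ)) (Δ.ι k δ) (genericι k hS hΔ) := by
  have h := ι_genericι k hS hΔ (bottomCone hS δ) δ (map_bottomCone_le hS δ)
  refine IsOpenImmersion.isPullback _ _ _ _ h (TopologicalSpace.Opens.ext (Set.ext fun x => ?_))
  change genericι k hS hΔ x ∈ Set.range (Δ.ι k δ) ↔ x ∈ Set.range (S.ι (RatFunc k) _)
  rw [Fan.mem_range_ι_iff, Fan.mem_range_ι_iff, le_bottomCone_iff hS hΔ]
  refine ⟨(orbitCone_genericι k hS hΔ x).trans, fun hx => ?_⟩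
  obtain ⟨y, rfl⟩ := Fan.mem_range_ι_iff.mpr ((le_bottomCone_iff hS hΔ).mpr hx)
  rw [← Fan.mem_range_ι_iff]
  exact ⟨_, (congr_arg (fun f : chart (RatFunc k) (bottomCone hS δ).1 ⟶ _ => f y) h).symm⟩

/-- The generic fiber is the toric variety of the fan at height zero. -/
theorem isPullback_genericι :
    IsPullback (genericι k hS hΔ) (S.structureMap (RatFunc k)) (toA1 k hΔ)
      (Spec.map (CommRingCat.ofHom (algebraMap (Polynomial k) (RatFunc k)))) := by
  refine Scheme.isPullback_of_openCover _ _ _ _ (Δ.openCover k) fun (δ : Δ.Cone) => ?_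
  have h1 := (isPullback_ι_genericι k hS hΔ δ).flip
  have h2 : IsPullback (Spec.map (CommRingCat.ofHom (genericHom k (bottomCone hS δ).1 δ.1
      (map_bottomCone_le hS δ)))) (Spec.map (CommRingCat.ofHom (algebraMap (RatFunc k)
        (semigroupRing (RatFunc k) (bottomCone hS δ).1)))) _ _ := isPullback_genericHom k (Δ.rational _ δ.2) (t_mem hΔ δ)
  have h3 : S.ι (RatFunc k) (bottomCone hS δ) ≫ S.structureMap (RatFunc k) = Spec.map
      (CommRingCat.ofHom (algebraMap (RatFunc k) (semigroupRing (RatFunc k) (bottomCone hS δ).1))) :=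
    colimit.ι_desc _ _
  change IsPullback (pullback.snd (genericι k hS hΔ) (Δ.ι k δ))
    (pullback.fst (genericι k hS hΔ) (Δ.ι k δ) ≫ S.structureMap (RatFunc k))
    (Δ.ι k δ ≫ toA1 k hΔ) _
  refine IsPullback.of_iso h2 h1.isoPullback (Iso.refl _) (Iso.refl _) (Iso.refl _) ?_ ?_ ?_ ?_
  · rw [h1.isoPullback_hom_snd]; exact Category.comp_id _
  · rw [← Category.assoc, h1.isoPullback_hom_fst, h3]; exact Category.comp_id _
  · rw [ι_toA1]; exact (Category.id_comp _).symm.trans (by simp)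
  · simp

end GenericFiber

/-! ### The degeneration -/

/-- A free abelian group of finite rank has unique sums, so that its semigroup rings are domains. -/
lemma uniqueSums_of_free (M : Type u) [AddCommGroup M] [Module.Free ℤ M] [Module.Finite ℤ M] :
    UniqueSums M :=
  let e := (Module.Free.chooseBasis ℤ M).repr
  UniqueSums.of_injective_addHom e.toAddEquiv.toAddHom e.injective inferInstance

end

end Toric

theorem proposition3p1 (k : Type u) [Field k] (M : Type u) [AddCommGroup M]
    [Module.Free ℤ M] [Module.Finite ℤ M]
    (Δ : Fan (M × ℤ)) (hΔ : Δ.support = halfSpace M)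
    (S : Fan M) (hS : S.cones = (fun δ => PointedCone.comap (heightZero M) δ) '' Δ.cones) :
    Surjective (toA1 k hΔ.subset) ∧
    -- the generic fiber is the toric variety of `S` over `k(t)`
    (∃ g : S.toricVariety (RatFunc k) ⟶ Δ.toricVariety k,
      (∀ (σ : S.Cone) (δ : Δ.Cone) (h : σ.1.map (heightZero M) ≤ δ.1),
        S.ι (RatFunc k) σ ≫ g =
          Spec.map (CommRingCat.ofHom (genericHom k σ.1 δ.1 h)) ≫ Δ.ι k δ) ∧
      IsPullback g (S.structureMap (RatFunc k)) (toA1 k hΔ.subset)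
        (Spec.map (CommRingCat.ofHom (algebraMap (Polynomial k) (RatFunc k))))) ∧
    -- the reduced special fiber
    (∃ (ι : ∀ P : Cell Δ, P.starVariety k ⟶ reducedSpecialFiber k hΔ.subset)
        (j : ∀ P Q : Cell Δ, P ≤ Q → (Q.starVariety k ⟶ P.starVariety k)),
      -- the embeddings of the strata, described on the toric charts
      (∀ P, IsClosedImmersion (ι P)) ∧
      (∀ (P : Cell Δ) (δ : Δ.Cone) (h : P.1 ≤ δ),
        (Δ.star P.1).ι k (Δ.starCone h) ≫ ι P ≫ reducedSpecialFiberι k hΔ.subset =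
          Spec.map (CommRingCat.ofHom (Δ.truncate k h)) ≫ Δ.ι k δ) ∧
      (∀ (P Q : Cell Δ) (h : P ≤ Q), j P Q h ≫ ι P = ι Q) ∧
      -- the special fiber is the union of the strata of the vertices
      (⋃ (V : Cell Δ) (_ : V.IsVertex), Set.range (ι V)) = Set.univ ∧
      -- the strata intersect according to the incidences of the cells
      (∀ (P Q R : Cell Δ) (h : IsLeast {R : Cell Δ | P ≤ R ∧ Q ≤ R} R),
        IsPullback (j P R h.1.1) (j Q R h.1.2) (ι P) (ι Q)) ∧
      (∀ P Q : Cell Δ, (¬ ∃ R : Cell Δ, P ≤ R ∧ Q ≤ R) →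
        Disjoint (Set.range (ι P)) (Set.range (ι Q))) ∧
      -- an edge gives a torus-invariant prime divisor in the stratum of each of its vertices
      (∀ (V E : Cell Δ) (h : V ≤ E), V.IsVertex → E.IsEdge →
        (Δ.star V.1).IsTorusInvariant k (Set.range (j V E h)) ∧
        IsPrimeDivisor (Set.range (j V E h))) ∧
      -- the special fiber is glued from the strata of the vertices along these divisors
      (∀ (T : Scheme.{u}) (g : ∀ V : Cell Δ, V.IsVertex → (V.starVariety k ⟶ T)),
        (∀ (V W E : Cell Δ) (hV : V.IsVertex) (hW : W.IsVertex) (hVE : V ≤ E) (hWE : W ≤ E),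
          E.IsEdge → j V E hVE ≫ g V hV = j W E hWE ≫ g W hW) →
        ∃! φ : reducedSpecialFiber k hΔ.subset ⟶ T,
          ∀ (V : Cell Δ) (hV : V.IsVertex), ι V ≫ φ = g V hV)) ∧
    -- the special fiber is itself reduced if all the vertices are lattice points
    ((∀ V : Cell Δ, V.IsVertex → ∃ n : M →+ ℤ, V.polyhedron = {toNR n}) →
      IsReduced (specialFiber k hΔ.subset)) := by
  have := uniqueSums_of_free M
  refine ⟨surjective_toA1 k hΔ, ⟨genericι k hS hΔ.subset, ι_genericι k hS hΔ.subset,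
    isPullback_genericι k hS hΔ.subset⟩, ⟨stratumι k hΔ.subset,
    fun P Q h => Δ.starHom k (show P.1 ≤ Q.1 from h), fun P => inferInstance, fun P δ h => ?_,
    fun P Q h => starHom_stratumι k hΔ.subset h, ?_,
    fun P Q R h => isPullback_stratumι k hΔ.subset h,
    fun P Q h => disjoint_range_stratumι k hΔ.subset h,
    fun V E h hV hE => isPrimeDivisor_range_starHom k hΔ.subset h hV hE,
    fun T g hg => existsUnique_stratumι_comp k hΔ.subset T g hg⟩,
    fun h => isReduced_specialFiber k hΔ.subset h⟩
  · rw [stratumι_comp]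
    exact Δ.ι_starι k h
  · refine Set.eq_univ_of_forall fun x => ?_
    obtain ⟨V, hV, hx⟩ := exists_vertex_mem_range k hΔ.subset x
    exact Set.mem_iUnion₂.mpr ⟨V, hV, hx⟩
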